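/- Let $i\mathsf{RCA}_0$ be the following two-sorted theory in intuitionistic predicate logic, with variables for natural numbers and for functions $\mathbb N\to\mathbb N$. Equality is primitive between numbers only. Number terms are built from number variables, $0$, successor, application of function variables, and definition by primitive recursion (with number and function parameters). The axioms are the equality axioms, $Sx\neq 0$, $Sx=Sy\to x=y$, the defining equations of primitive recursion, induction for quantifier-free formulas, and quantifier-free choice $\forall x\exists y\,A(x,y)\to\exists f\forall x\,A(x,f(x))$ for quantifier-free $A$ (parameters allowed in both schemes). In this theory the following notions are used, with primitive recursive bijective codings of pairs of numbers, of increasing pairs $(a,b)$, $a<b$, and of finite sequences of numbers $<n$. A function $t$ codes a tree $T\subseteq n^{<\mathbb N}$: a sequence $\sigma$ is in $T$ iff $t$ is positive at the codes of all initial segments of $\sigma$ (including $\sigma$ itself). A function $e$ codes a graph $G$ with vertex set $\mathbb N$: for $a<b$, $(a,b)$ is an edge iff $e$ is nonzero at the code of $(a,b)$. $G_m$ is the subgraph of $G$ induced on $\{0,\dots,m\}$. A $k$-coloring assigns to each vertex a number $<k$ such that adjacent vertices receive different numbers. * $\mathsf{WKL}n$: for every tree $T\subseteq n^{<\mathbb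 N}$, if for every $m$ there is $\sigma\in T$ of length $m$, then there is a function coding an infinite path through $T$, that is, a subtree $P\subseteq T$ containing the empty sequence in which every node has precisely one immediate successor. * $\mathsf{WKL}$ is $\mathsf{WKL}2$. * $\widehat{\mathsf{LLPO}}$: for every sequence $\langle p_i\rangle_{i\in\mathbb N}$ of functions $\mathbb N\to\mathbb N$ (given as one function on codes of pairs, $p_i(n)=p(\langle i,n\rangle)$) there is $f:\mathbb N\to\mathbb N$ such that for every $i$: if $f(i)=0$, then any $j$ with $p_i(j)\ne0$ and $p_i(t)=0$ for all $t<j$ is odd; and if $f(i)\neq0$, then $f(i)=1$ and any such $j$ is even. Here "$j$ is odd" means $\forall m\,(j\ne 2m)$ and "$j$ is even" means $\forall m\,(j\neq 2m+1)$. * $\mathsf{GC}k$: for every graph $G$ with vertex set $\mathbb N$, if every $G_m$ has a $k$-coloring, then there is $f:\mathbb N\to k$ that is a $k$-coloring of $G$. Then $i\mathsf{RCA}_0$ proves: for every $k\ge2$ the statements $\mathsf{WKL}$, $\widehat{\mathsf{LLPO}}$, $\mathsf{WKL}k$ and $\mathsf{GC}k$ are equivalent. -/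

import Mathlib

/-! Two-sorted intuitionistic arithmetic: number variables and variables for unary
functions from numbers to numbers.  Variables of each sort are de Bruijn indices; the two
sorts are indexed independently of each other. -/

namespace IRCA

/-- Number terms.  `app f t` is the value of the function variable number `f` at `t`.
`prec a b t` is definition by primitive recursion; it binds two number variables of `b`:
in `b`, variable `0` is the previous value and variable `1` is the stage, that is
`prec a b 0 = a` and `prec a b (t + 1) = b(prec a b t, t)`. As `b` may contain function
variables, terms are closed under primitive recursion relative to function parameters. -/
inductive Term : Type
  | var (n : ℕ)
  | zero
  | succ (t : Term)
  | app (f : ℕ) (t : Term)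
  | prec (a b t : Term)

prefix:max "♯" => Term.var

/-- Extension of a renaming under a binder. -/
def liftRen (ρ : ℕ → ℕ) : ℕ → ℕ
  | 0 => 0
  | n + 1 => ρ n + 1

namespace Term

/-- Rename number variables by `ρ` and function variables by `τ`. -/
def ren : Term → (ℕ → ℕ) → (ℕ → ℕ) → Term
  | var n, ρ, _ => var (ρ n)
  | zero, _, _ => zero
  | succ t, ρ, τ => succ (t.ren ρ τ)
  | app f t, ρ, τ => app (τ f) (t.ren ρ τ)
  | prec a b t, ρ, τ => prec (a.ren ρ τ) (b.ren (liftRen (liftRen ρ)) τ) (t.ren ρ τ)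

/-- Weakening by one number variable. -/
def sh (t : Term) : Term := t.ren Nat.succ id

/-- Weakening by one function variable. -/
def shF (t : Term) : Term := t.ren id Nat.succ

end Term

/-- The substitution `0 ↦ t`, `n + 1 ↦ σ n`. -/
def scons (t : Term) (σ : ℕ → Term) : ℕ → Term
  | 0 => t
  | n + 1 => σ n

/-- Extension of a substitution under a binder for a number variable. -/
def liftSub (σ : ℕ → Term) : ℕ → Term := scons ♯0 (fun n => (σ n).sh)

/-- The renaming `0 ↦ g`, `n + 1 ↦ n` of function variables. -/
def fcons (g : ℕ) : ℕ → ℕ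
  | 0 => g
  | n + 1 => n

/-- Simultaneous capture-avoiding substitution of terms for number variables and of function
variables for function variables. -/
def Term.sub : Term → (ℕ → Term) → (ℕ → ℕ) → Term
  | .var n, σ, _ => σ n
  | .zero, _, _ => .zero
  | .succ t, σ, τ => .succ (t.sub σ τ)
  | .app f t, σ, τ => .app (τ f) (t.sub σ τ)
  | .prec a b t, σ, τ => .prec (a.sub σ τ) (b.sub (liftSub (liftSub σ)) τ) (t.sub σ τ)

/-- Formulas: equality is primitive between numbers only. `allN`, `exN` quantify over
numbers, `allF`, `exF` over functions. -/
inductive Formula : Type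
  | eq (s t : Term)
  | bot
  | and (A B : Formula)
  | or (A B : Formula)
  | imp (A B : Formula)
  | allN (A : Formula)
  | exN (A : Formula)
  | allF (A : Formula)
  | exF (A : Formula)

infix:55 " ≐ " => Formula.eq
infixr:45 " ⩑ " => Formula.and
infixr:40 " ⇛ " => Formula.imp

namespace Formula

/-- Negation. -/
def neg (A : Formula) : Formula := A ⇛ bot

/-- Biconditional. -/
def iff (A B : Formula) : Formula := (A ⇛ B) ⩑ (B ⇛ A)

/-- Simultaneous capture-avoiding substitution. -/
def sub : Formula → (ℕ → Term) → (ℕ → ℕ) → Formula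
  | eq s t, σ, τ => eq (s.sub σ τ) (t.sub σ τ)
  | bot, _, _ => bot
  | and A B, σ, τ => and (A.sub σ τ) (B.sub σ τ)
  | or A B, σ, τ => or (A.sub σ τ) (B.sub σ τ)
  | imp A B, σ, τ => imp (A.sub σ τ) (B.sub σ τ)
  | allN A, σ, τ => allN (A.sub (liftSub σ) τ)
  | exN A, σ, τ => exN (A.sub (liftSub σ) τ)
  | allF A, σ, τ => allF (A.sub (fun n => (σ n).shF) (liftRen τ))
  | exF A, σ, τ => exF (A.sub (fun n => (σ n).shF) (liftRen τ))

/-- Weakening by one number variable. -/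
def sh (A : Formula) : Formula := A.sub (fun n => ♯(n + 1)) id

/-- Weakening by one function variable. -/
def shF (A : Formula) : Formula := A.sub Term.var Nat.succ

/-- Instantiation of the outermost number variable by a term. -/
def inst (A : Formula) (t : Term) : Formula := A.sub (scons t Term.var) id

/-- Instantiation of the outermost function variable by a function variable. -/
def instF (A : Formula) (g : ℕ) : Formula := A.sub Term.var (fcons g)

/-- Quantifier-free formulas. -/
def QF : Formula → Prop
  | eq _ _ => True
  | bot => True
  | and A B => A.QF ∧ B.QF
  | or A B => A.QF ∧ B.QF
  | imp A B => A.QF ∧ B.QF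
  | allN _ => False
  | exN _ => False
  | allF _ => False
  | exF _ => False

end Formula

open Formula in
/-- Derivability of `A` from the hypotheses `Γ` in intuitionistic two-sorted predicate logic
with equality, with the members of `T` as axioms (free variables of axioms are read
universally). -/
inductive Proves (T : Set Formula) : List Formula → Formula → Prop
  | ax {Γ A} : A ∈ T → Proves T Γ A
  | hyp {Γ A} : A ∈ Γ → Proves T Γ A
  | botE {Γ A} : Proves T Γ bot → Proves T Γ A
  | andI {Γ A B} : Proves T Γ A → Proves T Γ B → Proves T Γ (A ⩑ B)
  | andE₁ {Γ A B} : Proves T Γ (A ⩑ B) → Proves T Γ A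
  | andE₂ {Γ A B} : Proves T Γ (A ⩑ B) → Proves T Γ B
  | orI₁ {Γ A B} : Proves T Γ A → Proves T Γ (or A B)
  | orI₂ {Γ A B} : Proves T Γ B → Proves T Γ (or A B)
  | orE {Γ A B C} : Proves T Γ (or A B) → Proves T (A :: Γ) C → Proves T (B :: Γ) C →
      Proves T Γ C
  | impI {Γ A B} : Proves T (A :: Γ) B → Proves T Γ (A ⇛ B)
  | impE {Γ A B} : Proves T Γ (A ⇛ B) → Proves T Γ A → Proves T Γ B
  | allNI {Γ A} : Proves T (Γ.map sh) A → Proves T Γ (allN A)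
  | allNE {Γ A} (t : Term) : Proves T Γ (allN A) → Proves T Γ (A.inst t)
  | exNI {Γ A} (t : Term) : Proves T Γ (A.inst t) → Proves T Γ (exN A)
  | exNE {Γ A B} : Proves T Γ (exN A) → Proves T (A :: Γ.map sh) B.sh → Proves T Γ B
  | allFI {Γ A} : Proves T (Γ.map shF) A → Proves T Γ (allF A)
  | allFE {Γ A} (g : ℕ) : Proves T Γ (allF A) → Proves T Γ (A.instF g)
  | exFI {Γ A} (g : ℕ) : Proves T Γ (A.instF g) → Proves T Γ (exF A)
  | exFE {Γ A B} : Proves T Γ (exF A) → Proves T (A :: Γ.map shF) B.shF → Proves T Γ B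
  | eqRefl {Γ} (t : Term) : Proves T Γ (t ≐ t)
  | eqSubst {Γ} (A : Formula) {s t : Term} : Proves T Γ (s ≐ t) → Proves T Γ (A.inst s) →
      Proves T Γ (A.inst t)

/-- The axioms of `iRCA₀` (intuitionistic logic, function-based): successor axioms, defining
equations of primitive recursion, quantifier-free induction, and quantifier-free choice from
numbers to numbers (which gives closure under recursive definition of functions). -/
inductive iRCA0 : Set Formula
  | succ_ne_zero (t : Term) : iRCA0 (Formula.neg (.succ t ≐ .zero))
  | succ_inj (s t : Term) : iRCA0 ((.succ s ≐ .succ t) ⇛ (s ≐ t))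
  | prec_zero (a b : Term) : iRCA0 (.prec a b .zero ≐ a)
  | prec_succ (a b t : Term) : iRCA0
      (.prec a b (.succ t) ≐ b.sub (scons (.prec a b t) (scons t Term.var)) id)
  /- `A(0) ∧ ∀ x (A(x) → A(x + 1)) → ∀ x A(x)` -/
  | ind (A : Formula) : A.QF → iRCA0
      ((A.inst .zero ⩑ .allN (A ⇛ A.sub (scons (.succ ♯0) (fun n => ♯(n + 1))) id)) ⇛ .allN A)
  /- `∀ x ∃ y A(x, y) → ∃ f ∀ x A(x, f x)`; in `A`, variable `0` is `y` and `1` is `x` -/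
  | choice (A : Formula) : A.QF → iRCA0
      (.allN (.exN A) ⇛ .exF (.allN (A.sub (scons (.app 0 ♯0) Term.var) Nat.succ)))

/-! ### Primitive recursive functions as terms -/

namespace Term

def one : Term := succ zero

def two : Term := succ one

def add (s t : Term) : Term := prec s (succ ♯0) t

def mul (s t : Term) : Term := prec zero (add ♯0 s.sh.sh) t

/-- Predecessor, with value `0` at `0`. -/
def pred (t : Term) : Term := prec zero ♯1 t

/-- Truncated subtraction. -/
def tsub (s t : Term) : Term := prec s (pred ♯0) t

/-- `t (t - 1) / 2`. -/
def tri (t : Term) : Term := prec zero (add ♯0 ♯1) t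

/-- `a + b (b - 1) / 2`: on the pairs with `a < b`, a bijection onto the numbers. -/
def edgeCode (a b : Term) : Term := add (tri b) a

/-- A bijective code of all pairs `(i, n)`: the code of the increasing pair `(i, i + n + 1)`. -/
def pair (i n : Term) : Term := edgeCode i (succ (add i n))

/-- The quotient `⌊x / k⌋`, as the number of `i < x` with `(i + 1) k ≤ x` (for `k ≥ 1`). -/
def div (x k : Term) : Term :=
  prec zero (add ♯0 (tsub one (tsub (mul (succ ♯1) k.sh.sh) x.sh.sh))) x

/-! Finite sequences of numbers `< k` (for `k ≥ 1`) are coded by all numbers, in bijective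
base-`k` numeration: the empty sequence has code `0`, and if `σ` has code `c` then the sequence
`σ` followed by the entry `i < k` has code `k c + i + 1`. -/

/-- The code of the sequence coded by `c` followed by the entry `i`. -/
def snoc (k c i : Term) : Term := succ (add (mul k c) i)

/-- The code of the sequence coded by `c` without its last entry (`0` at `0`). -/
def parent (k c : Term) : Term := div (pred c) k

/-- The last entry of the (nonempty) sequence coded by `c`. -/
def last (k c : Term) : Term := tsub (pred c) (mul k (parent k c))

/-- The code of the sequence coded by `c` without its last `j` entries (the empty sequence if
there are at most `j` entries). As `j` varies these are all its initial segments. -/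
def cut (k c j : Term) : Term := prec c (parent k.sh.sh ♯0) j

/-- The length of the sequence coded by `c`, as the number of `j < c` with `cut k c j ≠ 0`. -/
def len (k c : Term) : Term :=
  prec zero (add ♯0 (tsub one (tsub one (cut k.sh.sh c.sh.sh ♯1)))) c

/-- The entry with index `i` (counted from `0`) of the sequence coded by `c`. -/
def entry (k c i : Term) : Term := last k (cut k c (tsub (len k c) (succ i)))

end Term

/-! ### The four principles -/

namespace Formula

open Term

/-- `s ≤ t` -/
def le (s t : Term) : Formula := tsub s t ≐ zero

/-- `s < t` -/
def lt (s t : Term) : Formula := le (succ s) t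

/-- The function variable `t` viewed as a code of a tree of sequences of numbers `< k`: the
sequence coded by `c` is in the tree iff `t` is positive at all its initial segments. -/
def inTree (k : Term) (t : ℕ) (c : Term) : Formula :=
  allN (lt zero (app t (cut k.sh c.sh ♯0)))

/-- For every `m` the tree coded by `t` has an element of length `m`.
(Inside, variable `1` is `m` and variable `0` is the code of the element.) -/
def infiniteTree (k : Term) (t : ℕ) : Formula :=
  allN (exN ((len k.sh.sh ♯0 ≐ ♯1) ⩑ inTree k.sh.sh t ♯0))

/-- `p` codes an infinite path through the tree coded by `t`: a subtree containing the empty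
sequence in which every node has precisely one immediate successor.
(Inside, the bound variables are a node `c`, then an entry `i`, then an entry `j`.) -/
def isPath (k : Term) (t p : ℕ) : Formula :=
  inTree k p zero ⩑
  allN (inTree k.sh p ♯0 ⇛
    (inTree k.sh t ♯0 ⩑
     exN (lt ♯0 k.sh.sh ⩑ inTree k.sh.sh p (snoc k.sh.sh ♯1 ♯0) ⩑
       allN (lt ♯0 k.sh.sh.sh ⇛ inTree k.sh.sh.sh p (snoc k.sh.sh.sh ♯2 ♯0) ⇛ (♯0 ≐ ♯1)))))

/-- Weak König's lemma for trees of sequences of numbers `< k`. -/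
def WKLn (k : Term) : Formula :=
  allF (infiniteTree k.shF 0 ⇛ exF (isPath k.shF.shF 1 0))

/-- Weak König's lemma (for binary trees). -/
def WKL : Formula := WKLn two

/-- `j` is the first argument at which the `i`-th function `n ↦ p(⟨i, n⟩)` is not `0`. -/
def isFirst (p : ℕ) (i j : Term) : Formula :=
  neg (app p (pair i j) ≐ zero) ⩑ allN (lt ♯0 j.sh ⇛ (app p (pair i.sh ♯0) ≐ zero))

/-- `n` is a correct value of `LLPO` for the `i`-th function `n ↦ p(⟨i, n⟩)`.
(Inside, the bound variables are `j`, then `m`.) -/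
def isLLPO (p : ℕ) (i n : Term) : Formula :=
  ((n ≐ zero) ⇛
    allN (isFirst p i.sh ♯0 ⇛ allN (neg (♯1 ≐ mul two ♯0)))) ⩑
  (neg (n ≐ zero) ⇛
    ((n ≐ one) ⩑ allN (isFirst p i.sh ♯0 ⇛ allN (neg (♯1 ≐ succ (mul two ♯0))))))

/-- The parallelization of the lesser limited principle of omniscience. -/
def LLPOhat : Formula := allF (exF (allN (isLLPO 1 ♯0 (app 0 ♯0))))

/-- `(a, b)`, where `a < b`, is an edge of the graph on the natural numbers coded by `e`. -/
def edge (e : ℕ) (a b : Term) : Formula := neg (app e (edgeCode a b) ≐ zero)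

/-- The finite subgraph with vertices `0, …, m` of the graph coded by `e` has a `k`-coloring,
coded as a sequence of length `m + 1` of numbers `< k`.
(Inside, the bound variables are the code `c`, then `a`, then `b`.) -/
def finColorable (k : Term) (e : ℕ) (m : Term) : Formula :=
  exN ((len k.sh ♯0 ≐ succ m.sh) ⩑
    allN (allN (lt ♯1 ♯0 ⇛ le ♯0 m.sh.sh.sh ⇛ edge e ♯1 ♯0 ⇛
      neg (entry k.sh.sh.sh ♯2 ♯1 ≐ entry k.sh.sh.sh ♯2 ♯0))))

/-- `f` is a `k`-coloring of the graph coded by `e`. -/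
def isColoring (k : Term) (e f : ℕ) : Formula :=
  allN (lt (app f ♯0) k.sh) ⩑
  allN (allN (lt ♯1 ♯0 ⇛ edge e ♯1 ♯0 ⇛ neg (app f ♯1 ≐ app f ♯0)))

/-- Every locally `k`-colorable infinite graph has a `k`-coloring. -/
def GC (k : Term) : Formula :=
  allF (allN (finColorable k.shF.sh 0 ♯0) ⇛ exF (isColoring k.shF.shF 1 0))

end Formula

end IRCA

/-! ### Substitution calculus, derived rules and decidability of quantifier-free formulas -/

namespace IRCA

/-! ### Substitution -/

/-! Everything is routed through the parallelized LLPO, with `k ≥ 2` a number variable of the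
theory: the four derivations are `llpo_of_wkl`, `wkl_of_llpo`, `gc_of_wkl` and `llpo_of_gc`, and the
binary case is the instance `k = 2`.

Trees yield LLPO values and colorings in the same way: the tree consists of the finite
approximations not refuted so far, and a path through it is a solution. For the converse, call a
node dead at height `m` if it has no extension by `m` entries in the tree. For a node `c` and an
entry `i`, LLPO is asked whether the child `c⌢i` dies before all its right siblings do. Answer `0`
guarantees that if the child is dead at height `m`, so are its right siblings; any other answer
guarantees the reverse. Moving from `c` to the first child with answer `0`, or to the last child if
there is none, one gets: if the chosen child is dead at height `m`, all children are, so `c` is dead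
at height `m + 1` (`dead_step`). As the root of an infinite tree is never dead, the walk stays in
the tree (`alive_follow`).

From colorings to LLPO: `k - 2` vertices joined to everything use up `k - 2` colors. Two colors
remain for a reference vertex and for infinitely many paths, the `i`-th of which is joined to the
reference vertex at the position where the `i`-th function is first nonzero. Comparing the color at
the start of the path with the reference color tells which parity is impossible (`color_values`).

The arithmetic behind these arguments is not derived formally but transferred from models.
Quantifier-free formulas have characteristic terms and are therefore decidable in the theory
(`Proves.em`). If `Γ` does not derive `G`, Zorn's lemma gives a deductively closed theory containing
`Γ`, still without `G`, that decides all quantifier-free formulas (`exists_complete`). Its terms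
modulo provable equality form a structure with quantifier-free induction; the point there is that
the induction step is known only term by term, which is overcome by the search term `climb`. So a
goal of suitable syntactic shape that is true in all such structures is derivable
(`proves_of_valid`), even though the logic is intuitionistic. Only function quantifiers, choice and
number quantifiers outside these shapes are treated by explicit rules. The rest is ordinary
mathematics in a structure `M`, in which `k` may be nonstandard and induction is restricted to
definable predicates. -/

theorem liftSub_var (ρ : ℕ → ℕ) : liftSub (fun n => ♯(ρ n)) = fun n => ♯(liftRen ρ n) := by
  funext n; cases n <;> rfl

theorem liftRen_comp (ρ ρ' : ℕ → ℕ) :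
    (fun n => liftRen ρ' (liftRen ρ n)) = liftRen (fun n => ρ' (ρ n)) := by
  funext n; cases n <;> rfl

theorem liftRen_id : liftRen (fun n => n) = fun n => n := by
  funext n; cases n <;> rfl

namespace Term

theorem ren_eq_sub (t : Term) : ∀ ρ τ, t.ren ρ τ = t.sub (fun n => ♯(ρ n)) τ := by
  induction t with
  | var n => intros; rfl
  | zero => intros; rfl
  | succ t ih => intros; simp [ren, sub, ih]
  | app f t ih => intros; simp [ren, sub, ih]
  | prec a b t iha ihb iht => intros; simp [ren, sub, iha, ihb, iht, liftSub_var]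

theorem sub_ren (t : Term) : ∀ ρ τ σ τ',
    (t.ren ρ τ).sub σ τ' = t.sub (fun n => σ (ρ n)) (fun n => τ' (τ n)) := by
  induction t with
  | var n => intros; rfl
  | zero => intros; rfl
  | succ t ih => intros; simp [ren, sub, ih]
  | app f t ih => intros; simp [ren, sub, ih]
  | prec a b t iha ihb iht =>
    intro ρ τ σ τ'
    have h (ρ : ℕ → ℕ) (σ : ℕ → Term) :
        (fun n => liftSub σ (liftRen ρ n)) = liftSub (fun n => σ (ρ n)) := by
      funext n; cases n <;> rfl
    simp [ren, sub, iha, ihb, iht, h]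

theorem sub_var (t : Term) : t.sub var (fun n => n) = t := by
  induction t with
  | var n => rfl
  | zero => rfl
  | succ t ih => simp [sub, ih]
  | app f t ih => simp [sub, ih]
  | prec a b t iha ihb iht =>
    have h : liftSub var = var := by funext n; cases n <;> rfl
    simp [sub, iha, ihb, iht, h]

@[simp] theorem sub_var_id (t : Term) : t.sub var id = t := sub_var t

theorem ren_ren (t : Term) (ρ τ ρ' τ') :
    (t.ren ρ τ).ren ρ' τ' = t.ren (fun n => ρ' (ρ n)) (fun n => τ' (τ n)) := by
  rw [ren_eq_sub _ ρ', sub_ren, ren_eq_sub]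

theorem ren_sub (t : Term) : ∀ σ τ ρ τ',
    (t.sub σ τ).ren ρ τ' = t.sub (fun n => (σ n).ren ρ τ') (fun n => τ' (τ n)) := by
  induction t with
  | var n => intros; rfl
  | zero => intros; rfl
  | succ t ih => intros; simp [ren, sub, ih]
  | app f t ih => intros; simp [ren, sub, ih]
  | prec a b t iha ihb iht =>
    intro σ τ ρ τ'
    have h (ρ : ℕ → ℕ) (σ : ℕ → Term) :
        (fun n => (liftSub σ n).ren (liftRen ρ) τ') = liftSub (fun n => (σ n).ren ρ τ') := by
      funext n
      cases n with
      | zero => rfl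
      | succ n => simp only [liftSub, scons, sh, ren_ren]; rfl
    simp [ren, sub, iha, ihb, iht, h]

theorem sh_sub (t : Term) (σ τ) : t.sh.sub σ τ = t.sub (fun n => σ (n + 1)) τ := sub_ren ..

theorem shF_sub (t : Term) (σ τ) : t.shF.sub σ τ = t.sub σ (fun n => τ (n + 1)) := sub_ren ..

theorem sub_sh (t : Term) (σ τ) : (t.sub σ τ).sh = t.sub (fun n => (σ n).sh) τ := ren_sub ..

theorem sub_shF (t : Term) (σ τ) :
    (t.sub σ τ).shF = t.sub (fun n => (σ n).shF) (fun n => τ n + 1) := ren_sub ..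

theorem sh_eq_sub (t : Term) : t.sh = t.sub (fun n => ♯(n + 1)) id := ren_eq_sub ..

theorem shF_eq_sub (t : Term) : t.shF = t.sub var Nat.succ := ren_eq_sub ..

@[simp] theorem sh_sub_liftSub (t : Term) (σ τ) : t.sh.sub (liftSub σ) τ = (t.sub σ τ).sh := by
  rw [sh_sub, sub_sh]; rfl

@[simp] theorem sh_inst (s t : Term) : s.sh.sub (scons t var) id = s := by
  rw [sh_sub]; exact sub_var s

end Term

theorem liftSub_comp (σ σ' : ℕ → Term) (τ') :
    (fun n => (liftSub σ n).sub (liftSub σ') τ') = liftSub (fun n => (σ n).sub σ' τ') := by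
  funext n
  cases n with
  | zero => rfl
  | succ n => exact Term.sh_sub_liftSub ..

theorem Term.sub_sub (t : Term) : ∀ σ τ σ' τ',
    (t.sub σ τ).sub σ' τ' = t.sub (fun n => (σ n).sub σ' τ') (fun n => τ' (τ n)) := by
  induction t with
  | var n => intros; rfl
  | zero => intros; rfl
  | succ t ih => intros; simp [sub, ih]
  | app f t ih => intros; simp [sub, ih]
  | prec a b t iha ihb iht => intros; simp [sub, iha, ihb, iht, liftSub_comp]

theorem Formula.sub_sub (A : Formula) : ∀ σ τ σ' τ',
    (A.sub σ τ).sub σ' τ' = A.sub (fun n => (σ n).sub σ' τ') (fun n => τ' (τ n)) := by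
  induction A with
  | eq s t => intros; simp [sub, Term.sub_sub]
  | bot => intros; rfl
  | and A B ihA ihB => intros; simp [sub, ihA, ihB]
  | or A B ihA ihB => intros; simp [sub, ihA, ihB]
  | imp A B ihA ihB => intros; simp [sub, ihA, ihB]
  | allN A ih => intros; simp [sub, ih, liftSub_comp]
  | exN A ih => intros; simp [sub, ih, liftSub_comp]
  | allF A ih =>
    intros
    simp only [sub, ih, Term.shF_sub, Term.sub_shF, liftRen_comp]; rfl
  | exF A ih =>
    intros
    simp only [sub, ih, Term.shF_sub, Term.sub_shF, liftRen_comp]; rfl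

theorem Formula.sub_var (A : Formula) : A.sub Term.var (fun n => n) = A := by
  have h : liftSub Term.var = Term.var := by funext n; cases n <;> rfl
  have h' : (fun n => (♯n).shF) = Term.var := rfl
  induction A with
  | eq s t => simp [sub, Term.sub_var]
  | bot => rfl
  | and A B ihA ihB => simp [sub, ihA, ihB]
  | or A B ihA ihB => simp [sub, ihA, ihB]
  | imp A B ihA ihB => simp [sub, ihA, ihB]
  | allN A ih => simp [sub, ih, h]
  | exN A ih => simp [sub, ih, h]
  | allF A ih => simp only [sub, h', liftRen_id, ih]
  | exF A ih => simp only [sub, h', liftRen_id, ih]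

theorem Formula.QF.sub {A : Formula} (h : A.QF) (σ τ) : (A.sub σ τ).QF := by
  induction A with
  | eq | bot => trivial
  | and A B ihA ihB => exact ⟨ihA h.1, ihB h.2⟩
  | or A B ihA ihB => exact ⟨ihA h.1, ihB h.2⟩
  | imp A B ihA ihB => exact ⟨ihA h.1, ihB h.2⟩
  | _ => exact h.elim

/-! ### Derived rules -/

infix:25 " ⊩ " => Proves iRCA0

open Formula Term

theorem Proves.weaken {T : Set Formula} {Γ : List Formula} {A} (h : Proves T Γ A) :
    ∀ {Δ}, Γ ⊆ Δ → Proves T Δ A := by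
  induction h with
  | ax h => exact fun _ => .ax h
  | hyp h => exact fun hs => .hyp (hs h)
  | botE _ ih => exact fun hs => .botE (ih hs)
  | andI _ _ ih ih' => exact fun hs => .andI (ih hs) (ih' hs)
  | andE₁ _ ih => exact fun hs => .andE₁ (ih hs)
  | andE₂ _ ih => exact fun hs => .andE₂ (ih hs)
  | orI₁ _ ih => exact fun hs => .orI₁ (ih hs)
  | orI₂ _ ih => exact fun hs => .orI₂ (ih hs)
  | orE _ _ _ ih ih₁ ih₂ =>
    exact fun hs => .orE (ih hs) (ih₁ (List.cons_subset_cons _ hs))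
      (ih₂ (List.cons_subset_cons _ hs))
  | impI _ ih => exact fun hs => .impI (ih (List.cons_subset_cons _ hs))
  | impE _ _ ih ih' => exact fun hs => .impE (ih hs) (ih' hs)
  | allNI _ ih => exact fun hs => .allNI (ih (List.map_subset _ hs))
  | allNE t _ ih => exact fun hs => .allNE t (ih hs)
  | exNI t _ ih => exact fun hs => .exNI t (ih hs)
  | exNE _ _ ih ih' =>
    exact fun hs => .exNE (ih hs) (ih' (List.cons_subset_cons _ (List.map_subset _ hs)))
  | allFI _ ih => exact fun hs => .allFI (ih (List.map_subset _ hs))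
  | allFE t _ ih => exact fun hs => .allFE t (ih hs)
  | exFI t _ ih => exact fun hs => .exFI t (ih hs)
  | exFE _ _ ih ih' =>
    exact fun hs => .exFE (ih hs) (ih' (List.cons_subset_cons _ (List.map_subset _ hs)))
  | eqRefl t => exact fun _ => .eqRefl t
  | eqSubst A _ _ ih ih' => exact fun hs => .eqSubst A (ih hs) (ih' hs)

variable {Γ : List Formula} {A B C : Formula} {s t u : Term}

theorem Proves.here : A :: Γ ⊩ A := .hyp List.mem_cons_self

theorem Proves.wk (h : Γ ⊩ A) : B :: Γ ⊩ A := h.weaken (List.subset_cons_self _ _)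

theorem Proves.cut (h : Γ ⊩ A) (h' : A :: Γ ⊩ B) : Γ ⊩ B := .impE (.impI h') h

theorem Proves.subst (A : Formula) (h : Γ ⊩ s ≐ t) (h' : Γ ⊩ A.sub (scons s var) id) :
    Γ ⊩ A.sub (scons t var) id := .eqSubst A h h'

/-- Leibniz substitution into an equation whose left side is weakened, so that only the right side
contains the variable being replaced. Symmetry and transitivity come from the same device. -/
theorem Proves.congr (c : Term) (h : Γ ⊩ s ≐ t) :
    Γ ⊩ c.sub (scons s var) id ≐ c.sub (scons t var) id := by
  have := Proves.subst ((c.sub (scons s var) id).sh ≐ c) h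
    (by simp only [Formula.sub, sh_inst]; exact .eqRefl _)
  simpa only [Formula.sub, sh_inst] using this

theorem Proves.symm (h : Γ ⊩ s ≐ t) : Γ ⊩ t ≐ s := by
  have := Proves.subst (♯0 ≐ s.sh) h
    (by simp only [Formula.sub, sh_inst]; exact .eqRefl _)
  simpa only [Formula.sub, sh_inst, Term.sub, scons] using this

theorem Proves.trans (h : Γ ⊩ s ≐ t) (h' : Γ ⊩ t ≐ u) : Γ ⊩ s ≐ u := by
  have := Proves.subst (s.sh ≐ ♯0) h' (by simpa only [Formula.sub, sh_inst, Term.sub, scons] using h)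
  simpa only [Formula.sub, sh_inst, Term.sub, scons] using this

theorem Proves.succ_congr (h : Γ ⊩ s ≐ t) : Γ ⊩ succ s ≐ succ t := Proves.congr (succ ♯0) h

theorem Proves.succ_inj (h : Γ ⊩ succ s ≐ succ t) : Γ ⊩ s ≐ t := .impE (.ax (.succ_inj s t)) h

theorem Proves.succ_zero (h : Γ ⊩ succ s ≐ zero) : Γ ⊩ A :=
  .botE (.impE (.ax (.succ_ne_zero s)) h)

theorem Proves.prec_zero (a b : Term) : Γ ⊩ prec a b zero ≐ a := .ax (.prec_zero a b)

theorem Proves.prec_succ (a b t : Term) :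
    Γ ⊩ prec a b (succ t) ≐ b.sub (scons (prec a b t) (scons t var)) id := .ax (.prec_succ a b t)

theorem Proves.prec_congr (a b : Term) (h : Γ ⊩ s ≐ t) : Γ ⊩ prec a b s ≐ prec a b t := by
  -- Number variable `0` marks the place of `s`; the parameters of `a` and `b` are shifted past it,
  -- in `b` underneath its two bound variables.
  have := Proves.congr (prec a.sh (b.sub (liftSub (liftSub fun n => ♯(n + 1))) id) ♯0) h
  simpa only [Term.sub, sh_inst, Term.sub_sub, liftSub_comp, scons, id,
    show liftSub (liftSub var) = var by funext n; rcases n with _ | _ | n <;> rfl,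
    Term.sub_var] using this

theorem Proves.prec_congr_left (b t : Term) {a a' : Term} (h : Γ ⊩ a ≐ a') :
    Γ ⊩ prec a b t ≐ prec a' b t := by
  have := Proves.congr (prec ♯0 (b.sub (liftSub (liftSub fun n => ♯(n + 1))) id) t.sh) h
  simpa only [Term.sub, sh_inst, Term.sub_sub, liftSub_comp, scons, id,
    show liftSub (liftSub var) = var by funext n; rcases n with _ | _ | n <;> rfl,
    Term.sub_var] using this

theorem Proves.prec_of_zero (a b : Term) (h : Γ ⊩ t ≐ zero) : Γ ⊩ prec a b t ≐ a :=
  (Proves.prec_congr a b h).trans (.prec_zero a b)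

theorem Proves.prec_of_succ (a b : Term) (h : Γ ⊩ t ≐ succ u) :
    Γ ⊩ prec a b t ≐ b.sub (scons (prec a b u) (scons u var)) id :=
  (Proves.prec_congr a b h).trans (.prec_succ a b u)

/-- Induction for a quantifier-free formula. -/
theorem Proves.ind (hA : A.QF) (h0 : Γ ⊩ A.sub (scons zero var) id)
    (hs : A :: Γ.map Formula.sh ⊩ A.sub (scons (succ ♯0) fun n => ♯(n + 1)) id) (t : Term) :
    Γ ⊩ A.sub (scons t var) id :=
  .allNE t (.impE (.ax (.ind A hA)) (.andI h0 (.allNI (.impI hs))))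

theorem Term.add_sub (s t : Term) (σ τ) : (add s t).sub σ τ = add (s.sub σ τ) (t.sub σ τ) := rfl

theorem Term.pred_sub (t : Term) (σ τ) : (pred t).sub σ τ = pred (t.sub σ τ) := rfl

theorem Term.tsub_sub (s t : Term) (σ τ) :
    (tsub s t).sub σ τ = tsub (s.sub σ τ) (t.sub σ τ) := rfl

/-! ### Arithmetic of predecessor and truncated subtraction -/

theorem Term.sh_step (t : Term) :
    t.sh.sub (scons (succ ♯0) fun n => ♯(n + 1)) id = t.sh := by
  rw [sh_sub, sh_eq_sub]; rfl

namespace Derive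

theorem pred_succ (t : Term) : Γ ⊩ pred (succ t) ≐ t := .prec_succ zero ♯1 t

theorem pred_congr (h : Γ ⊩ s ≐ t) : Γ ⊩ pred s ≐ pred t := .prec_congr _ _ h

/-- The source of all decidability in the theory: later case distinctions reduce to whether some
term vanishes, and this one is proved by induction on a quantifier-free disjunction. -/
theorem zero_or_succ (t : Term) : Γ ⊩ or (t ≐ zero) (t ≐ succ (pred t)) :=
  Proves.ind (A := or (♯0 ≐ zero) (♯0 ≐ succ (pred ♯0))) ⟨trivial, trivial⟩
    (.orI₁ (.eqRefl _)) (.orI₂ (Proves.succ_congr (pred_succ _).symm)) t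

theorem cases_zero_succ (t : Term) (h0 : (t ≐ zero) :: Γ ⊩ C)
    (hs : (t ≐ succ (pred t)) :: Γ ⊩ C) : Γ ⊩ C :=
  .orE (zero_or_succ t) h0 hs

theorem tsub_zero (s : Term) : Γ ⊩ tsub s zero ≐ s := .prec_zero ..

theorem tsub_succ (s t : Term) : Γ ⊩ tsub s (succ t) ≐ pred (tsub s t) := .prec_succ ..

theorem tsub_congr_left (h : Γ ⊩ s ≐ t) : Γ ⊩ tsub s u ≐ tsub t u := .prec_congr_left _ _ h

theorem tsub_congr_right (h : Γ ⊩ s ≐ t) : Γ ⊩ tsub u s ≐ tsub u t := .prec_congr _ _ h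

theorem add_zero (s : Term) : Γ ⊩ add s zero ≐ s := .prec_zero ..

theorem add_succ (s t : Term) : Γ ⊩ add s (succ t) ≐ succ (add s t) := .prec_succ ..

theorem zero_add (t : Term) : Γ ⊩ add zero t ≐ t :=
  Proves.ind (A := add zero ♯0 ≐ ♯0) trivial (add_zero _)
    ((add_succ _ _).trans (Proves.succ_congr .here)) t

theorem succ_add (s t : Term) : Γ ⊩ add (succ s) t ≐ succ (add s t) := by
  have := Proves.ind (Γ := Γ) (A := add (succ s.sh) ♯0 ≐ succ (add s.sh ♯0)) trivial
    (by
      simp only [Formula.sub, Term.sub, Term.add_sub, sh_inst, scons]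
      exact (add_zero _).trans (add_zero _).symm.succ_congr)
    (by
      simp only [Formula.sub, Term.sub, Term.add_sub, sh_step, scons]
      exact ((add_succ _ _).trans (Proves.succ_congr .here)).trans
        (Proves.succ_congr (add_succ _ _).symm)) t
  simpa only [Formula.sub, Term.sub, Term.add_sub, Term.tsub_sub, Formula.neg, sh_inst, scons] using this

theorem add_congr_left (h : Γ ⊩ s ≐ t) : Γ ⊩ add s u ≐ add t u := .prec_congr_left _ _ h

theorem succ_tsub_succ (s t : Term) : Γ ⊩ tsub (succ s) (succ t) ≐ tsub s t := by
  have := Proves.ind (Γ := Γ) (A := tsub (succ s.sh) (succ ♯0) ≐ tsub s.sh ♯0) trivial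
    (by
      simp only [Formula.sub, Term.sub, Term.tsub_sub, sh_inst, scons]
      exact (tsub_succ _ _).trans
        ((pred_congr (tsub_zero _)).trans ((pred_succ _).trans (tsub_zero _).symm)))
    (by
      simp only [Formula.sub, Term.sub, Term.tsub_sub, sh_step, scons]
      exact ((tsub_succ _ _).trans (pred_congr .here)).trans (tsub_succ _ _).symm) t
  simpa only [Formula.sub, Term.sub, Term.tsub_sub, sh_inst, scons] using this

theorem tsub_self (t : Term) : Γ ⊩ tsub t t ≐ zero :=
  Proves.ind (A := tsub ♯0 ♯0 ≐ zero) trivial (tsub_zero _)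
    ((succ_tsub_succ _ _).trans .here) t

theorem succ_tsub_self (t : Term) : Γ ⊩ tsub (succ t) t ≐ succ zero :=
  Proves.ind (A := tsub (succ ♯0) ♯0 ≐ succ zero) trivial (tsub_zero _)
    ((succ_tsub_succ _ _).trans .here) t

theorem tsub_of_succ_tsub (h : Γ ⊩ tsub (succ s) t ≐ zero) : Γ ⊩ tsub s t ≐ zero :=
  (((succ_tsub_succ s t).symm.trans (tsub_succ _ _)).trans (pred_congr h)).trans (.prec_zero ..)

/-- Either the subtraction has not been truncated, or `t` already exceeds `s`. Going from `t` to its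
successor, the first alternative turns into the second exactly when the difference has reached zero.
-/
theorem tsub_add_or (s t : Term) :
    Γ ⊩ or (add (tsub s t) t ≐ s) (Formula.neg (tsub t s ≐ zero)) := by
  have := Proves.ind (Γ := Γ)
    (A := or (add (tsub s.sh ♯0) ♯0 ≐ s.sh) (neg (tsub ♯0 s.sh ≐ zero)))
    ⟨trivial, trivial, trivial⟩
    (by
      simp only [Formula.sub, Term.sub, Term.add_sub, Term.tsub_sub, Formula.neg, sh_inst, scons]
      exact .orI₁ ((add_zero _).trans (tsub_zero _)))
    (by
      simp only [Formula.sub, Term.sub, Term.add_sub, Term.tsub_sub, Formula.neg, sh_step, scons]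
      refine .orE .here ?_ (.orI₂ (.impI (.impE (Proves.wk .here) (tsub_of_succ_tsub .here))))
      refine cases_zero_succ (tsub s.sh ♯0) (.orI₂ (.impI ?_)) (.orI₁ ?_)
      -- Here the induction variable equals `s`, so subtracting `s` from its successor gives one.
      · have e : (tsub s.sh ♯0 ≐ zero) :: (add (tsub s.sh ♯0) ♯0 ≐ s.sh) ::
          (or (add (tsub s.sh ♯0) ♯0 ≐ s.sh) (neg (tsub ♯0 s.sh ≐ zero))) ::
            Γ.map Formula.sh ⊩ ♯0 ≐ s.sh :=
          ((zero_add _).symm.trans (add_congr_left Proves.here.symm)).trans (Proves.wk .here)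
        exact Proves.succ_zero ((succ_tsub_self s.sh).symm.trans
          ((tsub_congr_left e.symm.succ_congr).wk.trans .here))
      · have e : (tsub s.sh ♯0 ≐ succ (pred (tsub s.sh ♯0))) ::
          (add (tsub s.sh ♯0) ♯0 ≐ s.sh) ::
          (or (add (tsub s.sh ♯0) ♯0 ≐ s.sh) (neg (tsub ♯0 s.sh ≐ zero))) ::
            Γ.map Formula.sh ⊩ add (tsub s.sh (succ ♯0)) (succ ♯0) ≐ add (tsub s.sh ♯0) ♯0 :=
          ((add_succ _ _).trans (add_congr_left (tsub_succ _ _)).succ_congr).trans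
            ((succ_add _ _).symm.trans (add_congr_left Proves.here.symm))
        exact e.trans (Proves.wk .here)) t
  simpa only [Formula.sub, Term.sub, Term.add_sub, Term.tsub_sub, Formula.neg, sh_inst, scons] using this

theorem eq_of_tsub (h : Γ ⊩ tsub s t ≐ zero) (h' : Γ ⊩ tsub t s ≐ zero) : Γ ⊩ s ≐ t :=
  .orE (tsub_add_or s t)
    ((Proves.here.symm.trans (add_congr_left h.wk)).trans (zero_add t))
    (.botE (.impE .here h'.wk))

end Derive

open Derive

/-! ### Characteristic terms of quantifier-free formulas -/

/-- A term that vanishes iff the quantifier-free formula holds. -/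
def chi : Formula → Term
  | .eq s t => prec (tsub t s) one (tsub s t)
  | .bot => one
  | .and A B => prec (chi B) one (chi A)
  | .or A B => prec zero (chi B).sh.sh (chi A)
  | .imp A B => prec (chi B) zero (chi A)
  | .allN _ => zero
  | .exN _ => zero
  | .allF _ => zero
  | .exF _ => zero

theorem chi_sub (A : Formula) (hA : A.QF) : ∀ σ τ, (chi A).sub σ τ = chi (A.sub σ τ) := by
  induction A with
  | eq s t => intros; rfl
  | bot => intros; rfl
  | and A B ihA ihB =>
    intros; simp only [chi, Term.sub, Formula.sub, ihA hA.1, ihB hA.2]; rfl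
  | or A B ihA ihB =>
    intros; simp only [chi, Term.sub, Formula.sub, ihA hA.1, ← ihB hA.2, sh_sub_liftSub]
  | imp A B ihA ihB =>
    intros; simp only [chi, Term.sub, Formula.sub, ihA hA.1, ihB hA.2]
  | _ => exact hA.elim

/-- Recursion with a step term ignoring the previous value and the stage is a case distinction on
whether the last argument is zero, so `chi` computes truth tables. The context is arbitrary because
the clauses for `or` and `imp` enlarge it. -/
theorem chi_iff (A : Formula) (hA : A.QF) :
    ∀ Γ, (Γ ⊩ A) ↔ (Γ ⊩ chi A ≐ zero) := by
  induction A with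
  | eq s t =>
    intro Γ
    refine ⟨fun h => ?_, fun h => ?_⟩
    · have h1 : Γ ⊩ tsub s t ≐ zero := (tsub_congr_left h).trans (tsub_self t)
      have h2 : Γ ⊩ tsub t s ≐ zero := (tsub_congr_right h).trans (tsub_self t)
      exact (Proves.prec_of_zero _ _ h1).trans h2
    · refine cases_zero_succ (tsub s t) ?_ ?_
      · exact eq_of_tsub .here ((Proves.prec_of_zero _ _ .here).symm.trans h.wk)
      · exact Proves.succ_zero ((Proves.prec_of_succ _ _ .here).symm.trans h.wk)
  | bot => exact fun Γ => ⟨.botE, Proves.succ_zero⟩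
  | and A B ihA ihB =>
    intro Γ
    refine ⟨fun h => ?_, fun h => ?_⟩
    · exact (Proves.prec_of_zero _ _ ((ihA hA.1 _).1 h.andE₁)).trans ((ihB hA.2 _).1 h.andE₂)
    · refine cases_zero_succ (chi A) ?_ ?_
      · exact .andI ((ihA hA.1 _).2 .here)
          ((ihB hA.2 _).2 ((Proves.prec_of_zero _ _ .here).symm.trans h.wk))
      · exact Proves.succ_zero ((Proves.prec_of_succ _ _ .here).symm.trans h.wk)
  | or A B ihA ihB =>
    have e (Γ) : (chi A ≐ succ (pred (chi A))) :: Γ ⊩ chi (or A B) ≐ chi B := by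
      have := Proves.prec_of_succ (Γ := (chi A ≐ succ (pred (chi A))) :: Γ) zero
        (chi B).sh.sh .here
      rwa [sh_sub, sh_sub, show (fun n => scons (prec zero (chi B).sh.sh (pred (chi A)))
        (scons (pred (chi A)) var) (n + 1 + 1)) = var from rfl, sub_var_id] at this
    intro Γ
    refine ⟨fun h => .orE h ?_ ?_, fun h => cases_zero_succ (chi A) ?_ ?_⟩
    · exact Proves.prec_of_zero _ _ ((ihA hA.1 _).1 .here)
    · refine cases_zero_succ (chi A) (Proves.prec_of_zero _ _ .here) ?_
      exact (e _).trans ((ihB hA.2 _).1 (Proves.wk .here))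
    · exact .orI₁ ((ihA hA.1 _).2 .here)
    · exact .orI₂ ((ihB hA.2 _).2 ((e _).symm.trans h.wk))
  | imp A B ihA ihB =>
    intro Γ
    refine ⟨fun h => cases_zero_succ (chi A) ?_ (Proves.prec_of_succ _ _ .here),
      fun h => .impI ((ihB hA.2 _).2 ?_)⟩
    · exact (Proves.prec_of_zero _ _ .here).trans
        ((ihB hA.2 _).1 (.impE h.wk ((ihA hA.1 _).2 .here)))
    · exact (Proves.prec_of_zero _ _ ((ihA hA.1 _).1 .here)).symm.trans h.wk
  | _ => exact hA.elim

/-- A characteristic term is zero or a successor; this is what makes classical model-theoretic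
arguments applicable to the intuitionistic theory. -/
theorem Proves.em (hA : A.QF) : Γ ⊩ or A (neg A) :=
  cases_zero_succ (chi A) (.orI₁ ((chi_iff A hA _).2 .here))
    (.orI₂ (.impI (Proves.succ_zero ((Proves.wk .here).symm.trans ((chi_iff A hA _).1 .here)))))

/-! ### Search for a counterexample to the induction step -/

theorem Formula.subst_congr (h : Γ ⊩ s ≐ t) (h' : Γ ⊩ A.sub (scons s var) id) :
    Γ ⊩ A.sub (scons t var) id := .eqSubst A h h'

/-- The largest `m ≤ t` such that `A` holds at `1, …, m`. -/
def climb (A : Formula) (t : Term) : Term :=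
  prec zero (prec (succ ♯0) ♯2 (chi (A.sub (scons (succ ♯0) fun n => ♯(n + 2)) id))) t

/-- The property of `climb A t` proved by induction on `t`. -/
def climbSpec (A : Formula) (t : Term) : Formula :=
  A.sub (scons (climb A t) var) id ⩑
    (A.sub (scons (succ (climb A t)) var) id ⇛ (climb A t ≐ t))

theorem scons_sub (t : Term) (σ σ' : ℕ → Term) (τ) :
    (fun n => (scons t σ n).sub σ' τ) = scons (t.sub σ' τ) (fun n => (σ n).sub σ' τ) := by
  funext n; cases n <;> rfl

theorem liftSub_scons (σ : ℕ → Term) (t : Term) (σ' : ℕ → Term) :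
    (fun n => (liftSub σ n).sub (scons t σ') id) = scons t (fun n => (σ n).sub σ' id) := by
  funext n
  cases n with
  | zero => rfl
  | succ n => exact sh_sub ..

theorem climb_sub (hA : A.QF) (t : Term) (σ) :
    (climb A t).sub σ id = climb (A.sub (liftSub σ) id) (t.sub σ id) := by
  simp only [climb, Term.sub, chi_sub _ (hA.sub _ _), Formula.sub_sub, liftSub_scons, scons_sub]
  have h (n) : liftSub (liftSub σ) (n + 2) = (σ n).sub (fun n => ♯(n + 2)) id := by
    rw [show liftSub (liftSub σ) (n + 2) = (σ n).sh.sh from rfl, sh_eq_sub, sh_eq_sub,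
      Term.sub_sub]
    rfl
  simp only [h]
  rfl

theorem climbSpec_sub (hA : A.QF) (t : Term) (σ) :
    (climbSpec A t).sub σ id = climbSpec (A.sub (liftSub σ) id) (t.sub σ id) := by
  simp only [climbSpec, Formula.sub, Term.sub, climb_sub hA, Formula.sub_sub, scons_sub,
    liftSub_scons, show ∀ n, (σ n).sub var id = σ n from fun n => sub_var _]

theorem climb_succ (hA : A.QF) (t : Term) : Γ ⊩ climb A (succ t) ≐
    prec (succ (climb A t)) (climb A t).sh.sh
      (chi (A.sub (scons (succ (climb A t)) var) id)) := by
  have := Proves.prec_succ (Γ := Γ) zero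
    (prec (succ ♯0) ♯2 (chi (A.sub (scons (succ ♯0) fun n => ♯(n + 2)) id))) t
  simp only [Term.sub, chi_sub _ (hA.sub _ _), Formula.sub_sub, scons_sub] at this
  exact this

/-- Decide `A` at the point after `climb A t`. If it holds, the hypothesis gives `climb A t = t` and
the search moves on to `t + 1`; if it fails, the search stays and the implication in the
specification is vacuous. -/
theorem climbSpec_succ (hA : A.QF) (t : Term) (h : Γ ⊩ climbSpec A t) :
    Γ ⊩ climbSpec A (succ t) := by
  have hA' := hA.sub (scons (succ (climb A t)) var) id
  refine .orE (Proves.em hA') ?_ ?_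
  · have e : A.sub (scons (succ (climb A t)) var) id :: Γ ⊩
        climb A (succ t) ≐ succ (climb A t) :=
      (climb_succ hA t).trans (Proves.prec_of_zero _ _ ((chi_iff _ hA' _).1 .here))
    refine .andI (Formula.subst_congr e.symm .here) (.impI ?_)
    exact (e.trans (Proves.succ_congr (.impE h.wk.andE₂ .here))).wk
  · have e : neg (A.sub (scons (succ (climb A t)) var) id) :: Γ ⊩
        climb A (succ t) ≐ climb A t := by
      refine (climb_succ hA t).trans (cases_zero_succ
        (chi (A.sub (scons (succ (climb A t)) var) id)) ?_ ?_)
      · exact .botE (.impE (Proves.wk .here) ((chi_iff _ hA' _).2 .here))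
      · have := Proves.prec_of_succ 
          (Γ := (chi (A.sub (scons (succ (climb A t)) var) id) ≐
              succ (pred (chi (A.sub (scons (succ (climb A t)) var) id)))) ::
            Formula.neg (A.sub (scons (succ (climb A t)) var) id) :: Γ)
          (succ (climb A t)) (climb A t).sh.sh .here
        rw [sh_sub, sh_sub] at this
        simpa only [scons, sub_var_id] using this
    refine .andI (Formula.subst_congr e.symm h.wk.andE₁) (.impI (.botE ?_))
    exact .impE (Proves.wk .here) (Formula.subst_congr e.succ_congr.wk .here)

/-- From `A(0)` alone the theory names a point at which `A` holds and at which the induction step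
fails unless that point is `t`. A single instance of the step, at this term, then suffices for
`A(t)`. -/
theorem climb_spec (hA : A.QF) (h0 : Γ ⊩ A.sub (scons zero var) id) (t : Term) :
    Γ ⊩ climbSpec A t := by
  -- The parameters of `A` are moved past the variable on which the induction runs; `e` and `e'`
  -- undo this after instantiation.
  have hA' := hA.sub (liftSub fun n => ♯(n + 1)) id
  have e (t σ) : (climbSpec (A.sub (liftSub fun n => ♯(n + 1)) id) ♯0).sub (scons t σ) id =
      climbSpec (A.sub (liftSub σ) id) t := by
    rw [climbSpec_sub hA', Formula.sub_sub, liftSub_comp]; rfl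
  have e' : A.sub (liftSub var) id = A := by
    rw [show liftSub var = var by funext n; cases n <;> rfl]; exact Formula.sub_var A
  have hq (A t) (hA : A.QF) : (climbSpec A t).QF := ⟨hA.sub _ _, hA.sub _ _, trivial⟩
  have := Proves.ind (Γ := Γ)
    (A := climbSpec (A.sub (liftSub fun n => ♯(n + 1)) id) ♯0) (hq _ _ hA')
    (by
      rw [e, e']
      have z : Γ ⊩ climb A zero ≐ zero := .prec_zero ..
      exact .andI (Formula.subst_congr z.symm h0) (.impI z.wk))
    (by rw [e]; exact climbSpec_succ hA' _ .here) t
  rwa [e, e'] at this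

/-- Existence of a function given by a term. -/
theorem Proves.comprehension (s : Term) : Γ ⊩ .exF (.allN (.app 0 ♯0 ≐ s.shF)) := by
  have h : Γ ⊩ .exF (.allN (.app 0 ♯0 ≐ s.sh.sub (scons (.app 0 ♯0) var) Nat.succ)) := by
    refine .impE (.ax (iRCA0.choice (♯0 ≐ s.sh) trivial)) (.allNI (.exNI s ?_))
    simp only [inst, Formula.sub, sh_inst]
    exact .eqRefl _
  rwa [sh_sub, show (fun n => scons (.app 0 ♯0) var (n + 1)) = var from rfl,
    ← shF_eq_sub] at h

end IRCA

/-! ### From truth in models to derivability -/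

namespace IRCA

/-! ### Models of quantifier-free primitive recursive arithmetic -/

/-- Extension of an environment by a new value for variable `0`. -/
def ext {α : Type*} (x : α) (v : ℕ → α) : ℕ → α
  | 0 => x
  | n + 1 => v n

@[simp] theorem ext_zero {α : Type*} (x : α) (v : ℕ → α) : ext x v 0 = x := rfl

@[simp] theorem ext_succ {α : Type*} (x : α) (v : ℕ → α) (n : ℕ) : ext x v (n + 1) = v n := rfl

@[simp] theorem ext_one {α : Type*} (x : α) (v : ℕ → α) : ext x v 1 = v 0 := rfl

/-- Boolean combinations of equations between functions from a given class. -/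
inductive QFDef {M : Type} (D : ((ℕ → M) → M) → Prop) : ((ℕ → M) → Prop) → Prop
  | eq {f g} : D f → D g → QFDef D (fun v => f v = g v)
  | false : QFDef D (fun _ => False)
  | and {P Q} : QFDef D P → QFDef D Q → QFDef D (fun v => P v ∧ Q v)
  | or {P Q} : QFDef D P → QFDef D Q → QFDef D (fun v => P v ∨ Q v)
  | imp {P Q} : QFDef D P → QFDef D Q → QFDef D (fun v => P v → Q v)

/-- A structure with a class `Dfn` of functions closed under primitive recursion, satisfying
induction for Boolean combinations of equations between members of the class. -/
class PRModel (M : Type) where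
  zero : M
  succ : M → M
  recur : M → (M → M → M) → M → M
  Dfn : ((ℕ → M) → M) → Prop
  dfn_proj (n : ℕ) : Dfn fun v => v n
  dfn_const (c : M) : Dfn fun _ => c
  dfn_comp {f} {g : ℕ → (ℕ → M) → M} : Dfn f → (∀ n, Dfn (g n)) → Dfn fun v => f fun n => g n v
  dfn_succ {f} : Dfn f → Dfn fun v => succ (f v)
  dfn_recur {a : (ℕ → M) → M} {b : M → M → (ℕ → M) → M} {c : (ℕ → M) → M} : Dfn a →
    Dfn (fun v => b (v 0) (v 1) fun n => v (n + 2)) → Dfn c →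
    Dfn fun v => recur (a v) (fun x y => b x y v) (c v)
  recur_zero (a : M) {b : M → M → M} : Dfn (fun v => b (v 0) (v 1)) → recur a b zero = a
  recur_succ (a : M) {b : M → M → M} (x : M) : Dfn (fun v => b (v 0) (v 1)) →
    recur a b (succ x) = b (recur a b x) x
  succ_inj {x y : M} : succ x = succ y → x = y
  succ_ne_zero (x : M) : succ x ≠ zero
  ind {P : M → Prop} : QFDef Dfn (fun v => P (v 0)) → P zero → (∀ x, P x → P (succ x)) → ∀ x, P x

/-- A unary function that may be applied in definitions. -/
class Definable₁ {M : Type} [PRModel M] (p : M → M) : Prop where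
  comp {f : (ℕ → M) → M} : PRModel.Dfn f → PRModel.Dfn fun v => p (f v)

section Semantics

variable {M : Type} [PRModel M]

/-- Value of a term. -/
def ev : Term → (ℕ → M) → (ℕ → M → M) → M
  | .var n, v, _ => v n
  | .zero, _, _ => PRModel.zero
  | .succ t, v, φ => PRModel.succ (ev t v φ)
  | .app f t, v, φ => φ f (ev t v φ)
  | .prec a b t, v, φ =>
    PRModel.recur (ev a v φ) (fun x y => ev b (ext x (ext y v)) φ) (ev t v φ)

/-- Truth of a formula; function quantifiers range over all functions. -/
def Sat : Formula → (ℕ → M) → (ℕ → M → M) → Prop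
  | .eq s t, v, φ => ev s v φ = ev t v φ
  | .bot, _, _ => False
  | .and A B, v, φ => Sat A v φ ∧ Sat B v φ
  | .or A B, v, φ => Sat A v φ ∨ Sat B v φ
  | .imp A B, v, φ => Sat A v φ → Sat B v φ
  | .allN A, v, φ => ∀ x, Sat A (ext x v) φ
  | .exN A, v, φ => ∃ x, Sat A (ext x v) φ
  | .allF A, v, φ => ∀ f, Sat A v (ext f φ)
  | .exF A, v, φ => ∃ f, Sat A v (ext f φ)

theorem ext_liftRen {α : Type*} (x : α) (v : ℕ → α) (ρ : ℕ → ℕ) :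
    (fun n => ext x v (liftRen ρ n)) = ext x fun n => v (ρ n) := by
  funext n; cases n <;> rfl

theorem ev_ren (t : Term) : ∀ ρ τ (v : ℕ → M) φ,
    ev (t.ren ρ τ) v φ = ev t (fun n => v (ρ n)) (fun n => φ (τ n)) := by
  induction t with
  | var n => intros; rfl
  | zero => intros; rfl
  | succ t ih => intros; simp [Term.ren, ev, ih]
  | app f t ih => intros; simp [Term.ren, ev, ih]
  | prec a b t iha ihb iht => intros; simp [Term.ren, ev, iha, ihb, iht, ext_liftRen]

theorem ev_sh (t : Term) (v : ℕ → M) (φ) : ev t.sh v φ = ev t (fun n => v (n + 1)) φ :=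
  ev_ren ..

theorem ev_shF (t : Term) (v : ℕ → M) (φ) : ev t.shF v φ = ev t v (fun n => φ (n + 1)) :=
  ev_ren ..

theorem ev_liftSub (σ : ℕ → Term) (x : M) (v φ) :
    (fun n => ev (liftSub σ n) (ext x v) φ) = ext x fun n => ev (σ n) v φ := by
  funext n
  cases n with
  | zero => rfl
  | succ n => exact ev_sh ..

theorem ev_sub (t : Term) : ∀ σ τ (v : ℕ → M) φ,
    ev (t.sub σ τ) v φ = ev t (fun n => ev (σ n) v φ) (fun n => φ (τ n)) := by
  induction t with
  | var n => intros; rfl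
  | zero => intros; rfl
  | succ t ih => intros; simp [Term.sub, ev, ih]
  | app f t ih => intros; simp [Term.sub, ev, ih]
  | prec a b t iha ihb iht => intros; simp [Term.sub, ev, iha, ihb, iht, ev_liftSub]

theorem sat_sub (A : Formula) : ∀ σ τ (v : ℕ → M) φ,
    Sat (A.sub σ τ) v φ ↔ Sat A (fun n => ev (σ n) v φ) (fun n => φ (τ n)) := by
  induction A with
  | eq s t => intros; simp [Formula.sub, Sat, ev_sub]
  | bot => intros; rfl
  | and A B ihA ihB => intros; simp [Formula.sub, Sat, ihA, ihB]
  | or A B ihA ihB => intros; simp [Formula.sub, Sat, ihA, ihB]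
  | imp A B ihA ihB => intros; simp [Formula.sub, Sat, ihA, ihB]
  | allN A ih => intros; simp [Formula.sub, Sat, ih, ev_liftSub]
  | exN A ih => intros; simp [Formula.sub, Sat, ih, ev_liftSub]
  | allF A ih => intros; simp [Formula.sub, Sat, ih, ev_shF, ext_liftRen]
  | exF A ih => intros; simp [Formula.sub, Sat, ih, ev_shF, ext_liftRen]

theorem sat_sh (A : Formula) (v : ℕ → M) (φ) : Sat A.sh v φ ↔ Sat A (fun n => v (n + 1)) φ :=
  sat_sub ..

theorem sat_shF (A : Formula) (v : ℕ → M) (φ) : Sat A.shF v φ ↔ Sat A v (fun n => φ (n + 1)) :=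
  sat_sub ..

end Semantics

/-! ### Term models -/

/-- A set of formulas that is closed under derivations without discharge of variables, consistent,
and decides quantifier-free formulas. -/
structure Complete (Th : Formula → Prop) : Prop where
  closed {L : List Formula} {A} : (∀ B ∈ L, Th B) → (L ⊩ A) → Th A
  em {A : Formula} : A.QF → Th A ∨ Th A.neg
  consistent : ¬ Th .bot

namespace Complete

variable {Th : Formula → Prop} (h : Complete Th)

include h

theorem proves {A : Formula} (hA : [] ⊩ A) : Th A := h.closed (by simp) hA

theorem map {A B : Formula} (f : ∀ {Γ}, (Γ ⊩ A) → (Γ ⊩ B)) (hA : Th A) : Th B :=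
  h.closed (L := [A]) (by simpa using hA) (f .here)

theorem map₂ {A B C : Formula} (f : ∀ {Γ}, (Γ ⊩ A) → (Γ ⊩ B) → (Γ ⊩ C)) (hA : Th A)
    (hB : Th B) : Th C :=
  h.closed (L := [A, B]) (by simp [hA, hB]) (f .here (.wk .here))

theorem and {A B : Formula} : Th (A ⩑ B) ↔ Th A ∧ Th B :=
  ⟨fun k => ⟨h.map .andE₁ k, h.map .andE₂ k⟩, fun k => h.map₂ .andI k.1 k.2⟩

/-- The disjunction property needs only that the theory decides the left disjunct. -/
theorem or {A B : Formula} (hA : A.QF) : Th (A.or B) ↔ Th A ∨ Th B := by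
  refine ⟨fun k => (h.em hA).imp id fun k' => ?_, fun k => k.elim (h.map .orI₁) (h.map .orI₂)⟩
  exact h.map₂ (fun k k' => .orE k (.botE (.impE k'.wk .here)) .here) k k'

theorem mp {A B : Formula} (hi : Th (A ⇛ B)) (hA : Th A) : Th B := h.map₂ .impE hi hA

theorem imp {A B : Formula} (hA : A.QF) : Th (A ⇛ B) ↔ (Th A → Th B) := by
  refine ⟨h.mp, fun k => (h.em hA).elim (fun k' => ?_) fun k' => ?_⟩
  · exact h.map (fun h => .impI h.wk) (k k')
  · exact h.map (fun h => .impI (.botE (.impE h.wk .here))) k'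

/-- The step is only a closure property of `Th` on terms, not an implication belonging to `Th`, so
the induction axiom does not apply. Using the step at the term `climb A t` forces `climb A t = t`
and hence `A(t)`. -/
theorem induction {A : Formula} (hA : A.QF) (h0 : Th (A.sub (scons .zero .var) id))
    (hs : ∀ t, Th (A.sub (scons t .var) id) → Th (A.sub (scons (.succ t) .var) id)) (t : Term) :
    Th (A.sub (scons t .var) id) := by
  have k : Th (climbSpec A t) := h.map (fun h => climb_spec hA h t) h0
  have e := h.mp (h.and.1 k).2 (hs _ (h.and.1 k).1)
  exact h.map₂ Formula.subst_congr e (h.and.1 k).1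

/-- Provable equality of terms. -/
def setoid : Setoid Term where
  r s t := Th (s ≐ t)
  iseqv := ⟨fun t => h.proves (.eqRefl t), h.map .symm, h.map₂ .trans⟩

/-- The carrier of the term model. -/
def Model : Type := Quotient h.setoid

/-- The class of a term. -/
def cls (t : Term) : h.Model := Quotient.mk h.setoid t

theorem cls_eq {s t : Term} : h.cls s = h.cls t ↔ Th (s ≐ t) := Quotient.eq (r := h.setoid)

theorem exists_cls (x : h.Model) : ∃ t, h.cls t = x := Quotient.exists_rep x

/-- `B` represents the binary function `b`. -/
def IsRep (b : h.Model → h.Model → h.Model) (B : Term) : Prop :=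
  ∀ s t, b (h.cls s) (h.cls t) = h.cls (B.sub (scons s (scons t .var)) id)

open Classical in
/-- The recursor of the term model. -/
noncomputable def recM (a : h.Model) (b : h.Model → h.Model → h.Model) (x : h.Model) : h.Model :=
  if H : ∃ B, h.IsRep b B then
    h.cls (.prec (Quotient.out (s := h.setoid) a) H.choose (Quotient.out (s := h.setoid) x))
  else h.cls .zero

/-- The recursor picks some representing term for `b`; agreement of two representatives on all
classes, together with term-by-term induction, shows that the choice does not matter. -/
theorem prec_rep {b B B'} (hB : h.IsRep b B) (hB' : h.IsRep b B') (a t : Term) :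
    h.cls (.prec a B t) = h.cls (.prec a B' t) := by
  have e (B t : Term) : (Term.prec a.sh (B.sub (liftSub (liftSub fun n => ♯(n + 1))) id) ♯0).sub
      (scons t .var) id = .prec a B t := by
    simp only [Term.sub, Term.sh_inst, Term.sub_sub, liftSub_comp, scons, id,
      show liftSub (liftSub .var) = .var by funext n; rcases n with _ | _ | n <;> rfl,
      Term.sub_var]
  have := h.induction (A := .prec a.sh (B.sub (liftSub (liftSub fun n => ♯(n + 1))) id) ♯0 ≐
    .prec a.sh (B'.sub (liftSub (liftSub fun n => ♯(n + 1))) id) ♯0) trivial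
    (by
      simp only [Formula.sub, e]
      exact h.proves ((Proves.prec_zero _ _).trans (Proves.prec_zero _ _).symm))
    (fun t ht => by
      simp only [Formula.sub, e, ← cls_eq h] at ht ⊢
      rw [h.cls_eq.2 (h.proves (.prec_succ a B t)), h.cls_eq.2 (h.proves (.prec_succ a B' t)),
        ← hB, ← hB', ht]) t
  simpa only [Formula.sub, e, ← cls_eq h] using this

theorem recM_cls {b B} (hB : h.IsRep b B) (a t : Term) :
    h.recM (h.cls a) b (h.cls t) = h.cls (.prec a B t) := by
  have H : ∃ B, h.IsRep b B := ⟨B, hB⟩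
  have ho (t : Term) : Th (Quotient.out (s := h.setoid) (h.cls t) ≐ t) :=
    Quotient.mk_out (s := h.setoid) t
  rw [recM, dif_pos H, h.prec_rep H.choose_spec hB]
  exact (h.cls_eq.2 (h.map (Proves.prec_congr_left _ _) (ho a))).trans
    (h.cls_eq.2 (h.map (Proves.prec_congr _ _) (ho t)))

omit h in
/-- Interleaving of a substitution with the identity. -/
def mix (σ : ℕ → Term) (n : ℕ) : Term := if n % 2 = 0 then σ (n / 2) else ♯(n / 2)

/-- Functions of the term model given by a term. -/
def DfnM (f : (ℕ → h.Model) → h.Model) : Prop :=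
  ∃ B : Term, ∀ σ : ℕ → Term, f (fun n => h.cls (σ n)) = h.cls (B.sub (mix σ) id)

theorem dfnM_proj (n : ℕ) : h.DfnM fun v => v n :=
  ⟨♯(2 * n), fun σ => by simp [Term.sub, mix]⟩

/-- This is why `mix` keeps the odd variables: an element of the model is the class of an open term,
whose own variables must survive the substitution of arguments. They are renamed to odd indices, and
`mix` restores them. -/
theorem dfnM_const (c : h.Model) : h.DfnM fun _ => c := by
  obtain ⟨t, rfl⟩ := h.exists_cls c
  refine ⟨t.sub (fun n => ♯(2 * n + 1)) id, fun σ => ?_⟩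
  simp only [Term.sub_sub, Term.sub, mix]
  have e (n : ℕ) : (2 * n + 1) / 2 = n := by omega
  simp [Nat.add_mod, e, Term.sub_var]

theorem dfnM_comp {f : (ℕ → h.Model) → h.Model} {g : ℕ → (ℕ → h.Model) → h.Model}
    (hf : h.DfnM f) (hg : ∀ n, h.DfnM (g n)) : h.DfnM fun v => f fun n => g n v := by
  obtain ⟨B, hB⟩ := hf
  choose C hC using hg
  refine ⟨B.sub (fun m => if m % 2 = 0 then C (m / 2) else ♯m) id, fun σ => ?_⟩
  simp only [hC, hB, Term.sub_sub]
  refine congrArg _ (congrArg₂ _ (funext fun m => ?_) rfl)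
  by_cases hm : m % 2 = 0 <;> simp [mix, hm, Term.sub]

/-- Converts the interleaved numbering into the numbering of a recursion step. The even indices `0`
and `2` become the two bound variables; the other even indices drop by two, since argument `n + 2`
is now supplied by `σ n`; odd indices rise by two to get past the binders. -/
theorem isRep_of_dfnM {b : h.Model → h.Model → (ℕ → h.Model) → h.Model} {B : Term}
    (hB : ∀ σ : ℕ → Term, b (h.cls (σ 0)) (h.cls (σ 1)) (fun n => h.cls (σ (n + 2))) =
      h.cls (B.sub (mix σ) id)) (σ : ℕ → Term) :
    h.IsRep (fun x y => b x y fun n => h.cls (σ n))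
      ((B.ren (fun m => if m = 0 then 0 else if m = 2 then 1 else
        if m % 2 = 0 then m - 2 else m + 2) id).sub (liftSub (liftSub (mix σ))) id) := by
  intro s t
  rw [Term.sub_ren, Term.sub_sub]
  refine (hB (scons s (scons t σ))).trans (congrArg _ (congrArg₂ _ (funext fun m => ?_) rfl))
  have e : (fun n => (liftSub (liftSub (mix σ)) n).sub (scons s (scons t .var)) id) =
      scons s (scons t (mix σ)) := by
    funext n
    rcases n with _ | _ | n
    · rfl
    · rfl
    · exact (Term.sh_sub ..).trans ((Term.sh_sub ..).trans (Term.sub_var _))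
  refine Eq.trans ?_ (congrFun e _).symm
  by_cases h0 : m = 0
  · subst h0; rfl
  by_cases h2 : m = 2
  · subst h2; rfl
  by_cases hm : m % 2 = 0
  · obtain ⟨k, rfl⟩ : ∃ k, m = 2 * k + 4 := ⟨(m - 4) / 2, by omega⟩
    have e1 : (2 * k + 4) / 2 = k + 2 := by omega
    have e2 : 2 * k + 4 - 2 = 2 * k + 2 := by omega
    rw [if_neg h0, if_neg h2, if_pos hm, mix, if_pos hm, e1, e2]
    simp [scons, mix]
  · rw [if_neg h0, if_neg h2, if_neg hm, mix, if_neg hm]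
    simp [scons, mix, hm]

theorem dfnM_rec {a : (ℕ → h.Model) → h.Model} {b : h.Model → h.Model → (ℕ → h.Model) → h.Model}
    {c : (ℕ → h.Model) → h.Model} (ha : h.DfnM a)
    (hb : h.DfnM fun v => b (v 0) (v 1) fun n => v (n + 2)) (hc : h.DfnM c) :
    h.DfnM fun v => h.recM (a v) (fun x y => b x y v) (c v) := by
  obtain ⟨A, hA⟩ := ha
  obtain ⟨B, hB⟩ := hb
  obtain ⟨C, hC⟩ := hc
  refine ⟨.prec A (B.ren (fun m => if m = 0 then 0 else if m = 2 then 1 else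
    if m % 2 = 0 then m - 2 else m + 2) id) C, fun σ => ?_⟩
  simp only [hA, hC]
  exact h.recM_cls (h.isRep_of_dfnM hB σ) _ _

theorem exists_isRep {b : h.Model → h.Model → h.Model} (hb : h.DfnM fun v => b (v 0) (v 1)) :
    ∃ B, h.IsRep b B := by
  obtain ⟨B, hB⟩ := hb
  exact ⟨_, h.isRep_of_dfnM (b := fun x y _ => b x y) hB .var⟩

/-- Boolean combinations of definable equations are quantifier-free formulas; disjunction and
implication commute with `Th` because it decides such formulas, and falsity by consistency. -/
theorem qfDef_iff {P : (ℕ → h.Model) → Prop} (hP : QFDef h.DfnM P) :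
    ∃ A : Formula, A.QF ∧ ∀ σ : ℕ → Term, P (fun n => h.cls (σ n)) ↔ Th (A.sub (mix σ) id) := by
  induction hP with
  | eq hf hg =>
    obtain ⟨A, hA⟩ := hf
    obtain ⟨B, hB⟩ := hg
    exact ⟨A ≐ B, trivial, fun σ => by beta_reduce; rw [hA, hB]; exact h.cls_eq⟩
  | false => exact ⟨.bot, trivial, fun σ => iff_of_false id h.consistent⟩
  | and _ _ ih ih' =>
    obtain ⟨A, qA, hA⟩ := ih
    obtain ⟨B, qB, hB⟩ := ih'
    exact ⟨A ⩑ B, ⟨qA, qB⟩, fun σ => by beta_reduce; rw [hA, hB]; exact h.and.symm⟩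
  | or _ _ ih ih' =>
    obtain ⟨A, qA, hA⟩ := ih
    obtain ⟨B, qB, hB⟩ := ih'
    exact ⟨A.or B, ⟨qA, qB⟩, fun σ => by beta_reduce; rw [hA, hB]; exact (h.or (qA.sub _ _)).symm⟩
  | imp _ _ ih ih' =>
    obtain ⟨A, qA, hA⟩ := ih
    obtain ⟨B, qB, hB⟩ := ih'
    exact ⟨A ⇛ B, ⟨qA, qB⟩, fun σ => by beta_reduce; rw [hA, hB]; exact (h.imp (qA.sub _ _)).symm⟩

noncomputable instance instModel : PRModel h.Model where
  zero := h.cls .zero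
  succ := Quotient.map' (s₁ := h.setoid) (s₂ := h.setoid) .succ fun _ _ => h.map Proves.succ_congr
  recur := h.recM
  Dfn := h.DfnM
  dfn_proj := h.dfnM_proj
  dfn_const := h.dfnM_const
  dfn_comp := h.dfnM_comp
  dfn_succ := fun ⟨B, hB⟩ => ⟨.succ B, fun σ => (congrArg _ (hB σ)).trans rfl⟩
  dfn_recur := h.dfnM_rec
  recur_zero a b hb := by
    obtain ⟨B, hB⟩ := h.exists_isRep hb
    obtain ⟨t, rfl⟩ := h.exists_cls a
    exact (h.recM_cls hB _ _).trans (h.cls_eq.2 (h.proves (.prec_zero _ _)))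
  recur_succ a b x hb := by
    obtain ⟨B, hB⟩ := h.exists_isRep hb
    obtain ⟨t, rfl⟩ := h.exists_cls a
    obtain ⟨s, rfl⟩ := h.exists_cls x
    rw [h.recM_cls hB, hB]
    exact (h.recM_cls hB _ _).trans (h.cls_eq.2 (h.proves (.prec_succ _ _ _)))
  succ_inj {x y} e := by
    obtain ⟨t, rfl⟩ := h.exists_cls x
    obtain ⟨s, rfl⟩ := h.exists_cls y
    exact h.cls_eq.2 (h.map Proves.succ_inj (h.cls_eq.1 e))
  succ_ne_zero x e := by
    obtain ⟨t, rfl⟩ := h.exists_cls x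
    exact h.consistent (h.map (A := .succ t ≐ .zero) Proves.succ_zero (h.cls_eq.1 e))
  ind {P} hP h0 hs x := by
    obtain ⟨A, qA, hA⟩ := h.qfDef_iff hP
    obtain ⟨t, rfl⟩ := h.exists_cls x
    -- At a constant assignment all argument variables, the even ones, can be merged into the
    -- induction variable `0`; the parameters are moved past it.
    have e (t) : P (h.cls t) ↔
        Th ((A.sub (fun m => if m % 2 = 0 then ♯0 else ♯(m / 2 + 1)) id).sub
          (scons t .var) id) := by
      refine (hA fun _ => t).trans (iff_of_eq (congrArg Th ?_))
      rw [Formula.sub_sub]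
      refine congrArg₂ _ (funext fun m => ?_) rfl
      by_cases hm : m % 2 = 0 <;> simp [mix, hm, Term.sub, scons]
    refine (e t).2 (h.induction (qA.sub _ _) ((e _).1 h0) (fun t ht => ?_) t)
    exact (e _).1 (hs _ ((e t).2 ht))

/-- The function variables as functions of the term model. -/
def fn (i : ℕ) : h.Model → h.Model :=
  Quotient.map' (s₁ := h.setoid) (s₂ := h.setoid) (.app i)
    fun _ _ => h.map (Proves.congr (.app i ♯0))

instance (i : ℕ) : Definable₁ (h.fn i) where
  comp := fun ⟨B, hB⟩ => ⟨.app i B, fun σ => (congrArg (h.fn i) (hB σ)).trans rfl⟩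

theorem ev_cls (t : Term) : ∀ σ : ℕ → Term, ev t (fun n => h.cls (σ n)) h.fn = h.cls (t.sub σ id) := by
  induction t with
  | var n => intros; rfl
  | zero => intros; rfl
  | succ t ih => intro σ; simp only [ev, ih]; rfl
  | app f t ih => intro σ; simp only [ev, ih]; rfl
  | prec a b t iha ihb iht =>
    intro σ
    simp only [ev, iha, iht, Term.sub]
    refine h.recM_cls (fun s t => ?_) _ _
    have e : (fun n => (liftSub (liftSub σ) n).sub (scons s (scons t .var)) id) =
        scons s (scons t σ) := by
      funext n
      rcases n with _ | _ | n
      · rfl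
      · rfl
      · exact (Term.sh_sub ..).trans ((Term.sh_sub ..).trans (Term.sub_var _))
    have e' : ext (h.cls s) (ext (h.cls t) fun n => h.cls (σ n)) =
        fun n => h.cls (scons s (scons t σ) n) := by
      funext n; rcases n with _ | _ | n <;> rfl
    rw [Term.sub_sub, e, e', ihb]
    rfl

end Complete

/-! ### Completeness for arithmetical formulas -/

namespace Formula

/-- Formulas whose truth in the term model implies provability. -/
def IsE : Formula → Prop
  | eq _ _ => True
  | bot => True
  | and A B => A.IsE ∧ B.IsE
  | or A B => A.IsE ∧ B.IsE
  | imp A B => A.QF ∧ B.QF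
  | exN A => A.IsE
  | _ => False

/-- Formulas whose provability implies truth in the term model. -/
def IsH : Formula → Prop
  | eq _ _ => True
  | bot => True
  | and A B => A.IsH ∧ B.IsH
  | or A B => A.QF ∧ B.QF
  | imp A B => A.IsE ∧ B.IsH
  | allN A => A.IsH
  | _ => False

/-- Goals for which truth in all models suffices. -/
def IsP : Formula → Prop
  | eq _ _ => True
  | bot => True
  | and A B => A.IsP ∧ B.IsP
  | or A B => A.IsE ∧ B.IsE
  | imp A B => A.IsH ∧ B.IsP
  | exN A => A.IsE
  | allN A => A.IsP
  | _ => False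

theorem qf_sub_iff (A : Formula) : ∀ σ τ, (A.sub σ τ).QF ↔ A.QF := by
  induction A <;> simp_all [sub, QF]

theorem isE_sub (A : Formula) : ∀ σ τ, (A.sub σ τ).IsE ↔ A.IsE := by
  induction A <;> simp_all [sub, IsE, qf_sub_iff]

theorem isH_sub (A : Formula) : ∀ σ τ, (A.sub σ τ).IsH ↔ A.IsH := by
  induction A <;> simp_all [sub, IsH, qf_sub_iff, isE_sub]

end Formula

namespace Complete

variable {Th : Formula → Prop} (h : Complete Th)

theorem sat_iff (A : Formula) (hA : A.QF) :
    ∀ σ : ℕ → Term, Sat A (fun n => h.cls (σ n)) h.fn ↔ Th (A.sub σ id) := by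
  induction A with
  | eq s t => intro σ; simp only [Sat, h.ev_cls]; exact h.cls_eq
  | bot => exact fun σ => iff_of_false id h.consistent
  | and A B ihA ihB =>
    intro σ; simp only [Sat, ihA hA.1, ihB hA.2]; exact h.and.symm
  | or A B ihA ihB =>
    intro σ; simp only [Sat, ihA hA.1, ihB hA.2]; exact (h.or (hA.1.sub _ _)).symm
  | imp A B ihA ihB =>
    intro σ; simp only [Sat, ihA hA.1, ihB hA.2]; exact (h.imp (hA.1.sub _ _)).symm
  | _ => exact hA.elim

theorem ext_cls (t : Term) (σ : ℕ → Term) :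
    ext (h.cls t) (fun n => h.cls (σ n)) = fun n => h.cls (scons t σ n) := by
  funext n; cases n <;> rfl

theorem sub_inst (A : Formula) (σ : ℕ → Term) (t : Term) :
    (A.sub (liftSub σ) id).inst t = A.sub (scons t σ) id := by
  rw [Formula.inst, Formula.sub_sub, liftSub_scons]
  simp only [show ∀ n, (σ n).sub .var id = σ n from fun n => Term.sub_var _]
  rfl

/-- Truth in the term model supplies a term as witness and selects a disjunct, so existential
quantifiers and disjunctions are harmless. Implications must be quantifier-free, where truth and
membership in `Th` coincide. -/
theorem of_sat (A : Formula) (hA : A.IsE) :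
    ∀ σ : ℕ → Term, Sat A (fun n => h.cls (σ n)) h.fn → Th (A.sub σ id) := by
  induction A with
  | eq s t => exact fun σ => (h.sat_iff (s ≐ t) trivial σ).1
  | bot => exact fun σ k => k.elim
  | and A B ihA ihB => exact fun σ k => h.and.2 ⟨ihA hA.1 σ k.1, ihB hA.2 σ k.2⟩
  | or A B ihA ihB =>
    exact fun σ k => k.elim (fun k => h.map .orI₁ (ihA hA.1 σ k))
      fun k => h.map .orI₂ (ihB hA.2 σ k)
  | imp A B => exact fun σ => (h.sat_iff (A ⇛ B) hA σ).1
  | exN A ih =>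
    rintro σ ⟨x, k⟩
    obtain ⟨t, rfl⟩ := h.exists_cls x
    rw [ext_cls] at k
    have := ih hA _ k
    rw [← sub_inst] at this
    exact h.map (.exNI t) this
  | _ => exact hA.elim

/-- In this direction `Th` need not provide witnesses, and it splits a disjunction only if the
disjuncts are decided. Implication is admissible when truth of the premise can be brought back into
`Th` by `of_sat`. -/
theorem sat_of (A : Formula) (hA : A.IsH) :
    ∀ σ : ℕ → Term, Th (A.sub σ id) → Sat A (fun n => h.cls (σ n)) h.fn := by
  induction A with
  | eq s t => exact fun σ => (h.sat_iff (s ≐ t) trivial σ).2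
  | bot => exact fun σ => h.consistent
  | and A B ihA ihB =>
    exact fun σ k => ⟨ihA hA.1 σ (h.and.1 k).1, ihB hA.2 σ (h.and.1 k).2⟩
  | or A B => exact fun σ => (h.sat_iff (A.or B) hA σ).2
  | imp A B _ ihB => exact fun σ k k' => ihB hA.2 σ (h.mp k (h.of_sat A hA.1 σ k'))
  | allN A ih =>
    intro σ k x
    obtain ⟨t, rfl⟩ := h.exists_cls x
    rw [ext_cls]
    refine ih hA _ ?_
    rw [← sub_inst]
    exact h.map (.allNE t) k
  | _ => exact hA.elim

end Complete

/-- Zorn's lemma is applied to sets of quantifier-free formulas that do not derive `G` over `Γ`. For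
a maximal such set, `A` and its negation cannot both lead to `G`, since `Proves.em` would then
derive `G`. Formulas with quantifiers are never added, so no classical principle beyond the theory
enters. -/
theorem exists_complete {Γ : List Formula} {G : Formula} (hG : ¬ (Γ ⊩ G)) :
    ∃ Th, Complete Th ∧ (∀ B ∈ Γ, Th B) ∧ ¬ Th G := by
  obtain ⟨U, hU⟩ := zorn_subset
    {U : Set Formula | (∀ A ∈ U, A.QF) ∧ ∀ L : List Formula, (∀ B ∈ L, B ∈ U) → ¬ (L ++ Γ ⊩ G)} (by
      intro c hc hch
      refine ⟨⋃₀ c, ⟨?_, ?_⟩, fun s => Set.subset_sUnion_of_mem⟩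
      · rintro A ⟨s, hs, hA⟩
        exact (hc hs).1 A hA
      · intro L hL k
        have : L = [] ∨ ∃ s ∈ c, ∀ B ∈ L, B ∈ s := by
          clear k
          induction L with
          | nil => exact .inl rfl
          | cons A L ih =>
            obtain ⟨s, hs, hA⟩ := hL A (by simp)
            right
            rcases ih fun B hB => hL B (by simp [hB]) with rfl | ⟨s', hs', hL'⟩
            · exact ⟨s, hs, by simpa using hA⟩
            · rcases hch.total hs hs' with hss | hss
              · exact ⟨s', hs', by simpa using ⟨hss hA, hL'⟩⟩
              · exact ⟨s, hs, by simpa using ⟨hA, fun B hB => hss (hL' B hB)⟩⟩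
        rcases this with rfl | ⟨s, hs, hLs⟩
        · exact hG k
        · exact (hc hs).2 L hLs k)
  obtain ⟨⟨hQ, hL⟩, hmax⟩ := hU
  -- Maximality: a formula outside `U` yields `G` together with finitely many members of `U`.
  have key (A : Formula) (hA : A.QF) :
      A ∈ U ∨ ∃ L : List Formula, (∀ B ∈ L, B ∈ U) ∧ (A :: (L ++ Γ) ⊩ G) := by
    by_contra! hn
    refine hn.1 (hmax (y := insert A U) ⟨?_, ?_⟩ (Set.subset_insert _ _) (Set.mem_insert _ _))
    · rintro B (rfl | hB)
      exacts [hA, hQ B hB]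
    · intro L hLA k
      classical
      refine hn.2 (L.filter (· ≠ A)) (fun B hB => ?_) (k.weaken fun B hB => ?_)
      · simp only [ne_eq, decide_not, List.mem_filter, Bool.not_eq_eq_eq_not, Bool.not_true,
          decide_eq_false_iff_not] at hB
        exact (hLA B hB.1).resolve_left hB.2
      · by_cases e : B = A
        · simp [e]
        · simp_all
  refine ⟨fun A => ∃ L : List Formula, (∀ B ∈ L, B ∈ U) ∧ (L ++ Γ ⊩ A), ⟨?_, ?_, ?_⟩, ?_, ?_⟩
  · intro L A hA k
    have : ∃ L' : List Formula, (∀ B ∈ L', B ∈ U) ∧ ∀ B ∈ L, (L' ++ Γ ⊩ B) := by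
      clear k
      induction L with
      | nil => exact ⟨[], by simp, by simp⟩
      | cons C L ih =>
        obtain ⟨L₁, h₁, k₁⟩ := hA C (by simp)
        obtain ⟨L₂, h₂, k₂⟩ := ih fun B hB => hA B (by simp [hB])
        refine ⟨L₁ ++ L₂, fun B hB => (List.mem_append.1 hB).elim (h₁ B) (h₂ B), ?_⟩
        rintro B (_ | ⟨_, hB⟩)
        · exact k₁.weaken fun x hx => by simp only [List.mem_append] at hx ⊢; tauto
        · exact (k₂ B hB).weaken fun x hx => by simp only [List.mem_append] at hx ⊢; tauto
    obtain ⟨L', h', k'⟩ := this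
    refine ⟨L', h', ?_⟩
    -- Iterated cut, which makes the set of consequences closed under derivation.
    have aux : ∀ (L Δ : List Formula) (A : Formula), (L ⊩ A) → (∀ B ∈ L, (Δ ⊩ B)) → (Δ ⊩ A) := by
      intro L
      induction L with
      | nil => exact fun Δ A h _ => h.weaken (by simp)
      | cons C L ih =>
        exact fun Δ A h hB => .impE (ih Δ _ (.impI h) fun B hB' => hB B (by simp [hB']))
          (hB C (by simp))
    exact aux L _ A k k'
  · intro A hA
    rcases key A hA with h | ⟨L, h, k⟩
    · exact .inl ⟨[A], by simpa using h, .here⟩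
    rcases key A.neg ⟨hA, trivial⟩ with h' | ⟨L', h', k'⟩
    · exact .inr ⟨[A.neg], by simpa using h', .here⟩
    refine (hL (L ++ L') (fun B hB => (List.mem_append.1 hB).elim (h B) (h' B)) ?_).elim
    refine .orE (Proves.em hA) (k.weaken fun x hx => ?_) (k'.weaken fun x hx => ?_)
    all_goals simp only [List.mem_cons, List.mem_append] at hx ⊢; tauto
  · exact fun ⟨L, h, k⟩ => hL L h (.botE k)
  · exact fun B hB => ⟨[], by simp, .hyp hB⟩
  · exact fun ⟨L, h, k⟩ => hL L h k

/-- Truth in all models of the hypotheses of class `IsH`. -/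
def Valid (Γ : List Formula) (G : Formula) : Prop :=
  ∀ (M : Type) [PRModel M] (v : ℕ → M) (φ : ℕ → M → M), (∀ i, Definable₁ (φ i)) →
    (∀ B ∈ Γ, B.IsH → Sat B v φ) → Sat G v φ

/-- The term model of a completed theory that avoids `G` would be a countermodel, each variable
being interpreted by its own class. -/
theorem proves_of_valid_of_isE {Γ : List Formula} {G : Formula} (hG : G.IsE) (h : Valid Γ G) :
    Γ ⊩ G := by
  by_contra hn
  obtain ⟨Th, hT, hΓ, hn⟩ := exists_complete hn
  refine hn ?_
  rw [← Formula.sub_var G]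
  refine hT.of_sat G hG _ (h _ _ _ inferInstance fun B hB hH => ?_)
  refine hT.sat_of B hH _ ?_
  rw [show B.sub .var id = B from Formula.sub_var B]
  exact hΓ B hB

/-- Outer universal quantifiers and implications are removed by introduction rules before the
countermodel is built; this is why `IsP` allows them around goals of class `IsE`. -/
theorem proves_of_valid (G : Formula) (hG : G.IsP) : ∀ Γ, Valid Γ G → (Γ ⊩ G) := by
  induction G with
  | eq s t => exact fun Γ => proves_of_valid_of_isE trivial
  | bot => exact fun Γ => proves_of_valid_of_isE trivial
  | and A B ihA ihB =>
    exact fun Γ h => .andI (ihA hG.1 Γ fun M _ v φ hφ k => (h M v φ hφ k).1)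
      (ihB hG.2 Γ fun M _ v φ hφ k => (h M v φ hφ k).2)
  | or A B => exact fun Γ => proves_of_valid_of_isE hG
  | imp A B _ ihB =>
    exact fun Γ h => .impI (ihB hG.2 _ fun M _ v φ hφ k =>
      h M v φ hφ (fun B hB => k B (by simp [hB])) (k A (by simp) hG.1))
  | exN A => exact fun Γ => proves_of_valid_of_isE hG
  | allN A ih =>
    refine fun Γ h => .allNI (ih hG _ fun M _ v φ hφ k => ?_)
    have := h M (fun n => v (n + 1)) φ hφ (fun B hB hH => ?_) (v 0)
    · rwa [show ext (v 0) (fun n => v (n + 1)) = v by funext n; cases n <;> rfl] at this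
    · exact (sat_sh B v φ).1 (k B.sh (List.mem_map_of_mem hB) ((Formula.isH_sub _ _ _).2 hH))
  | _ => exact hG.elim

end IRCA

/-! ### Arithmetic inside a structure with quantifier-free induction -/

namespace IRCA

open PRModel

/-! ### Definability -/

section Definability

variable {M : Type} [PRModel M]

/-- `f` is a definable function of finitely many of the variables. -/
class Definable (f : (ℕ → M) → M) : Prop where
  out : Dfn f

/-- `P` is a Boolean combination of equations between definable functions. -/
class DefPred (P : (ℕ → M) → Prop) : Prop where
  out : QFDef (Dfn (M := M)) P

instance (n : ℕ) : Definable fun v : ℕ → M => v n := ⟨dfn_proj n⟩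

instance (c : M) : Definable fun _ : ℕ → M => c := ⟨dfn_const c⟩

instance (f : (ℕ → M) → M) [hf : Definable f] : Definable fun v => succ (f v) :=
  ⟨dfn_succ hf.out⟩

instance (p : M → M) [hp : Definable₁ p] (f : (ℕ → M) → M) [hf : Definable f] :
    Definable fun v => p (f v) := ⟨hp.comp hf.out⟩

instance definable_recur (a : (ℕ → M) → M) (b : M → M → (ℕ → M) → M) (c : (ℕ → M) → M)
    [ha : Definable a] [hb : Definable fun v => b (v 0) (v 1) fun n => v (n + 2)]
    [hc : Definable c] : Definable fun v => recur (a v) (fun x y => b x y v) (c v) :=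
  ⟨dfn_recur ha.out hb.out hc.out⟩

instance (f g : (ℕ → M) → M) [hf : Definable f] [hg : Definable g] :
    DefPred fun v => f v = g v := ⟨.eq hf.out hg.out⟩

instance (P Q : (ℕ → M) → Prop) [hP : DefPred P] [hQ : DefPred Q] :
    DefPred fun v => P v ∧ Q v := ⟨.and hP.out hQ.out⟩

instance (P Q : (ℕ → M) → Prop) [hP : DefPred P] [hQ : DefPred Q] :
    DefPred fun v => P v ∨ Q v := ⟨.or hP.out hQ.out⟩

instance (P Q : (ℕ → M) → Prop) [hP : DefPred P] [hQ : DefPred Q] :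
    DefPred fun v => P v → Q v := ⟨.imp hP.out hQ.out⟩

instance (P : (ℕ → M) → Prop) [hP : DefPred P] : DefPred fun v => ¬ P v :=
  ⟨.imp hP.out .false⟩

instance (P Q : (ℕ → M) → Prop) [hP : DefPred P] [hQ : DefPred Q] :
    DefPred fun v => P v ↔ Q v := by
  simp only [iff_def]; infer_instance

/-- Instance search certifies the predicate as definable, so that induction can be used in `M` much
like ordinary induction. -/
theorem induct (P : M → Prop) [hP : DefPred fun v => P (v 0)] (h0 : P zero)
    (hs : ∀ x, P x → P (succ x)) (x : M) : P x := ind hP.out h0 hs x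

theorem recur_zero' (a : M) (b : M → M → M) [hb : Definable fun v => b (v 0) (v 1)] :
    recur a b zero = a := recur_zero a hb.out

theorem recur_succ' (a : M) (b : M → M → M) [hb : Definable fun v => b (v 0) (v 1)] (x : M) :
    recur a b (succ x) = b (recur a b x) x := recur_succ a x hb.out

/-! ### Addition, multiplication and truncated subtraction -/

instance : Zero M := ⟨zero⟩
instance : One M := ⟨succ 0⟩
instance : Add M := ⟨fun x y => recur x (fun u _ => succ u) y⟩
instance : Mul M := ⟨fun x y => recur 0 (fun u _ => u + x) y⟩

/-- Predecessor, with value `0` at `0`. -/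
def predM (x : M) : M := recur 0 (fun _ y => y) x

instance : Sub M := ⟨fun x y => recur x (fun u _ => predM u) y⟩

theorem zero_def : (zero : M) = 0 := rfl

theorem Definable.reindex (f : (ℕ → M) → M) [hf : Definable f] (ρ : ℕ → ℕ) :
    Definable fun v => f fun n => v (ρ n) := ⟨dfn_comp hf.out fun n => dfn_proj (ρ n)⟩

theorem Definable.comp₁ (F : M → M) [hF : Definable fun v => F (v 0)] (f : (ℕ → M) → M)
    [hf : Definable f] : Definable fun v => F (f v) :=
  ⟨dfn_comp (g := fun _ => f) hF.out fun _ => hf.out⟩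

theorem Definable.comp₂ (F : M → M → M) [hF : Definable fun v => F (v 0) (v 1)]
    (f g : (ℕ → M) → M) [hf : Definable f] [hg : Definable g] : Definable fun v => F (f v) (g v) :=
  ⟨dfn_comp (g := fun n => n.rec f fun _ _ => g) hF.out fun n => by cases n <;> [exact hf.out; exact hg.out]⟩

theorem Definable.comp₃ (F : M → M → M → M) [hF : Definable fun v => F (v 0) (v 1) (v 2)]
    (f g k : (ℕ → M) → M) [hf : Definable f] [hg : Definable g] [hk : Definable k] :
    Definable fun v => F (f v) (g v) (k v) :=
  ⟨dfn_comp (g := fun n => if n = 0 then f else if n = 1 then g else k) hF.out fun n => by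
    split_ifs <;> [exact hf.out; exact hg.out; exact hk.out]⟩

instance : Definable fun v : ℕ → M => v 0 + v 1 :=
  definable_recur (fun v => v 0) (fun u _ _ => succ u) (fun v => v 1)

instance (f g : (ℕ → M) → M) [Definable f] [Definable g] : Definable fun v => f v + g v :=
  .comp₂ (· + ·) f g

instance : Definable fun v : ℕ → M => v 0 * v 1 :=
  definable_recur (fun _ => 0) (fun u _ v => u + v 0) (fun v => v 1)

instance (f g : (ℕ → M) → M) [Definable f] [Definable g] : Definable fun v => f v * g v :=
  .comp₂ (· * ·) f g

instance : Definable fun v : ℕ → M => predM (v 0) :=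
  definable_recur (fun _ => 0) (fun _ y _ => y) (fun v => v 0)

instance (f : (ℕ → M) → M) [Definable f] : Definable fun v => predM (f v) := .comp₁ predM f

instance : Definable fun v : ℕ → M => v 0 - v 1 :=
  definable_recur (fun v => v 0) (fun u _ _ => predM u) (fun v => v 1)

instance (f g : (ℕ → M) → M) [Definable f] [Definable g] : Definable fun v => f v - g v :=
  .comp₂ (· - ·) f g

namespace Arith

theorem add_zero (x : M) : x + 0 = x := recur_zero' x fun u _ => succ u

theorem add_succ (x y : M) : x + succ y = succ (x + y) := recur_succ' x (fun u _ => succ u) y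

theorem mul_zero (x : M) : x * 0 = 0 := recur_zero' 0 fun u _ => u + x

theorem mul_succ (x y : M) : x * succ y = x * y + x := recur_succ' 0 (fun u _ => u + x) y

theorem pred_zero : predM (0 : M) = 0 := recur_zero' 0 fun _ y => y

theorem pred_succ (x : M) : predM (succ x) = x := recur_succ' 0 (fun _ y => y) x

theorem sub_zero (x : M) : x - 0 = x := recur_zero' x fun u _ => predM u

theorem sub_succ (x y : M) : x - succ y = predM (x - y) := recur_succ' x (fun u _ => predM u) y

theorem zero_add (x : M) : 0 + x = x :=
  induct (fun x : M => 0 + x = x) (add_zero _) (fun x h => by rw [add_succ, h]) x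

theorem succ_add (x y : M) : succ x + y = succ (x + y) :=
  induct (fun y : M => succ x + y = succ (x + y)) (by simp only [zero_def, add_zero])
    (fun y h => by rw [add_succ, h, add_succ]) y

theorem add_comm (x y : M) : x + y = y + x :=
  induct (fun y : M => x + y = y + x) (by simp only [zero_def, add_zero, zero_add])
    (fun y h => by rw [add_succ, h, succ_add]) y

theorem add_assoc (x y z : M) : x + y + z = x + (y + z) :=
  induct (fun z : M => x + y + z = x + (y + z)) (by simp only [zero_def, add_zero])
    (fun z h => by rw [add_succ, h, add_succ, add_succ]) z

theorem zero_mul (x : M) : 0 * x = 0 :=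
  induct (fun x : M => 0 * x = 0) (mul_zero _) (fun x h => by rw [mul_succ, h, add_zero]) x

theorem succ_mul (x y : M) : succ x * y = x * y + y :=
  induct (fun y : M => succ x * y = x * y + y) (by simp only [zero_def, add_zero, mul_zero])
    (fun y h => by
      rw [mul_succ, h, mul_succ, add_succ, add_succ, add_assoc, add_assoc, add_comm x y]) y

theorem mul_comm (x y : M) : x * y = y * x :=
  induct (fun y : M => x * y = y * x) (by simp only [zero_def, mul_zero, zero_mul])
    (fun y h => by rw [mul_succ, h, succ_mul]) y

theorem mul_add (x y z : M) : x * (y + z) = x * y + x * z :=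
  induct (fun z : M => x * (y + z) = x * y + x * z) (by simp only [zero_def, mul_zero, add_zero])
    (fun z h => by rw [add_succ, mul_succ, h, mul_succ, add_assoc]) z

theorem mul_assoc (x y z : M) : x * y * z = x * (y * z) :=
  induct (fun z : M => x * y * z = x * (y * z)) (by simp only [zero_def, mul_zero])
    (fun z h => by rw [mul_succ, h, mul_succ, mul_add]) z

theorem mul_one (x : M) : x * 1 = x := by
  rw [show (1 : M) = succ 0 from rfl, mul_succ, mul_zero, zero_add]

end Arith

instance : CommSemiring M where
  add_assoc := Arith.add_assoc
  zero_add := Arith.zero_add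
  add_zero := Arith.add_zero
  add_comm := Arith.add_comm
  left_distrib := Arith.mul_add
  right_distrib x y z := by rw [Arith.mul_comm, Arith.mul_add, Arith.mul_comm z, Arith.mul_comm z]
  zero_mul := Arith.zero_mul
  mul_zero := Arith.mul_zero
  mul_assoc := Arith.mul_assoc
  one_mul x := by rw [Arith.mul_comm, Arith.mul_one]
  mul_one := Arith.mul_one
  mul_comm := Arith.mul_comm
  nsmul := nsmulRec

theorem succ_eq (x : M) : succ x = x + 1 := by
  rw [show (1 : M) = succ 0 from rfl, Arith.add_succ, add_zero]

theorem induction {P : M → Prop} [DefPred fun v => P (v 0)] (h0 : P 0)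
    (hs : ∀ x, P x → P (x + 1)) (x : M) : P x :=
  induct P h0 (fun x h => by rw [succ_eq]; exact hs x h) x

theorem zero_or_succ' (x : M) : x = 0 ∨ x = predM x + 1 :=
  induction (P := fun x : M => x = 0 ∨ x = predM x + 1) (.inl rfl)
    (fun x _ => .inr (by rw [← succ_eq x, Arith.pred_succ, succ_eq])) x

namespace Arith

theorem add_right_cancel {x y z : M} (h : x + z = y + z) : x = y :=
  induction (P := fun z : M => x + z = y + z → x = y) (by simp)
    (fun z ih h => ih (succ_inj (by rw [← add_succ, ← add_succ, succ_eq]; exact h))) z h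

theorem sub_add_one (x y : M) : x - (y + 1) = predM (x - y) := by rw [← succ_eq, sub_succ]

theorem add_one_sub_add_one (x y : M) : x + 1 - (y + 1) = x - y :=
  induction (P := fun y : M => x + 1 - (y + 1) = x - y)
    (by rw [sub_add_one, sub_zero, ← succ_eq, pred_succ, sub_zero])
    (fun y h => by rw [sub_add_one, h, sub_add_one]) y

theorem sub_self (x : M) : x - x = 0 :=
  induction (P := fun x : M => x - x = 0) (sub_zero _) (fun x h => by rw [add_one_sub_add_one, h]) x

theorem zero_sub (x : M) : 0 - x = 0 :=
  induction (P := fun x : M => 0 - x = 0) (sub_zero _) (fun x h => by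
    rw [sub_add_one, h, pred_zero]) x

theorem sub_add_self (x y : M) : y - (x + y) = 0 :=
  induction (P := fun y : M => y - (x + y) = 0) (by rw [zero_sub]) (fun y h => by
    rw [← _root_.add_assoc, add_one_sub_add_one, h]) y

theorem add_one_sub_self (x : M) : x + 1 - x = 1 :=
  induction (P := fun x : M => x + 1 - x = 1) (by rw [sub_zero, zero_add])
    (fun x h => by rw [add_one_sub_add_one, h]) x

theorem add_one_ne_zero (x : M) : x + 1 ≠ 0 := by rw [← succ_eq]; exact succ_ne_zero x

/-- The semantic twin of `tsub_add_or`; from it the order and its compatibility with addition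
follow. -/
theorem sub_add_cancel_or (x z : M) : x - z + z = x ∨ z - x ≠ 0 :=
  induction (P := fun z : M => x - z + z = x ∨ z - x ≠ 0) (.inl (by rw [sub_zero, _root_.add_zero]))
    (fun z h => by
      rcases h with h | h
      · rcases zero_or_succ' (x - z) with e | e
        · rw [e, _root_.zero_add] at h
          subst h
          right
          rw [add_one_sub_self]
          simpa using add_one_ne_zero (0 : M)
        · left
          rw [sub_add_one]
          rw [e] at h
          rw [← _root_.add_assoc, add_right_comm, h]
      · right
        intro k
        refine h ?_
        rw [← add_one_sub_add_one, sub_add_one, k, pred_zero]) z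

theorem sub_add_cancel_or' (x z : M) : x - z + z = x ∨ x - z = 0 :=
  induction (P := fun z : M => x - z + z = x ∨ x - z = 0) (.inl (by rw [sub_zero, _root_.add_zero]))
    (fun z h => by
      rw [sub_add_one]
      rcases h with h | h
      · rcases zero_or_succ' (x - z) with e | e
        · exact .inr (by rw [e, pred_zero])
        · left
          rw [e] at h
          rw [← _root_.add_assoc, add_right_comm, h]
      · exact .inr (by rw [h, pred_zero])) z

theorem sub_eq_zero_iff (x y : M) : x - y = 0 ↔ ∃ z, y = x + z := by
  constructor
  · intro h
    refine ⟨y - x, ?_⟩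
    rw [_root_.add_comm]
    exact ((sub_add_cancel_or y x).resolve_right (not_not_intro h)).symm
  · rintro ⟨z, rfl⟩
    rw [_root_.add_comm, sub_add_self]

end Arith

/-- Defined by an equation, so that comparisons are definable predicates and agree with the formula
`le`; the algebra uses the existential description `le_iff_exists`. -/
instance : LE M := ⟨fun x y => x - y = 0⟩

theorem le_def (x y : M) : x ≤ y ↔ x - y = 0 := Iff.rfl

theorem le_iff_exists (x y : M) : x ≤ y ↔ ∃ z, y = x + z := Arith.sub_eq_zero_iff x y

noncomputable instance : LinearOrder M where
  le_refl := Arith.sub_self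
  le_trans x y z h h' := by
    obtain ⟨a, rfl⟩ := (le_iff_exists _ _).1 h
    obtain ⟨b, rfl⟩ := (le_iff_exists _ _).1 h'
    exact (le_iff_exists _ _).2 ⟨a + b, by ring⟩
  le_antisymm x y h h' := by
    obtain ⟨a, rfl⟩ := (le_iff_exists _ _).1 h
    obtain ⟨b, e⟩ := (le_iff_exists _ _).1 h'
    have e : (a + b) + x = 0 + x := by rw [zero_add, add_comm, ← add_assoc, ← e]
    have e := Arith.add_right_cancel e
    rcases zero_or_succ' a with rfl | k
    · rw [add_zero]
    · rw [k, add_right_comm] at e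
      exact (Arith.add_one_ne_zero _ e).elim
  le_total x y := by
    rcases Arith.sub_add_cancel_or' x y with h | h
    · right
      rw [← h, le_def, Arith.sub_add_self]
    · exact .inl h
  toDecidableLE := Classical.decRel _

instance : IsOrderedCancelAddMonoid M where
  add_le_add_left x y h z := by
    obtain ⟨a, rfl⟩ := (le_iff_exists _ _).1 h
    exact (le_iff_exists _ _).2 ⟨a, by ring⟩
  le_of_add_le_add_left x y z h := by
    obtain ⟨a, e⟩ := (le_iff_exists _ _).1 h
    refine (le_iff_exists _ _).2 ⟨a, Arith.add_right_cancel (z := x) ?_⟩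
    rw [add_comm, e]; ring

instance : CanonicallyOrderedAdd M where
  exists_add_of_le h := (le_iff_exists _ _).1 h
  le_add_self _ y := (le_iff_exists _ _).2 ⟨y, add_comm _ _⟩
  le_self_add _ y := (le_iff_exists _ _).2 ⟨y, rfl⟩

instance : OrderedSub M where
  tsub_le_iff_right x y z := by
    constructor
    · intro h
      obtain ⟨a, e⟩ := (le_iff_exists _ _).1 h
      rcases Arith.sub_add_cancel_or x y with k | k
      · exact (le_iff_exists _ _).2 ⟨a, by rw [← k, e]; ring⟩
      · have : x ≤ y := (le_total x y).resolve_right k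
        exact this.trans le_add_self
    · intro h
      rcases Arith.sub_add_cancel_or x y with k | k
      · rw [← k] at h
        exact le_of_add_le_add_right h
      · have : x - y = 0 := (le_total x y).resolve_right k
        rw [this]
        exact zero_le

instance : Nontrivial M := ⟨0, 1, fun h => Arith.add_one_ne_zero (0 : M) (by rw [zero_add, ← h])⟩

theorem lt_iff_add_one_le (x y : M) : x < y ↔ x + 1 ≤ y := by
  constructor
  · intro h
    obtain ⟨z, rfl⟩ := (le_iff_exists _ _).1 h.le
    rcases zero_or_succ' z with rfl | e
    · simp at h
    · exact (le_iff_exists _ _).2 ⟨predM z, by rw [add_right_comm, add_assoc, ← e]⟩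
  · intro h
    refine lt_of_lt_of_le ?_ h
    exact lt_add_of_pos_right x (pos_iff_ne_zero.2 one_ne_zero)

instance : IsStrictOrderedRing M where
  zero_le_one := zero_le
  le_of_add_le_add_left _ _ _ := le_of_add_le_add_left
  mul_lt_mul_of_pos_left x hx y z h := by
    obtain ⟨a, rfl⟩ := (le_iff_exists _ _).1 ((lt_iff_add_one_le _ _).1 h)
    obtain ⟨b, rfl⟩ := (le_iff_exists _ _).1 ((lt_iff_add_one_le _ _).1 hx)
    rw [lt_iff_add_one_le, le_iff_exists]
    -- The smaller number is `y`, the larger `y + 1 + a`, and the factor is `1 + b`; the products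
    -- differ by `(1 + b)(1 + a)`, which is one more than this witness.
    exact ⟨y * 0 + b * (a + 1) + a, by ring⟩
  mul_lt_mul_of_pos_right x hx y z h := by
    obtain ⟨a, rfl⟩ := (le_iff_exists _ _).1 ((lt_iff_add_one_le _ _).1 h)
    obtain ⟨b, rfl⟩ := (le_iff_exists _ _).1 ((lt_iff_add_one_le _ _).1 hx)
    rw [lt_iff_add_one_le, le_iff_exists]
    exact ⟨y * 0 + b * (a + 1) + a, by ring⟩

theorem predM_eq (x : M) : predM x = x - 1 := by
  rw [← zero_add (1 : M), Arith.sub_add_one, Arith.sub_zero]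

theorem lt_add_one_iff' (x y : M) : x < y + 1 ↔ x ≤ y := by
  rw [lt_iff_add_one_le, add_le_add_iff_right]

theorem exists_eq_add_one {x : M} (h : x ≠ 0) : ∃ y, x = y + 1 :=
  (zero_or_succ' x).elim (fun e => (h e).elim) fun e => ⟨_, e⟩

theorem recur_zero'' (a : M) (b : M → M → M) [Definable fun v => b (v 0) (v 1)] :
    recur a b 0 = a := recur_zero' a b

theorem recur_add_one (a : M) (b : M → M → M) [Definable fun v => b (v 0) (v 1)] (x : M) :
    recur a b (x + 1) = b (recur a b x) x := by rw [← succ_eq, recur_succ']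

/-! ### Characteristic functions and bounded quantifiers -/

/-- Equality becomes the sum of the two truncated differences, conjunction a sum, disjunction a
product, and implication a case distinction by recursion. Bounded quantifiers are reduced to sums of
such functions. -/
theorem exists_chi (P : (ℕ → M) → Prop) [hP : DefPred P] :
    ∃ f : (ℕ → M) → M, Definable f ∧ ∀ v, P v ↔ f v = 0 := by
  obtain ⟨hP⟩ := hP
  have hr (a b c : (ℕ → M) → M) (ha : Definable a) (hb : Definable b) (hc : Definable c) :
      Definable fun v => recur (a v) (fun _ _ => b v) (c v) := by
    have := Definable.reindex b (· + 2)
    infer_instance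
  have h0 (x y z : M) (h : z = 0) : recur x (fun _ _ => y) z = x := by
    rw [h, recur_zero'' x fun _ _ => y]
  have h1 (x y z : M) (h : z ≠ 0) : recur x (fun _ _ => y) z = y := by
    obtain ⟨z, rfl⟩ := exists_eq_add_one h
    rw [recur_add_one x fun _ _ => y]
  induction hP with
  | @eq f g hf hg =>
    have : Definable f := ⟨hf⟩
    have : Definable g := ⟨hg⟩
    refine ⟨fun v => (f v - g v) + (g v - f v), inferInstance, fun v => ?_⟩
    beta_reduce
    rw [add_eq_zero, tsub_eq_zero_iff_le, tsub_eq_zero_iff_le, le_antisymm_iff]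
  | false => exact ⟨fun _ => 1, inferInstance, by simp⟩
  | and _ _ ih ih' =>
    obtain ⟨f, hf, hP⟩ := ih
    obtain ⟨g, hg, hQ⟩ := ih'
    exact ⟨fun v => f v + g v, inferInstance, fun v => by beta_reduce; rw [hP, hQ, add_eq_zero]⟩
  | or _ _ ih ih' =>
    obtain ⟨f, hf, hP⟩ := ih
    obtain ⟨g, hg, hQ⟩ := ih'
    exact ⟨fun v => f v * g v, inferInstance, fun v => by beta_reduce; rw [hP, hQ, mul_eq_zero]⟩
  | imp _ _ ih ih' =>
    obtain ⟨f, hf, hP⟩ := ih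
    obtain ⟨g, hg, hQ⟩ := ih'
    refine ⟨fun v => recur (g v) (fun _ _ => 0) (f v), hr _ _ _ hg inferInstance hf, fun v => ?_⟩
    beta_reduce
    rw [hP, hQ]
    by_cases h : f v = 0
    · rw [h0 _ _ _ h]; simp only [h, forall_const]
    · simp only [h, false_imp_iff, h1 _ _ _ h]

/-- The sum of `f j` for `j < n`. -/
def sumM (f : M → M) (n : M) : M := recur 0 (fun u j => u + f j) n

instance (f : M → (ℕ → M) → M) (n : (ℕ → M) → M) [Definable fun v => f (v 0) fun n => v (n + 1)]
    [Definable n] : Definable fun v => sumM (fun j => f j v) (n v) := by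
  have := Definable.reindex (fun v => f (v 0) fun n => v (n + 1)) (· + 1)
  exact definable_recur (fun _ => 0) (fun u j v => u + f j v) n

section

variable (f : M → M) [Definable fun v => f (v 0)]

theorem sumM_zero : sumM f 0 = 0 := by
  have := Definable.reindex (fun v => f (v 0)) (· + 1)
  exact recur_zero'' 0 fun u j => u + f j

theorem sumM_succ (n : M) : sumM f (n + 1) = sumM f n + f n := by
  have := Definable.reindex (fun v => f (v 0)) (· + 1)
  exact recur_add_one 0 (fun u j => u + f j) n

instance (n : (ℕ → M) → M) [hn : Definable n] : Definable fun v => f (n v) :=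
  Definable.comp₁ f n

theorem sumM_eq_zero (n : M) : sumM f n = 0 ↔ ∀ j < n, f j = 0 := by
  constructor
  · intro h j
    -- The comparison is written with a difference, so that the predicate is a Boolean combination
    -- of equations.
    refine induction (P := fun n : M => sumM f n = 0 → n - j ≠ 0 → f j = 0)
      (fun _ h => (h (zero_tsub j)).elim)
      (fun n ih h hj => ?_) n h ∘ fun h => (tsub_pos_of_lt h).ne'
    rw [sumM_succ, add_eq_zero] at h
    have hj : j < n + 1 := tsub_pos_iff_lt.1 (pos_iff_ne_zero.2 hj)
    rcases ((lt_add_one_iff' _ _).1 hj).eq_or_lt with rfl | k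
    exacts [h.2, ih h.1 (tsub_pos_of_lt k).ne']
  · intro h
    refine induction (P := fun m : M => m - n = 0 → sumM f m = 0) (fun _ => sumM_zero f)
      (fun m ih hm => ?_) n (tsub_self n)
    have hm : m + 1 ≤ n := hm
    have hm' : m < n := (lt_iff_add_one_le _ _).2 hm
    rw [sumM_succ, h m hm', ih hm'.le, add_zero]

end

instance (f g : (ℕ → M) → M) [Definable f] [Definable g] : DefPred fun v => f v ≤ g v := by
  simp only [le_def]; infer_instance

instance (f g : (ℕ → M) → M) [Definable f] [Definable g] : DefPred fun v => f v < g v := by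
  simp only [lt_iff_add_one_le]; infer_instance

/-- Bounded quantification adds nothing to the definable predicates: it is the vanishing of a sum of
characteristic functions. Induction thereby extends to all bounded formulas. -/
instance (P : M → (ℕ → M) → Prop) (n : (ℕ → M) → M) [DefPred fun v => P (v 0) fun n => v (n + 1)]
    [Definable n] : DefPred fun v => ∀ j < n v, P j v := by
  obtain ⟨f, hf, hP⟩ := exists_chi fun v : ℕ → M => P (v 0) fun n => v (n + 1)
  have hP' (j v) : P j v ↔ f (ext j v) = 0 := hP (ext j v)
  have e : (fun v : ℕ → M => ext (v 0) fun n => v (n + 1)) = id := by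
    funext v n; cases n <;> rfl
  have : Definable fun v : ℕ → M => f (ext (v 0) fun n => v (n + 1)) := by
    simpa only [congrFun e, id] using hf
  have e' : (fun v => ∀ j < n v, P j v) = fun v => sumM (fun j => f (ext j v)) (n v) = 0 := by
    funext v
    have : Definable fun w : ℕ → M => f (ext (w 0) v) := by
      refine ⟨dfn_comp (g := fun n w => ext (w 0) v n) hf.out fun n => ?_⟩
      cases n with
      | zero => exact dfn_proj 0
      | succ n => exact dfn_const (v n)
    rw [sumM_eq_zero fun j => f (ext j v)]
    simp only [hP']
  rw [e']
  infer_instance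

instance (P : M → (ℕ → M) → Prop) (n : (ℕ → M) → M) [DefPred fun v => P (v 0) fun n => v (n + 1)]
    [Definable n] : DefPred fun v => ∃ j < n v, P j v := by
  have : (fun v => ∃ j < n v, P j v) = fun v => ¬ ∀ j < n v, ¬ P j v := by
    funext v; push Not; rfl
  rw [this]
  infer_instance

/-- Without a least element, the bounded statement that nothing below `y` satisfies `P` is
inductive. -/
theorem exists_least {P : M → Prop} [DefPred fun v => P (v 0)] {x : M} (h : P x) :
    ∃ y ≤ x, P y ∧ ∀ z < y, ¬ P z := by
  have : DefPred fun v : ℕ → M => P (v 0) := inferInstance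
  by_contra! hn
  have key := induction (P := fun y : M => ∀ z < y, z ≤ x → ¬ P z) (by simp)
    (fun y ih z hz hzx hPz => by
      rcases ((lt_add_one_iff' _ _).1 hz).eq_or_lt with rfl | hz
      · obtain ⟨z', hz', k⟩ := hn z hzx hPz
        exact ih z' hz' (hz'.le.trans hzx) k
      · exact ih z hz hzx hPz)
  exact key (x + 1) x ((lt_add_one_iff' _ _).2 le_rfl) le_rfl h

end Definability

/-! ### Definability of the values of terms -/

section Semantics

variable {M : Type} [PRModel M] {φ : ℕ → M → M}

theorem definable_ev (hφ : ∀ i, Definable₁ (φ i)) (t : Term) :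
    Definable fun v : ℕ → M => ev t v φ := by
  have e (v : ℕ → M) : (ext (v 0) (ext (v 1) fun n => v (n + 2))) = v := by
    funext n; rcases n with _ | _ | n <;> rfl
  induction t with
  | var n => exact ⟨dfn_proj n⟩
  | zero => exact ⟨dfn_const _⟩
  | succ t ih => exact ⟨dfn_succ ih.out⟩
  | app f t ih => exact ⟨(hφ f).comp ih.out⟩
  | prec a b t iha ihb iht =>
    exact ⟨dfn_recur (b := fun x y v => ev b (ext x (ext y v)) φ) iha.out
      (by simpa only [e] using ihb.out) iht.out⟩

theorem definable_ev_ext (hφ : ∀ i, Definable₁ (φ i)) (t : Term) (v : ℕ → M) :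
    Definable fun w : ℕ → M => ev t (ext (w 0) v) φ := by
  refine ⟨dfn_comp (g := fun n w => ext (w 0) v n) (definable_ev hφ t).out fun n => ?_⟩
  cases n with
  | zero => exact dfn_proj 0
  | succ n => exact dfn_const (v n)

theorem ev_chi (A : Formula) (hA : A.QF) :
    ∀ v : ℕ → M, ev (chi A) v φ = 0 ↔ Sat A v φ := by
  have h0 (x y z : M) (h : z = 0) : recur x (fun _ _ => y) z = x := by
    rw [h, recur_zero'' x fun _ _ => y]
  have h1 (x y z : M) (h : z ≠ 0) : recur x (fun _ _ => y) z = y := by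
    obtain ⟨z, rfl⟩ := exists_eq_add_one h
    rw [recur_add_one x fun _ _ => y]
  induction A with
  | eq s t =>
    intro v
    change recur (ev t v φ - ev s v φ) (fun _ _ => 1) (ev s v φ - ev t v φ) = 0 ↔
      ev s v φ = ev t v φ
    rw [le_antisymm_iff (a := ev s v φ), le_def (ev s v φ), le_def (ev t v φ)]
    by_cases h : ev s v φ - ev t v φ = 0
    · rw [h0 _ _ _ h]; simp only [h, true_and]
    · rw [h1 _ _ _ h]; simp only [h, one_ne_zero, false_and]
  | bot => exact fun v => iff_of_false (Arith.add_one_ne_zero (M := M) 0 ∘ fun h => by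
      rw [zero_add]; exact h) id
  | and A B ihA ihB =>
    intro v
    change recur (ev (chi B) v φ) (fun _ _ => 1) (ev (chi A) v φ) = 0 ↔ _ ∧ _
    rw [← ihA hA.1, ← ihB hA.2]
    by_cases h : ev (chi A) v φ = 0
    · rw [h0 _ _ _ h]; simp only [h, true_and]
    · rw [h1 _ _ _ h]; simp only [h, one_ne_zero, false_and]
  | or A B ihA ihB =>
    intro v
    simp only [chi, ev, ev_sh, ext_succ]
    change recur 0 (fun _ _ => ev (chi B) v φ) (ev (chi A) v φ) = 0 ↔ _ ∨ _
    rw [← ihA hA.1, ← ihB hA.2]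
    by_cases h : ev (chi A) v φ = 0
    · rw [h0 _ _ _ h]; simp only [h, true_or]
    · rw [h1 _ _ _ h]; simp only [h, false_or]
  | imp A B ihA ihB =>
    intro v
    change recur (ev (chi B) v φ) (fun _ _ => 0) (ev (chi A) v φ) = 0 ↔ (_ → _)
    rw [← ihA hA.1, ← ihB hA.2]
    by_cases h : ev (chi A) v φ = 0
    · rw [h0 _ _ _ h]; simp only [h, true_imp_iff]
    · rw [h1 _ _ _ h]; simp only [h, false_imp_iff]
  | _ => exact hA.elim

/-- The bounded quantification `∀ j < n, A(j)` of a quantifier-free formula, as an equation. -/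
def Formula.ball (n : Term) (A : Formula) : Formula :=
  .prec .zero (.add ♯0 ((chi A).ren Nat.succ id)) n ≐ .zero

/-- The term with value `1` if the quantifier-free formula `A` holds, and `0` otherwise. -/
def ind (A : Formula) : Term := .tsub .one (chi A)

theorem sat_ball (hφ : ∀ i, Definable₁ (φ i)) (n : Term) (A : Formula) (hA : A.QF) (v : ℕ → M) :
    Sat (A.ball n) v φ ↔ ∀ j < ev n v φ, Sat A (ext j v) φ := by
  have h : Sat (A.ball n) v φ ↔ sumM (fun j => ev (chi A) (ext j v) φ) (ev n v φ) = 0 := by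
    simp only [Formula.ball, Sat, ev, Term.add, ev_ren]
    rfl
  have := definable_ev_ext hφ (chi A) v
  rw [h, sumM_eq_zero fun j => ev (chi A) (ext j v) φ]
  simp only [ev_chi A hA]

theorem ev_ind (A : Formula) (hA : A.QF) (v : ℕ → M) :
    0 < ev (ind A) v φ ↔ Sat A v φ := by
  rw [← ev_chi A hA]
  change 0 < 1 - ev (chi A) v φ ↔ _
  rw [tsub_pos_iff_lt, ← zero_add (1 : M), lt_add_one_iff', nonpos_iff_eq_zero]

end Semantics

end IRCA

/-! ### Pairs, division and finite sequences inside a structure -/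

namespace IRCA

open PRModel

section Coding

variable {M : Type} [PRModel M]

/-! ### Pairs -/

/-- `x (x - 1) / 2` -/
def triM (x : M) : M := sumM (fun j => j) x

instance (f : (ℕ → M) → M) [Definable f] : Definable fun v => triM (f v) := by
  unfold triM; infer_instance

/-- The code of a pair `a < b`. -/
def edgeM (a b : M) : M := triM b + a

instance (f g : (ℕ → M) → M) [Definable f] [Definable g] : Definable fun v => edgeM (f v) (g v) := by
  unfold edgeM; infer_instance

/-- The code of a pair. -/
def pairM (i n : M) : M := edgeM i (i + n + 1)

instance (f g : (ℕ → M) → M) [Definable f] [Definable g] : Definable fun v => pairM (f v) (g v) := by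
  unfold pairM; infer_instance

theorem triM_zero : triM (0 : M) = 0 := sumM_zero _

theorem triM_add_one (x : M) : triM (x + 1) = triM x + x := sumM_succ _ x

theorem triM_mono {x y : M} (h : x ≤ y) : triM x ≤ triM y := by
  obtain ⟨z, rfl⟩ := exists_add_of_le h
  refine induction (P := fun z : M => triM x ≤ triM (x + z)) (by simp) (fun z ih => ?_) z
  rw [← add_assoc, triM_add_one]
  exact ih.trans le_self_add

/-- The codes with larger endpoint `b` fill the interval from `triM b` up to, but excluding, `triM
(b + 1)`; intervals for different `b` are disjoint. -/
theorem edgeM_lt {a b b' : M} (h : a < b) (hb : b < b') (a' : M) : edgeM a b < edgeM a' b' := by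
  have := triM_mono ((lt_iff_add_one_le _ _).1 hb)
  rw [triM_add_one] at this
  calc edgeM a b < triM b + b := by unfold edgeM; gcongr
    _ ≤ triM b' := this
    _ ≤ _ := le_self_add

theorem edgeM_inj {a b a' b' : M} (h : a < b) (h' : a' < b') (e : edgeM a b = edgeM a' b') :
    a = a' ∧ b = b' := by
  have hb : b = b' := by
    rcases lt_trichotomy b b' with k | k | k
    · exact ((edgeM_lt h k a').ne e).elim
    · exact k
    · exact ((edgeM_lt h' k a).ne e.symm).elim
  subst hb
  exact ⟨add_left_cancel e, rfl⟩

theorem le_triM_add_one (x : M) : x ≤ triM (x + 1) := by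
  rw [triM_add_one]; exact le_add_self

theorem add_le_pairM (i n : M) : i + n ≤ pairM i n :=
  (le_triM_add_one _).trans le_self_add

theorem left_le_pairM (i n : M) : i ≤ pairM i n := le_self_add.trans (add_le_pairM i n)

theorem right_le_pairM (i n : M) : n ≤ pairM i n := le_add_self.trans (add_le_pairM i n)

theorem pairM_inj {i n i' n' : M} (e : pairM i n = pairM i' n') : i = i' ∧ n = n' := by
  have h (i n : M) : i < i + n + 1 := (lt_add_one_iff' _ _).2 le_self_add
  obtain ⟨rfl, e⟩ := edgeM_inj (h i n) (h i' n') e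
  rw [add_assoc, add_assoc] at e
  exact ⟨rfl, add_right_cancel (add_left_cancel e)⟩

theorem edgeM_right_le {a b : M} (h : a < b) : b ≤ edgeM a b + 1 := by
  obtain ⟨b, rfl⟩ := exists_eq_add_one (ne_zero_of_lt h)
  gcongr
  exact (le_triM_add_one b).trans le_self_add

theorem exists_pairM (x : M) : ∃ i n, x = pairM i n := by
  have := induction (P := fun x : M => ∃ i < x + 1, ∃ n < x + 1, x = pairM i n)
    ⟨0, by simp, 0, by simp, by
      simpa [pairM, edgeM, triM_zero] using (triM_add_one (0 : M)).symm⟩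
    (fun x ih => by
      obtain ⟨i, -, n, -, rfl⟩ := ih
      -- The successor of a code moves along the diagonal from `(i, n + 1)` to `(i + 1, n)`, and
      -- from its end `(i, 0)` to the start `(0, i + 1)` of the next.
      have key : ∃ i' n', pairM i n + 1 = pairM i' n' := by
        rcases eq_or_ne n 0 with rfl | hn
        · refine ⟨0, i + 1, ?_⟩
          simp only [pairM, edgeM, add_zero, zero_add]
          rw [triM_add_one (i + 1)]; ring
        · obtain ⟨n, rfl⟩ := exists_eq_add_one hn
          refine ⟨i + 1, n, ?_⟩
          simp only [pairM, edgeM]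
          rw [show i + 1 + n = i + (n + 1) by ring]; ring
      obtain ⟨i', n', e⟩ := key
      refine ⟨i', ?_, n', ?_, e⟩
      · rw [e, lt_add_one_iff']; exact left_le_pairM _ _
      · rw [e, lt_add_one_iff']; exact right_le_pairM _ _) x
  obtain ⟨i, -, n, -, e⟩ := this
  exact ⟨i, n, e⟩

/-! ### Division -/

section

variable (f g : M → M) [Definable fun v => f (v 0)] [Definable fun v => g (v 0)]

theorem sumM_le_sumM {n : M} (h : ∀ j < n, f j ≤ g j) : sumM f n ≤ sumM g n := by
  refine induction (P := fun m : M => m ≤ n → sumM f m ≤ sumM g m)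
    (by rw [sumM_zero, sumM_zero]; exact fun _ => le_rfl) (fun m ih hm => ?_) n le_rfl
  have hm' : m < n := (lt_iff_add_one_le _ _).2 hm
  rw [sumM_succ, sumM_succ]
  exact add_le_add (ih hm'.le) (h m hm')

theorem sumM_lt_sumM {n i : M} (h : ∀ j < n, f j ≤ g j) (hi : i < n) (hfg : f i < g i) :
    sumM f n < sumM g n := by
  refine induction (P := fun m : M => m ≤ n → i < m → sumM f m < sumM g m)
    (by simp) (fun m ih hm him => ?_) n le_rfl hi
  have hm' : m < n := (lt_iff_add_one_le _ _).2 hm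
  rw [sumM_succ, sumM_succ]
  rcases ((lt_add_one_iff' _ _).1 him).eq_or_lt with rfl | k
  · exact add_lt_add_of_le_of_lt
      (sumM_le_sumM f g fun j hj => h j (hj.trans hm')) hfg
  · exact add_lt_add_of_lt_of_le (ih hm'.le k) (h m hm')

theorem sumM_shift (n : M) : sumM f (n + 1) = f 0 + sumM (fun j => f (j + 1)) n := by
  refine induction (P := fun n : M => sumM f (n + 1) = f 0 + sumM (fun j => f (j + 1)) n)
    (by rw [sumM_succ, sumM_zero, sumM_zero, zero_add, add_zero]) (fun n ih => ?_) n
  rw [sumM_succ, ih, sumM_succ (fun j => f (j + 1)), add_assoc]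

theorem sumM_extend {m n : M} (hmn : m ≤ n) (h : ∀ j, m ≤ j → f j = 0) :
    sumM f n = sumM f m := by
  obtain ⟨z, rfl⟩ := exists_add_of_le hmn
  refine induction (P := fun z : M => sumM f (m + z) = sumM f m) (by rw [add_zero])
    (fun z ih => ?_) z
  rw [← add_assoc, sumM_succ, ih, h _ le_self_add, add_zero]

end

instance (f g : (ℕ → M) → M) [Definable f] [Definable g] :
    Definable fun v => min (f v) (g v) := by
  have e (x y : M) : min x y = x - (x - y) := by
    rcases le_total x y with h | h
    · rw [min_eq_left h, tsub_eq_zero_of_le h, tsub_zero]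
    · rw [min_eq_right h, tsub_tsub_cancel_of_le h]
  simp only [e]
  infer_instance

/-- The quotient `⌊x / k⌋` for `k ≥ 1`. -/
def divM (x k : M) : M := sumM (fun j => 1 - (succ j * k - x)) x

instance : Definable fun v : ℕ → M => divM (v 0) (v 1) := by
  unfold divM; infer_instance

instance (f g : (ℕ → M) → M) [Definable f] [Definable g] : Definable fun v => divM (f v) (g v) :=
  .comp₂ divM f g

theorem exists_div {k : M} (hk : 0 < k) (x : M) : ∃ q r, x = k * q + r ∧ r < k := by
  have := induction (P := fun x : M => ∃ q < x + 1, ∃ r < k, x = k * q + r)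
    ⟨0, by simp, 0, hk, by simp⟩
    (fun x ih => by
      obtain ⟨q, hq, r, hr, e⟩ := ih
      rcases ((lt_iff_add_one_le _ _).1 hr).eq_or_lt with h | h
      · refine ⟨q + 1, by gcongr, 0, hk, ?_⟩
        rw [e, add_zero, mul_add, mul_one, add_assoc, h]
      · exact ⟨q, hq.trans (by rw [lt_add_one_iff']), r + 1, h, by rw [e, add_assoc]⟩) x
  obtain ⟨q, -, r, hr, e⟩ := this
  exact ⟨q, r, e, hr⟩

theorem divM_eq {k q r : M} (hr : r < k) : divM (k * q + r) k = q := by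
  set x := k * q + r with hx
  -- The summand for `j` is `1` precisely when `(j + 1) k ≤ x`, that is when `j < q`; so the count
  -- over `j < n` is `min n q`.
  have key := induction (P := fun n : M => sumM (fun j => 1 - (succ j * k - x)) n = min n q)
    (by rw [sumM_zero]; simp)
    (fun n ih => by
      rw [sumM_succ (fun j => 1 - (succ j * k - x)), ih, succ_eq]
      rcases lt_or_ge n q with h | h
      · have h' := (lt_iff_add_one_le _ _).1 h
        have : (n + 1) * k ≤ x := by
          rw [hx, mul_comm]
          exact (mul_le_mul_right h' k).trans le_self_add
        rw [tsub_eq_zero_of_le this, tsub_zero, min_eq_left h.le, min_eq_left h']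
      · have : x < (n + 1) * k := by
          have : k * q ≤ k * n := mul_le_mul_right h k
          calc x = k * q + r := rfl
            _ < k * q + k := by gcongr
            _ ≤ k * n + k := by gcongr
            _ = _ := by ring
        have h1 : 1 ≤ (n + 1) * k - x := by
          simpa using (lt_iff_add_one_le _ _).1 (tsub_pos_of_lt this)
        rw [tsub_eq_zero_of_le h1, min_eq_right h, min_eq_right (h.trans le_self_add),
          add_zero]) x
  refine key.trans (min_eq_right ?_)
  have h1 : 1 ≤ k := by
    rw [← zero_add (1 : M), ← lt_iff_add_one_le]; exact pos_of_gt hr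
  calc q = 1 * q := (one_mul q).symm
    _ ≤ k * q := mul_le_mul_left h1 q
    _ ≤ x := le_self_add

/-! ### Finite sequences -/

/-- The sequence `c` followed by `i`. -/
def snocM (k c i : M) : M := k * c + i + 1

instance (f g h : (ℕ → M) → M) [Definable f] [Definable g] [Definable h] :
    Definable fun v => snocM (f v) (g v) (h v) := by
  unfold snocM; infer_instance

/-- The sequence `c` without its last entry. -/
def parentM (k c : M) : M := divM (predM c) k

instance (f g : (ℕ → M) → M) [Definable f] [Definable g] :
    Definable fun v => parentM (f v) (g v) := by
  unfold parentM; infer_instance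

/-- The last entry. -/
def lastM (k c : M) : M := predM c - k * parentM k c

/-- The sequence `c` without its last `j` entries. -/
def cutM (k c j : M) : M := recur c (fun u _ => parentM k u) j

instance : Definable fun v : ℕ → M => cutM (v 0) (v 1) (v 2) :=
  definable_recur (fun v => v 1) (fun u _ v => parentM (v 0) u) (fun v => v 2)

instance (f g h : (ℕ → M) → M) [Definable f] [Definable g] [Definable h] :
    Definable fun v => cutM (f v) (g v) (h v) := .comp₃ cutM f g h

/-- The length. -/
def lenM (k c : M) : M := sumM (fun j => 1 - (1 - cutM k c j)) c

instance : Definable fun v : ℕ → M => lenM (v 0) (v 1) := by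
  unfold lenM; infer_instance

instance (f g : (ℕ → M) → M) [Definable f] [Definable g] : Definable fun v => lenM (f v) (g v) :=
  .comp₂ lenM f g

/-- The entry with index `i`. -/
def entryM (k c i : M) : M := lastM k (cutM k c (lenM k c - (i + 1)))

variable {k : M}

theorem predM_snocM (c i : M) : predM (snocM k c i) = k * c + i := by
  rw [predM_eq, snocM, add_tsub_cancel_right]

theorem parentM_snocM {i : M} (hi : i < k) (c : M) : parentM k (snocM k c i) = c := by
  rw [parentM, predM_snocM, divM_eq hi]

theorem lastM_snocM {i : M} (hi : i < k) (c : M) : lastM k (snocM k c i) = i := by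
  rw [lastM, parentM_snocM hi, predM_snocM, add_tsub_cancel_left]

theorem exists_snocM (hk : 0 < k) {c : M} (hc : c ≠ 0) : ∃ d i, i < k ∧ c = snocM k d i := by
  obtain ⟨x, rfl⟩ := exists_eq_add_one hc
  obtain ⟨q, r, rfl, hr⟩ := exists_div hk x
  exact ⟨q, r, hr, rfl⟩

theorem lt_snocM (hk : 0 < k) (c i : M) : c < snocM k c i := by
  have h1 : 1 ≤ k := by rwa [← zero_add (1 : M), ← lt_iff_add_one_le]
  rw [snocM, lt_add_one_iff']
  calc c = 1 * c := (one_mul c).symm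
    _ ≤ k * c := mul_le_mul_left h1 c
    _ ≤ _ := le_self_add

/-- Removing the last entry makes a nonzero code smaller, so a least counterexample is impossible.
-/
theorem code_induction (hk : 0 < k) {P : M → Prop} [DefPred fun v => P (v 0)] (h0 : P 0)
    (hs : ∀ c i, i < k → P c → P (snocM k c i)) (c : M) : P c := by
  by_contra hc
  obtain ⟨d, -, hd, hmin⟩ := exists_least (P := fun c => ¬ P c) hc
  rcases eq_or_ne d 0 with rfl | h
  · exact hd h0
  obtain ⟨c, i, hi, rfl⟩ := exists_snocM hk h
  exact hd (hs c i hi (not_not.1 (hmin c (lt_snocM hk c i))))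

theorem parentM_zero (hk : 0 < k) : parentM k 0 = 0 := by
  have := divM_eq (q := 0) hk
  rw [mul_zero, add_zero] at this
  rw [parentM, predM_eq, zero_tsub, this]

theorem cutM_zero (c : M) : cutM k c 0 = c := recur_zero'' c fun u _ => parentM k u

theorem cutM_succ (c j : M) : cutM k c (j + 1) = parentM k (cutM k c j) :=
  recur_add_one c (fun u _ => parentM k u) j

theorem cutM_cutM (c i j : M) : cutM k (cutM k c i) j = cutM k c (i + j) :=
  induction (P := fun j : M => cutM k (cutM k c i) j = cutM k c (i + j))
    (by rw [cutM_zero, add_zero]) (fun j ih => by rw [cutM_succ, ih, ← add_assoc, cutM_succ]) j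

theorem cutM_one (c : M) : cutM k c 1 = parentM k c := by
  rw [← zero_add (1 : M), cutM_succ, cutM_zero]

theorem cutM_snocM {i : M} (hi : i < k) (c j : M) : cutM k (snocM k c i) (j + 1) = cutM k c j := by
  rw [add_comm, ← cutM_cutM, cutM_one, parentM_snocM hi]

theorem cutM_eq_zero (hk : 0 < k) (c : M) : ∀ j, c ≤ j → cutM k c j = 0 := by
  -- Each cut lowers a nonzero code by at least one.
  have h (j : M) : cutM k c j ≤ c - j := by
    refine induction (P := fun j : M => cutM k c j ≤ c - j) (by rw [cutM_zero, tsub_zero])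
      (fun j ih => ?_) j
    rw [cutM_succ, ← tsub_tsub]
    rcases eq_or_ne (cutM k c j) 0 with e | e
    · rw [e, parentM_zero hk]; exact zero_le
    · obtain ⟨d, i, hi, e⟩ := exists_snocM hk e
      rw [e, parentM_snocM hi]
      rw [e] at ih
      have := (lt_iff_add_one_le _ _).1 ((lt_snocM hk d i).trans_le ih)
      exact le_tsub_of_add_le_right this
  intro j hj
  have := h j
  rwa [tsub_eq_zero_of_le hj, nonpos_iff_eq_zero] at this

theorem lenM_zero : lenM k 0 = 0 := sumM_zero _

theorem lenM_snocM {i : M} (hi : i < k) (c : M) : lenM k (snocM k c i) = lenM k c + 1 := by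
  have hk : 0 < k := pos_of_gt hi
  have e : lenM k (snocM k c i) = sumM (fun j => 1 - (1 - cutM k (snocM k c i) j))
    (k * c + i + 1) := rfl
  rw [e, sumM_shift (fun j => 1 - (1 - cutM k (snocM k c i) j)), cutM_zero, add_comm]
  have h1 : 1 ≤ snocM k c i := le_add_self
  rw [tsub_eq_zero_of_le h1, tsub_zero]
  simp only [cutM_snocM hi]
  -- The sum defining a length runs up to the code itself, hence further for the longer sequence;
  -- the additional summands vanish because those cuts are empty.
  rw [sumM_extend (fun j => 1 - (1 - cutM k c j)) (m := c)
    ((lt_add_one_iff' _ _).1 (lt_snocM hk c i)), lenM]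
  intro j hj
  rw [cutM_eq_zero hk c j hj, tsub_zero, tsub_self]

theorem lenM_parentM (hk : 0 < k) (c : M) : lenM k (parentM k c) = lenM k c - 1 := by
  rcases eq_or_ne c 0 with rfl | h
  · rw [parentM_zero hk, lenM_zero, zero_tsub]
  · obtain ⟨d, i, hi, rfl⟩ := exists_snocM hk h
    rw [parentM_snocM hi, lenM_snocM hi, add_tsub_cancel_right]

theorem lenM_cutM (hk : 0 < k) (c j : M) : lenM k (cutM k c j) = lenM k c - j :=
  induction (P := fun j : M => lenM k (cutM k c j) = lenM k c - j) (by rw [cutM_zero, tsub_zero])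
    (fun j ih => by rw [cutM_succ, lenM_parentM hk, ih, tsub_tsub]) j

theorem lenM_eq_zero (hk : 0 < k) {c : M} (h : lenM k c = 0) : c = 0 := by
  by_contra hc
  obtain ⟨d, i, hi, rfl⟩ := exists_snocM hk hc
  rw [lenM_snocM hi] at h
  exact Arith.add_one_ne_zero _ h

theorem cutM_len (hk : 0 < k) (c : M) : cutM k c (lenM k c) = 0 :=
  lenM_eq_zero hk (by rw [lenM_cutM hk, tsub_self])

theorem entryM_cutM (hk : 0 < k) {c i j : M} (h : i + 1 ≤ lenM k c - j) :
    entryM k (cutM k c j) i = entryM k c i := by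
  rw [entryM, lenM_cutM hk, cutM_cutM, entryM]
  have hj : j + (i + 1) ≤ lenM k c := by
    rw [add_comm]
    by_cases hjl : j ≤ lenM k c
    · exact (le_tsub_iff_right hjl).1 h
    · rw [tsub_eq_zero_of_le (le_of_not_ge hjl), nonpos_iff_eq_zero] at h
      exact (Arith.add_one_ne_zero _ h).elim
  rw [tsub_right_comm, add_tsub_cancel_of_le (le_tsub_of_add_le_right hj)]

/-- A bound for the codes of sequences of length `m`. -/
def boundM (k m : M) : M := recur 0 (fun u _ => k * u + k) m

instance : Definable fun v : ℕ → M => boundM (v 0) (v 1) :=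
  definable_recur (fun _ => 0) (fun u _ v => v 0 * u + v 0) (fun v => v 1)

instance (f g : (ℕ → M) → M) [Definable f] [Definable g] : Definable fun v => boundM (f v) (g v) :=
  .comp₂ boundM f g

/-- Makes quantification over the sequences of a given length bounded, so that being dead at a given
height is a definable predicate. -/
theorem le_boundM (hk : 0 < k) (c : M) : c ≤ boundM k (lenM k c) :=
  code_induction hk (P := fun c => c ≤ boundM k (lenM k c)) zero_le (fun c i hi ih => by
    rw [lenM_snocM hi, boundM, recur_add_one 0 (fun u _ => k * u + k), snocM, add_assoc]
    exact add_le_add (mul_le_mul_right ih k) ((lt_iff_add_one_le _ _).1 hi)) c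

/-! ### Branches -/

/-- `g n` is the sequence of the first `n` values of `f`. -/
structure IsBranch (k : M) (f g : M → M) : Prop where
  lt (n : M) : f n < k
  zero : g 0 = 0
  succ (n : M) : g (n + 1) = snocM k (g n) (f n)

section

variable {f g : M → M} [Definable fun v => f (v 0)] [Definable fun v => g (v 0)]
  (h : IsBranch k f g)

include h

omit [Definable fun v => f (v 0)] in
theorem IsBranch.len (n : M) : lenM k (g n) = n :=
  induction (P := fun n : M => lenM k (g n) = n) (by rw [h.zero, lenM_zero])
    (fun n ih => by rw [h.succ, lenM_snocM (h.lt n), ih]) n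

omit [Definable fun v => f (v 0)] in
theorem IsBranch.cut (n j : M) : cutM k (g n) j = g (n - j) := by
  have hk := pos_of_gt (h.lt 0)
  refine induction (P := fun j : M => cutM k (g n) j = g (n - j)) (by rw [cutM_zero, tsub_zero])
    (fun j ih => ?_) j
  rw [cutM_succ, ih, ← tsub_tsub]
  rcases eq_or_ne (n - j) 0 with e | e
  · rw [e, zero_tsub, h.zero, parentM_zero hk]
  · obtain ⟨m, e⟩ := exists_eq_add_one e
    rw [e, h.succ, parentM_snocM (h.lt m), add_tsub_cancel_right]

omit [Definable fun v => f (v 0)] in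
theorem IsBranch.entry {n i : M} (hi : i < n) : entryM k (g n) i = f i := by
  have e : n - (n - (i + 1)) = i + 1 := tsub_tsub_cancel_of_le ((lt_iff_add_one_le _ _).1 hi)
  rw [entryM, h.len, h.cut, e, h.succ, lastM_snocM (h.lt i)]

end

end Coding

/-! ### Values of the coding terms -/

section Semantics

variable {M : Type} [PRModel M] (v : ℕ → M) (φ : ℕ → M → M) (r s t : Term)

open Term

@[simp] theorem ev_var (n : ℕ) : ev ♯n v φ = v n := rfl
@[simp] theorem ev_zero : ev zero v φ = 0 := rfl
@[simp] theorem ev_succ : ev (succ t) v φ = ev t v φ + 1 := succ_eq _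
@[simp] theorem ev_app (i : ℕ) : ev (app i t) v φ = φ i (ev t v φ) := rfl
@[simp] theorem ev_one : ev one v φ = 1 := rfl
@[simp] theorem ev_two : ev two v φ = 2 := (succ_eq _).trans one_add_one_eq_two
@[simp] theorem ev_add : ev (add s t) v φ = ev s v φ + ev t v φ := rfl
@[simp] theorem ev_tsub : ev (tsub s t) v φ = ev s v φ - ev t v φ := rfl

@[simp] theorem ev_mul : ev (mul s t) v φ = ev s v φ * ev t v φ := by
  simp only [mul, ev, ev_add, ev_sh, ext_succ]; rfl

@[simp] theorem ev_edgeCode : ev (edgeCode s t) v φ = edgeM (ev s v φ) (ev t v φ) := rfl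

@[simp] theorem ev_pair : ev (pair s t) v φ = pairM (ev s v φ) (ev t v φ) := by
  simp only [pair, ev_edgeCode, ev_succ, ev_add]; rfl

@[simp] theorem ev_div : ev (div s t) v φ = divM (ev s v φ) (ev t v φ) := by
  simp only [div, ev, ev_add, ev_tsub, ev_mul, ev_sh, ext_succ, ev_one]; rfl

@[simp] theorem ev_snoc : ev (snoc r s t) v φ = snocM (ev r v φ) (ev s v φ) (ev t v φ) := by
  simp only [snoc, ev_succ, ev_add, ev_mul]; rfl

@[simp] theorem ev_parent : ev (parent s t) v φ = parentM (ev s v φ) (ev t v φ) := by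
  simp only [parent, ev_div]; rfl

@[simp] theorem ev_last : ev (last s t) v φ = lastM (ev s v φ) (ev t v φ) := by
  simp only [last, ev_tsub, ev_mul, ev_parent]; rfl

@[simp] theorem ev_cut : ev (cut r s t) v φ = cutM (ev r v φ) (ev s v φ) (ev t v φ) := by
  simp only [cut, ev, ev_parent, ev_sh, ext_succ]; rfl

@[simp] theorem ev_len : ev (len s t) v φ = lenM (ev s v φ) (ev t v φ) := by
  simp only [len, ev, ev_add, ev_tsub, ev_cut, ev_sh, ext_succ, ev_one]; rfl

@[simp] theorem ev_entry : ev (entry r s t) v φ = entryM (ev r v φ) (ev s v φ) (ev t v φ) := by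
  simp only [entry, ev_last, ev_cut, ev_tsub, ev_len, ev_succ]; rfl

end Semantics

end IRCA

/-! ### Trees and LLPO inside a structure -/

namespace IRCA

open PRModel

section Combinatorics

variable {M : Type} [PRModel M] {k : M}

/-! ### Parity, first arguments, trees -/

noncomputable instance (P : (ℕ → M) → Prop) (f g : (ℕ → M) → M) [hP : DefPred P] [Definable f]
    [Definable g] [∀ v, Decidable (P v)] : Definable fun v => if P v then f v else g v := by
  obtain ⟨c, hc, h⟩ := exists_chi P
  have := Definable.reindex g (· + 2)
  have e : (fun v => if P v then f v else g v) = fun v => recur (f v) (fun _ _ => g v) (c v) := by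
    funext v
    split_ifs with hv
    · rw [(h v).1 hv, recur_zero'' (f v) fun _ _ => g v]
    · obtain ⟨z, e⟩ := exists_eq_add_one (mt (h v).2 hv)
      rw [e, recur_add_one (f v) fun _ _ => g v]
  rw [e]
  infer_instance

theorem even_or_odd' (j : M) : (∃ m, j = 2 * m) ∨ ∃ m, j = 2 * m + 1 := by
  obtain ⟨q, r, e, hr⟩ := exists_div (k := (2 : M)) two_pos j
  rw [← one_add_one_eq_two, lt_add_one_iff'] at hr
  rcases hr.eq_or_lt with rfl | hr
  · exact .inr ⟨q, e⟩
  · rw [← zero_add (1 : M), lt_add_one_iff', nonpos_iff_eq_zero] at hr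
    exact .inl ⟨q, by rw [e, hr, add_zero]⟩

theorem two_mul_ne (m n : M) : 2 * m ≠ 2 * n + 1 := by
  intro h
  have h1 := divM_eq (k := (2 : M)) (q := m) (r := 0) two_pos
  have h2 := divM_eq (k := (2 : M)) (q := n) (r := 1) one_lt_two
  rw [add_zero, h, h2] at h1
  subst h1
  exact Arith.add_one_ne_zero (0 : M) (by rw [zero_add]; exact left_eq_add.1 h)

theorem le_two_mul (m : M) : m ≤ 2 * m := by
  rw [two_mul]; exact le_self_add

/-- `j` is the first argument at which the `i`-th function given by `p` is not `0`. -/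
def First (p : M → M) (i j : M) : Prop := p (pairM i j) ≠ 0 ∧ ∀ t < j, p (pairM i t) = 0

/-- `j` is not of the form `2 m`. -/
def NotEven (j : M) : Prop := ∀ m < j + 1, j ≠ 2 * m

/-- `j` is not of the form `2 m + 1`. -/
def NotOdd (j : M) : Prop := ∀ m < j + 1, j ≠ 2 * m + 1

theorem notEven_iff (j : M) : NotEven j ↔ ∀ m, j ≠ 2 * m :=
  ⟨fun h m e => h m (by rw [lt_add_one_iff', e]; exact le_two_mul m) e, fun h m _ => h m⟩

theorem notOdd_iff (j : M) : NotOdd j ↔ ∀ m, j ≠ 2 * m + 1 :=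
  ⟨fun h m e => h m (by rw [lt_add_one_iff', e]; exact (le_two_mul m).trans le_self_add) e,
    fun h m _ => h m⟩

theorem notOdd_iff_not (j : M) : NotOdd j ↔ ¬ NotEven j := by
  rw [notEven_iff, notOdd_iff]
  rcases even_or_odd' j with ⟨m, rfl⟩ | ⟨m, rfl⟩
  · exact iff_of_true (two_mul_ne m) fun h => h m rfl
  · exact iff_of_false (fun h => h m rfl) fun h => h fun n => (two_mul_ne n m).symm

theorem First.unique {p : M → M} {i j j' : M} (h : First p i j) (h' : First p i j') : j = j' := by
  rcases lt_trichotomy j j' with k | k | k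
  · exact (h.1 (h'.2 j k)).elim
  · exact k
  · exact (h'.1 (h.2 j' k)).elim

theorem exists_first {p : M → M} [Definable₁ p] {i j : M} (h : p (pairM i j) ≠ 0) :
    ∃ j' ≤ j, First p i j' := by
  obtain ⟨j', hj, h1, h2⟩ := exists_least (P := fun j => p (pairM i j) ≠ 0) h
  exact ⟨j', hj, h1, fun t ht => not_not.1 (h2 t ht)⟩

/-- The sequence `x` is in the tree coded by `t`. -/
def InT (k : M) (t : M → M) (x : M) : Prop := ∀ j < x + 1, 0 < t (cutM k x j)

instance (k : M) (t : M → M) [Definable₁ t] (f : (ℕ → M) → M) [Definable f] :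
    DefPred fun v => InT k t (f v) := by
  have := Definable.reindex f (· + 1)
  unfold InT; infer_instance

/-- After as many cuts as the code is large only the empty sequence is left, so the unbounded
quantifier in the definition of the tree is equivalent to a bounded one. -/
theorem inT_iff (hk : 0 < k) (t : M → M) (x : M) : InT k t x ↔ ∀ j, 0 < t (cutM k x j) := by
  refine ⟨fun h j => ?_, fun h j _ => h j⟩
  rcases lt_or_ge j (x + 1) with hj | hj
  · exact h j hj
  · have := h x (lt_add_one _)
    rw [cutM_eq_zero hk x x le_rfl] at this
    rwa [cutM_eq_zero hk x j (le_self_add.trans hj)]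

/-- The sequence of the first `n` values of `f`. -/
def codeM (k : M) (f : M → M) (n : M) : M := recur 0 (fun u j => snocM k u (f j)) n

instance (k : M) (f : M → M) [Definable fun v => f (v 0)] (n : (ℕ → M) → M) [Definable n] :
    Definable fun v => codeM k f (n v) := by
  have := Definable.reindex (fun v => f (v 0)) (· + 1)
  unfold codeM; infer_instance

theorem isBranch_codeM {f : M → M} [Definable fun v => f (v 0)] (hf : ∀ n, f n < k) :
    IsBranch k f (codeM k f) := by
  have := Definable.reindex (fun v => f (v 0)) (· + 1)
  exact ⟨hf, recur_zero'' 0 fun u j => snocM k u (f j),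
    fun n => recur_add_one 0 (fun u j => snocM k u (f j)) n⟩

theorem IsBranch.eq_codeM {f g : M → M} [Definable fun v => f (v 0)] [Definable fun v => g (v 0)]
    (h : IsBranch k f g) (n : M) : g n = codeM k f n :=
  have h' := isBranch_codeM h.lt
  induction (P := fun n : M => g n = codeM k f n) (by rw [h.zero, h'.zero])
    (fun n ih => by rw [h.succ, h'.succ, ih]) n

/-- The branch of the tree obtained by following the successor function `s`. -/
def followM (k : M) (s : M → M) (n : M) : M := recur 0 (fun u _ => snocM k u (s u)) n

instance (k : M) (s : M → M) [Definable₁ s] (n : (ℕ → M) → M) [Definable n] :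
    Definable fun v => followM k s (n v) := by
  unfold followM; infer_instance

section

variable (k) (s : M → M) [Definable₁ s]

theorem followM_zero : followM k s 0 = 0 := recur_zero'' 0 fun u _ => snocM k u (s u)

theorem followM_succ (n : M) : followM k s (n + 1) = snocM k (followM k s n) (s (followM k s n)) :=
  recur_add_one 0 (fun u _ => snocM k u (s u)) n

end

/-- A path through a tree yields the function of its entries. -/
theorem path_fun (hk : 0 < k) {t p s f : M → M} [Definable₁ p] [Definable₁ s] [Definable₁ f]
    (h0 : InT k p 0) (hp : ∀ c, InT k p c → InT k t c)
    (hs : ∀ c, InT k p c → s c < k ∧ InT k p (snocM k c (s c)))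
    (hf : ∀ n, f n = s (followM k s n)) (n : M) : f n < k ∧ 0 < t (codeM k f n) := by
  have h (n : M) : InT k p (followM k s n) :=
    induction (P := fun n : M => InT k p (followM k s n)) (by rw [followM_zero]; exact h0)
      (fun n ih => by rw [followM_succ]; exact (hs _ ih).2) n
  have hb : IsBranch k f (followM k s) :=
    ⟨fun n => by rw [hf]; exact (hs _ (h n)).1, followM_zero k s,
      fun n => by rw [followM_succ, hf]⟩
  refine ⟨hb.lt n, ?_⟩
  rw [← hb.eq_codeM]
  have := (inT_iff hk _ _).1 (hp _ (h n)) 0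
  rwa [cutM_zero] at this

/-! ### From trees to the lesser limited principle of omniscience -/

/-- The entries of `c` are correct values as far as can be seen below the length of `c`. -/
def Correct (k : M) (p : M → M) (c : M) : Prop :=
  ∀ i < lenM k c, entryM k c i < 2 ∧ ∀ j < lenM k c, First p i j →
    (entryM k c i = 0 → NotEven j) ∧ (entryM k c i = 1 → NotOdd j)

/-- At level `m` the value `1` is guessed exactly when an even first argument is visible below `m`.
This takes only a bounded search, so every level of the tree is inhabited without any omniscience.
-/
theorem correct_code (hk : 2 ≤ k) {p t f : M → M} [Definable₁ p] [Definable fun v => f (v 0)]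
    (ht : ∀ x, 0 < t x ↔ Correct k p x) {m : M}
    (hf : ∀ i, (f i = 1 ∧ ∃ j < m, First p i j ∧ NotOdd j) ∨
      (f i = 0 ∧ ¬ ∃ j < m, First p i j ∧ NotOdd j)) :
    lenM k (codeM k f m) = m ∧ ∀ j, 0 < t (cutM k (codeM k f m) j) := by
  have hf2 (n) : f n < 2 := by
    rcases hf n with ⟨h, -⟩ | ⟨h, -⟩ <;> rw [h]
    exacts [one_lt_two, two_pos]
  have hb := isBranch_codeM fun n => (hf2 n).trans_le hk
  refine ⟨hb.len m, fun j => ?_⟩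
  rw [ht, hb.cut, Correct, hb.len]
  intro i hi
  rw [hb.entry hi]
  refine ⟨hf2 i, fun j' hj' hfst => ⟨fun h => ?_, fun h => ?_⟩⟩
  · by_contra hn
    rw [← notOdd_iff_not] at hn
    rcases hf i with ⟨h', -⟩ | ⟨-, h'⟩
    · exact zero_ne_one (h.symm.trans h')
    · exact h' ⟨j', hj'.trans_le tsub_le_self, hfst, hn⟩
  · rcases hf i with ⟨-, j₁, -, h1, h2⟩ | ⟨h', -⟩
    · rwa [hfst.unique h1]
    · exact (zero_ne_one (h'.symm.trans h)).elim

theorem correct_values {p t f : M → M} [Definable₁ f] (ht : ∀ x, 0 < t x ↔ Correct k p x)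
    (hf : ∀ n, f n < k ∧ 0 < t (codeM k f n)) (i : M) :
    (f i = 0 → ∀ j, First p i j → ∀ m, j ≠ 2 * m) ∧
      (f i ≠ 0 → f i = 1 ∧ ∀ j, First p i j → ∀ m, j ≠ 2 * m + 1) := by
  have hb := isBranch_codeM fun n => (hf n).1
  have key (j : M) : f i < 2 ∧ (First p i j → (f i = 0 → NotEven j) ∧ (f i = 1 → NotOdd j)) := by
    -- This prefix is long enough to contain the entry `i` and to test the argument `j`.
    have := (ht _).1 (hf (max i j + 1)).2
    rw [Correct, hb.len] at this
    have hi : i < max i j + 1 := (lt_add_one_iff' _ _).2 (le_max_left _ _)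
    have hj : j < max i j + 1 := (lt_add_one_iff' _ _).2 (le_max_right _ _)
    have := this i hi
    rw [hb.entry hi] at this
    exact ⟨this.1, this.2 j hj⟩
  refine ⟨fun h j hj => (notEven_iff j).1 (((key j).2 hj).1 h), fun h => ?_⟩
  have h1 : f i = 1 := by
    have h2 := (key 0).1
    rw [← one_add_one_eq_two, lt_add_one_iff'] at h2
    refine h2.antisymm ?_
    rw [← zero_add (1 : M), ← lt_iff_add_one_le]
    exact pos_iff_ne_zero.2 h
  exact ⟨h1, fun j hj => (notOdd_iff j).1 (((key j).2 hj).2 h1)⟩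

/-! ### From trees to colorings -/

/-- `c` codes a coloring of an initial segment of the graph. -/
def ValidCol (k : M) (e : M → M) (c : M) : Prop :=
  ∀ b < lenM k c, ∀ a < b, e (edgeM a b) ≠ 0 → entryM k c a ≠ entryM k c b

/-- A coloring of the vertices `0, …, m` has length `m + 1`, so its last entry is dropped to obtain
an element of length `m`; all its initial segments color initial segments of the graph. -/
theorem validCol_parent (hk : 0 < k) {e t : M → M} (ht : ∀ x, 0 < t x ↔ ValidCol k e x) {c m : M}
    (hc : lenM k c = m + 1)
    (h : ∀ a b, a < b → b ≤ m → e (edgeM a b) ≠ 0 → entryM k c a ≠ entryM k c b) :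
    lenM k (parentM k c) = m ∧ ∀ j, 0 < t (cutM k (parentM k c) j) := by
  refine ⟨by rw [lenM_parentM hk, hc, add_tsub_cancel_right], fun j => ?_⟩
  rw [ht, ← cutM_one, cutM_cutM, ValidCol, lenM_cutM hk]
  intro b hb a hab
  have hb' := (lt_iff_add_one_le _ _).1 hb
  rw [entryM_cutM hk hb', entryM_cutM hk ((add_le_add_left hab.le 1).trans hb')]
  refine h a b hab ?_
  rw [← lt_add_one_iff', ← hc]
  exact hb.trans_le tsub_le_self

theorem validCol_fun {e t f : M → M} [Definable₁ f] (ht : ∀ x, 0 < t x ↔ ValidCol k e x)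
    (hf : ∀ n, f n < k ∧ 0 < t (codeM k f n)) {a b : M} (hab : a < b) (h : e (edgeM a b) ≠ 0) :
    f a ≠ f b := by
  have hb := isBranch_codeM fun n => (hf n).1
  have := (ht _).1 (hf (b + 1)).2
  rw [ValidCol, hb.len] at this
  have := this b (lt_add_one b) a hab h
  rwa [hb.entry (lt_add_one b), hb.entry (hab.trans (lt_add_one b))] at this

/-! ### From the lesser limited principle of omniscience to trees -/

/-- No extension of `c` by `m` entries is in the tree. -/
def Dead (k : M) (t : M → M) (c m : M) : Prop :=
  ∀ x < boundM k (lenM k c + m) + 1, ¬ (lenM k x = lenM k c + m ∧ cutM k x m = c ∧ InT k t x)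

instance (k : M) (t : M → M) [Definable₁ t] (f g : (ℕ → M) → M) [Definable f] [Definable g] :
    DefPred fun v => Dead k t (f v) (g v) := by
  have := Definable.reindex f (· + 1)
  have := Definable.reindex g (· + 1)
  unfold Dead; infer_instance

theorem dead_iff (hk : 0 < k) (t : M → M) (c m : M) : Dead k t c m ↔
    ∀ x, ¬ (lenM k x = lenM k c + m ∧ cutM k x m = c ∧ ∀ j, 0 < t (cutM k x j)) := by
  simp only [Dead, inT_iff hk]
  refine ⟨fun h x hx => h x ?_ hx, fun h x _ => h x⟩
  rw [lt_add_one_iff', ← hx.1]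
  exact le_boundM hk x

/-- A surviving extension of greater height can be cut back. -/
theorem Dead.mono (hk : 0 < k) {t : M → M} {c m n : M} (h : Dead k t c m) (hmn : m ≤ n) :
    Dead k t c n := by
  rw [dead_iff hk] at h ⊢
  obtain ⟨d, rfl⟩ := exists_add_of_le hmn
  rintro x ⟨h1, h2, h3⟩
  refine h (cutM k x d) ⟨?_, ?_, fun j => ?_⟩
  · rw [lenM_cutM hk, h1, ← add_assoc, add_tsub_cancel_right]
  · rw [cutM_cutM, add_comm, h2]
  · rw [cutM_cutM]; exact h3 _

/-- An extension of `c` by `m + 1` entries passes through some child, namely its cut by `m` entries.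
-/
theorem Dead.of_children (hk : 0 < k) {t : M → M} {c m : M}
    (h : ∀ i < k, Dead k t (snocM k c i) m) : Dead k t c (m + 1) := by
  rw [dead_iff hk]
  rintro x ⟨h1, h2, h3⟩
  have hne : cutM k x m ≠ 0 := by
    intro e
    have := lenM_cutM hk x m
    rw [e, lenM_zero, h1, ← add_assoc, add_right_comm, add_tsub_cancel_right] at this
    exact Arith.add_one_ne_zero _ this.symm
  obtain ⟨d, i, hi, e⟩ := exists_snocM hk hne
  rw [cutM_succ, e, parentM_snocM hi] at h2
  subst h2
  refine (dead_iff hk _ _ _).1 (h i hi) x ⟨?_, e, h3⟩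
  rw [h1, lenM_snocM hi]; ring

/-- The `j`-th stage of the function asking whether `c` followed by `i` dies out before its right
siblings do. -/
def Race (k : M) (t : M → M) (c i j : M) : Prop :=
  ∃ m < j + 1, (j = 2 * m ∧ Dead k t (snocM k c i) m) ∨
    (j = 2 * m + 1 ∧ ∀ i' < k, i < i' → Dead k t (snocM k c i') m)

/-- The function coding all the races. -/
def RaceCode (k : M) (t : M → M) (y : M) : Prop :=
  ∃ c < y + 1, ∃ i < y + 1, ∃ j < y + 1, y = pairM (pairM c i) j ∧ Race k t c i j

theorem raceCode_iff (t : M → M) (c i j : M) :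
    RaceCode k t (pairM (pairM c i) j) ↔ Race k t c i j := by
  constructor
  · rintro ⟨c', -, i', -, j', -, e, h⟩
    obtain ⟨e', rfl⟩ := pairM_inj e
    obtain ⟨rfl, rfl⟩ := pairM_inj e'
    exact h
  · refine fun h => ⟨c, ?_, i, ?_, j, ?_, rfl, h⟩ <;> rw [lt_add_one_iff']
    · exact (left_le_pairM c i).trans (left_le_pairM _ j)
    · exact (right_le_pairM c i).trans (left_le_pairM _ j)
    · exact right_le_pairM _ j

section

variable {t p f s : M → M} [Definable₁ t] [Definable₁ p] [Definable₁ s]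
  (hk : 0 < k) (hp : ∀ y, 0 < p y ↔ RaceCode k t y)
  (hf : ∀ i j, First p i j → (f i = 0 → NotEven j) ∧ (f i ≠ 0 → NotOdd j))
  (hs : ∀ c, s c < k ∧ (∀ i < s c, f (pairM c i) ≠ 0) ∧ (f (pairM c (s c)) = 0 ∨ s c + 1 = k))
  (ht : ∀ m, ¬ Dead k t 0 m)

include hk hp hf

omit [Definable₁ t] in
-- Death of the child at height `m` shows up at stage `2 m`. The first event then occurs no later,
-- and by the answer `0` at an odd stage, so the right siblings have died at some height at most
-- `m`.
theorem dead_right {c i m : M} (hi : f (pairM c i) = 0) (h : Dead k t (snocM k c i) m) :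
    ∀ i' < k, i < i' → Dead k t (snocM k c i') m := by
  have h1 : Race k t c i (2 * m) :=
    ⟨m, by rw [lt_add_one_iff']; exact le_two_mul m, .inl ⟨rfl, h⟩⟩
  obtain ⟨j, hj, hfst⟩ := exists_first ((hp _).2 ((raceCode_iff t _ _ _).2 h1)).ne'
  have hodd := (notEven_iff j).1 ((hf _ _ hfst).1 hi)
  obtain ⟨m', -, h' | h'⟩ := (raceCode_iff t _ _ _).1 ((hp _).1 (pos_iff_ne_zero.2 hfst.1))
  · exact (hodd m' h'.1).elim
  · refine fun i' hi' hii => (h'.2 i' hi' hii).mono hk ?_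
    rw [h'.1] at hj
    exact le_of_mul_le_mul_left (le_self_add.trans hj) two_pos

omit [Definable₁ t] in
-- Death of the right siblings shows up at stage `2 m + 1`, while the first event must have an even
-- stage. That stage is at most `2 m`, so the child has died at height at most `m`.
theorem dead_left {c i m : M} (hi : f (pairM c i) ≠ 0)
    (h : ∀ i' < k, i < i' → Dead k t (snocM k c i') m) : Dead k t (snocM k c i) m := by
  have h1 : Race k t c i (2 * m + 1) :=
    ⟨m, by rw [lt_add_one_iff']; exact (le_two_mul m).trans le_self_add, .inr ⟨rfl, h⟩⟩
  obtain ⟨j, hj, hfst⟩ := exists_first ((hp _).2 ((raceCode_iff t _ _ _).2 h1)).ne'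
  have heven := (notOdd_iff j).1 ((hf _ _ hfst).2 hi)
  obtain ⟨m', -, h' | h'⟩ := (raceCode_iff t _ _ _).1 ((hp _).1 (pos_iff_ne_zero.2 hfst.1))
  · refine h'.2.mono hk ?_
    rw [h'.1] at hj
    rcases hj.eq_or_lt with hj | hj
    · exact (two_mul_ne _ _ hj).elim
    · rw [lt_add_one_iff'] at hj
      exact le_of_mul_le_mul_left hj two_pos
  · exact (heven m' h'.1).elim

include hs

omit [Definable₁ s] in
-- If the selected child is dead, so are its right siblings, by its answer or because there are
-- none. The nonzero answers at smaller entries then carry death leftwards, one child at a time.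
theorem dead_step {c m : M} (h : Dead k t (snocM k c (s c)) m) : Dead k t c (m + 1) := by
  obtain ⟨h1, h2, h3⟩ := hs c
  have hr : ∀ i' < k, s c < i' → Dead k t (snocM k c i') m := by
    rcases h3 with h3 | h3
    · exact dead_right hk hp hf h3 h
    · intro i' hi' hii
      rw [← h3, lt_add_one_iff'] at hi'
      exact (hii.not_ge hi').elim
  -- After `d` steps, all children from index `s c - d` on are known to be dead.
  have key := induction
    (P := fun d : M => d ≤ s c → ∀ i' < k, s c - d ≤ i' → Dead k t (snocM k c i') m)
    (fun _ i' hi' hii => by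
      rw [tsub_zero] at hii
      rcases hii.eq_or_lt with rfl | hii
      exacts [h, hr i' hi' hii])
    (fun d ih hd i' hi' hii => by
      have hd' : d < s c := (lt_iff_add_one_le _ _).2 hd
      have e : s c - (d + 1) + 1 = s c - d := by
        rw [← tsub_tsub, tsub_add_cancel_of_le]
        exact le_tsub_of_add_le_left hd
      rcases hii.eq_or_lt with rfl | hii
      · refine dead_left hk hp hf (h2 _ (tsub_lt_self_iff.2 ⟨pos_of_gt hd', by simp⟩)) ?_
        intro i'' hi'' hlt
        exact ih hd'.le i'' hi'' (e ▸ (lt_iff_add_one_le _ _).1 hlt)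
      · exact ih hd'.le i' hi' (e ▸ (lt_iff_add_one_le _ _).1 hii)) (s c) le_rfl
  exact .of_children hk fun i hi => key i hi (by rw [tsub_self]; exact zero_le)

include ht

theorem alive_follow (n : M) : InT k t (followM k s n) := by
  -- For a fixed target length `n`, the remaining height shrinks as the walk advances; the predicate
  -- is bounded, and at `i = n` it says that the node itself is in the tree.
  have key := induction (P := fun i : M => i ≤ n → ¬ Dead k t (followM k s i) (n - i))
    (fun _ => by rw [followM_zero, tsub_zero]; exact ht n)
    (fun i ih hi hd => by
      have hi' : i < n := (lt_iff_add_one_le _ _).2 hi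
      rw [followM_succ] at hd
      refine ih hi'.le ?_
      have e : n - (i + 1) + 1 = n - i := by
        rw [← tsub_tsub, tsub_add_cancel_of_le]
        exact le_tsub_of_add_le_left hi
      rw [← e]
      exact dead_step hk hp hf hs hd) n le_rfl
  rw [tsub_self, dead_iff hk] at key
  push Not at key
  obtain ⟨x, -, h2, h3⟩ := key
  rw [cutM_zero] at h2
  subst h2
  exact (inT_iff hk _ _).2 h3

omit [Definable₁ p] [Definable₁ t] hp hf hs ht in
-- The path consists of the nodes of the walk, recognised by comparing a sequence with the walk at
-- its own length; uniqueness of the successor is then uniqueness of the last entry.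
theorem follow_isPath {q : M → M} (hs : ∀ c, s c < k)
    (hq : ∀ c, 0 < q c ↔ c = followM k s (lenM k c)) (ht : ∀ n, InT k t (followM k s n)) :
    (∀ j, 0 < q (cutM k 0 j)) ∧ ∀ c, (∀ j, 0 < q (cutM k c j)) →
      (∀ j, 0 < t (cutM k c j)) ∧ s c < k ∧ (∀ j, 0 < q (cutM k (snocM k c (s c)) j)) ∧
      ∀ i, i < k → (∀ j, 0 < q (cutM k (snocM k c i) j)) → i = s c := by
  have hf (n : M) : s (followM k s n) < k := hs _
  have hb : IsBranch k (fun n => s (followM k s n)) (followM k s) :=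
    ⟨hf, followM_zero k s, followM_succ k s⟩
  have hqf (n j : M) : 0 < q (cutM k (followM k s n) j) := by
    rw [hb.cut, hq, hb.len]
  refine ⟨fun j => ?_, fun c hc => ?_⟩
  · have := hqf 0 j
    rwa [followM_zero] at this
  · have hc : c = followM k s (lenM k c) := by
      have := hc 0
      rwa [cutM_zero, hq] at this
    have e : snocM k c (s c) = followM k s (lenM k c + 1) := by rw [followM_succ, ← hc]
    refine ⟨?_, hs c, fun j => ?_, fun i hi hci => ?_⟩
    · have := (inT_iff hk _ _).1 (ht (lenM k c))
      rwa [← hc] at this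
    · rw [e]; exact hqf _ _
    · have := hci 0
      rw [cutM_zero, hq, lenM_snocM hi, ← e] at this
      rw [← lastM_snocM hi c, this, lastM_snocM (hs c)]

end

end Combinatorics

end IRCA

/-! ### Graph colorings inside a structure -/

namespace IRCA

open PRModel

section Colorings

variable {M : Type} [PRModel M] {k : M}

/-! ### From colorings to the lesser limited principle of omniscience -/

/-- The number of colors may be nonstandard, so the principle is proved by definable induction: the
number of colors used grows with every new argument and never exceeds `k`. -/
theorem pigeonhole {h : M → M} [Definable fun v => h (v 0)] {n : M} (hlt : ∀ i < n, h i < k)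
    (hinj : ∀ i < n, ∀ j < i, h j ≠ h i) : n ≤ k := by
  classical
  let χ (m c : M) : M := if ∃ j < m, h j = c then 1 else 0
  have hχ : Definable fun v : ℕ → M => χ (v 0) (v 1) := by
    change Definable fun v : ℕ → M => if ∃ j < v 0, h j = v 1 then 1 else 0
    infer_instance
  have hχ' (f g : (ℕ → M) → M) [Definable f] [Definable g] : Definable fun v => χ (f v) (g v) :=
    .comp₂ χ f g
  -- The sum counts the colors below `k` taken by the first `m` arguments; the color of the next
  -- argument is new.
  have h1 := induction (P := fun m : M => m ≤ n → m ≤ sumM (χ m) k) (fun _ => zero_le)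
    (fun m ih hm => by
      have hm' : m < n := (lt_iff_add_one_le _ _).2 hm
      rw [← lt_iff_add_one_le]
      refine (ih hm'.le).trans_lt (sumM_lt_sumM (χ m) (χ (m + 1)) (fun c _ => ?_) (hlt m hm') ?_)
      · simp only [χ]
        split_ifs with h1 h2
        · exact le_rfl
        · obtain ⟨j, hj, e⟩ := h1
          exact (h2 ⟨j, hj.trans (lt_add_one m), e⟩).elim
        · exact zero_le
        · exact le_rfl
      · simp only [χ]
        rw [if_neg, if_pos ⟨m, lt_add_one m, rfl⟩]
        · exact one_pos
        · rintro ⟨j, hj, e⟩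
          exact hinj m hm' j hj e) n le_rfl
  refine h1.trans ?_
  have h2 : sumM (χ n) k ≤ sumM (fun _ => 1) k := sumM_le_sumM (χ n) (fun _ => 1) fun c _ => by
    simp only [χ]; split_ifs <;> simp
  refine h2.trans (le_of_eq ?_)
  exact induction (P := fun k : M => sumM (fun _ => 1) k = k) (sumM_zero _)
    (fun k ih => by rw [sumM_succ (fun _ => 1), ih]) k

/-- Adjacency of `a < b` in the graph with vertices `w < k - 2` adjacent to all others, a vertex
`k - 2`, and for each `i` an infinite path of vertices `k - 1 + ⟨i, j⟩`, the vertex `k - 2` being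
adjacent to that with `j` the first nonzero argument of the `i`-th function. -/
def Adj (k : M) (p : M → M) (a b : M) : Prop :=
  a + 2 < k ∨ (∃ i < b + 1, ∃ j < b + 1, a + 2 = k ∧ b + 1 = k + pairM i j ∧ First p i j) ∨
    ∃ i < b + 1, ∃ j < b + 1, a + 1 = k + pairM i j ∧ b + 1 = k + pairM i (j + 1)

/-- The code of an adjacent pair. -/
def AdjCode (k : M) (p : M → M) (x : M) : Prop :=
  ∃ b < x + 2, ∃ a < b, x = edgeM a b ∧ Adj k p a b

theorem adjCode_iff (p : M → M) {a b : M} (hab : a < b) :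
    AdjCode k p (edgeM a b) ↔ Adj k p a b := by
  constructor
  · rintro ⟨b', -, a', hab', e, h⟩
    obtain ⟨rfl, rfl⟩ := edgeM_inj hab hab' e
    exact h
  · intro h
    refine ⟨b, ?_, a, hab, rfl, h⟩
    rw [← one_add_one_eq_two, ← add_assoc, lt_add_one_iff']
    exact edgeM_right_le hab

/-- The color `y` of the vertex `v` in a coloring of the graph up to `m`. -/
def ColSpec (k : M) (p : M → M) (m v y : M) : Prop :=
  y < k ∧ (v + 2 < k → y = v) ∧ (v + 2 = k → y + 1 = k) ∧
    ∀ i < v + 1, ∀ j < v + 1, v + 1 = k + pairM i j →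
      (((∃ j' < m + 1, First p i j' ∧ NotOdd j') ↔ NotOdd j) → y + 2 = k) ∧
      (¬ ((∃ j' < m + 1, First p i j' ∧ NotOdd j') ↔ NotOdd j) → y + 1 = k)

/-- The cases are universal vertices, the reference vertex and path vertices. The code of a path
vertex determines `i` and `j`, so its two clauses cannot conflict. -/
theorem exists_colSpec (hk : 2 ≤ k) (p : M → M) (m v : M) : ∃ y, ColSpec k p m v y := by
  obtain ⟨z, rfl⟩ := exists_add_of_le hk
  have hz : (2 : M) + z = z + 1 + 1 := by rw [add_assoc, one_add_one_eq_two, add_comm]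
  rcases lt_trichotomy v z with h | rfl | h
  · refine ⟨v, ?_, fun _ => rfl, fun e => ?_, fun i _ j _ e => ?_⟩
    · exact h.trans_le le_add_self
    · rw [add_comm] at e
      exact (h.ne (add_left_cancel e)).elim
    · have : v + 1 < 2 + z + pairM i j := by
        refine lt_of_lt_of_le ?_ le_self_add
        rw [hz, lt_add_one_iff']; gcongr
      exact (this.ne e).elim
  · refine ⟨v + 1, ?_, fun h => ?_, fun e => hz.symm, fun i _ j _ e => ?_⟩
    · rw [hz]; exact lt_add_one _
    · rw [add_comm] at h
      exact (lt_irrefl _ h).elim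
    · have : v + 1 < 2 + v + pairM i j := by
        refine lt_of_lt_of_le ?_ le_self_add
        rw [hz]; exact lt_add_one _
      exact (this.ne e).elim
  · have h1 : ¬ v + 2 < 2 + z := by
      rw [add_comm v]; exact not_lt.2 (add_le_add_right h.le 2)
    have h2 : v + 2 ≠ 2 + z := by
      rw [add_comm v]; exact fun e => h.ne' (add_left_cancel e)
    by_cases hv : ∃ i j, v + 1 = 2 + z + pairM i j ∧
      ((∃ j' < m + 1, First p i j' ∧ NotOdd j') ↔ NotOdd j)
    · obtain ⟨i, j, e, hij⟩ := hv
      refine ⟨z, ?_, fun h => (h1 h).elim, fun h => (h2 h).elim, fun i' _ j' _ e' => ?_⟩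
      · exact lt_of_lt_of_le (lt_add_one z) (by rw [hz]; exact le_self_add)
      · obtain ⟨rfl, rfl⟩ := pairM_inj (add_left_cancel (e.symm.trans e'))
        exact ⟨fun _ => add_comm _ _, fun h => (h hij).elim⟩
    · refine ⟨z + 1, ?_, fun h => (h1 h).elim, fun h => (h2 h).elim, fun i' _ j' _ e' => ?_⟩
      · rw [hz]; exact lt_add_one _
      · exact ⟨fun h => (hv ⟨i', j', e', h⟩).elim, fun _ => hz.symm⟩

theorem notOdd_add_one (j : M) : NotOdd (j + 1) ↔ ¬ NotOdd j := by
  rw [notOdd_iff_not j, not_not, notEven_iff, notOdd_iff]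
  refine forall_congr' fun m => not_congr ?_
  exact ⟨add_right_cancel, fun e => by rw [e]⟩

theorem bounds_of_vertex (hk : 0 < k) {v i j : M} (e : v + 1 = k + pairM i j) :
    i < v + 1 ∧ j < v + 1 := by
  have h : pairM i j < v + 1 := by rw [e]; exact lt_add_of_pos_left _ hk
  exact ⟨(left_le_pairM i j).trans_lt h, (right_le_pairM i j).trans_lt h⟩

/-- Universal vertices keep their own colors, the reference vertex gets `k - 1`, and each path
alternates between `k - 2` and `k - 1`. The phase is chosen so that the position joined to the
reference vertex gets `k - 2`; if no even first argument is found up to `m`, the odd positions do.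
-/
theorem colSpec_adj (hk : 0 < k) {p f : M → M} {m : M} (hf : ∀ v, ColSpec k p m v (f v)) {a b : M}
    (hab : a < b) (hb : b ≤ m) (h : Adj k p a b) : f a ≠ f b := by
  obtain ⟨-, a1, a2, a3⟩ := hf a
  obtain ⟨-, b1, b2, b3⟩ := hf b
  have two_ne {x y : M} (hx : x + 2 = k) (hy : y + 1 = k) : x ≠ y := by
    rintro rfl
    exact one_lt_two.ne (add_left_cancel (hy.trans hx.symm))
  have small : ∀ {x : M}, x + 2 < k → x + 1 ≠ k ∧ x + 2 ≠ k := fun {x} hx =>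
    ⟨((add_le_add_right one_le_two x).trans_lt hx).ne, hx.ne⟩
  rcases h with h | ⟨i, hi, j, hj, h1, h2, h3⟩ | ⟨i, hi, j, hj, h1, h2⟩
  · rw [a1 h]
    intro e
    rcases lt_trichotomy (b + 2) k with h' | h' | h'
    · rw [b1 h'] at e
      exact hab.ne e
    · have := b2 h'
      rw [← e] at this
      exact (small h).1 this
    · have h' := (lt_iff_add_one_le _ _).1 h'
      -- Pair codes are surjective, so every vertex beyond the reference vertex lies on a path.
      obtain ⟨d, hd⟩ := exists_add_of_le h'
      obtain ⟨i, j, rfl⟩ := exists_pairM d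
      have e' : b + 1 = k + pairM i j := by
        refine add_right_cancel (b := 1) ?_
        rw [add_assoc, one_add_one_eq_two, hd]; ring
      have hij := bounds_of_vertex hk e'
      by_cases hev : (∃ j' < m + 1, First p i j' ∧ NotOdd j') ↔ NotOdd j
      · have := (b3 i hij.1 j hij.2 e').1 hev
        rw [← e] at this
        exact (small h).2 this
      · have := (b3 i hij.1 j hij.2 e').2 hev
        rw [← e] at this
        exact (small h).1 this
  -- An even first argument `j` has been found, since it is below `b + 1 ≤ m + 1`; an odd one
  -- excludes a different, even first argument by uniqueness.
  · refine (two_ne ((b3 i hi j hj h2).1 ?_) (a2 h1)).symm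
    constructor
    · rintro ⟨j', -, h4, h5⟩
      rwa [h3.unique h4]
    · exact fun h4 => ⟨j, hj.trans_le (by gcongr), h3, h4⟩
  · have ha := bounds_of_vertex hk h1
    have hb := bounds_of_vertex hk h2
    have ha' := a3 i ha.1 j ha.2 h1
    have hb' := b3 i hb.1 (j + 1) hb.2 h2
    rw [notOdd_add_one] at hb'
    by_cases hev : (∃ j' < m + 1, First p i j' ∧ NotOdd j') ↔ NotOdd j
    · exact two_ne (ha'.1 hev) (hb'.2 fun h => iff_not_self (hev.symm.trans h))
    · exact (two_ne (hb'.1 (not_iff_comm.1 (not_iff.1 hev)).symm)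
        (ha'.2 hev)).symm

/-- With `k = z + 2`, the `z` universal vertices leave two colors for the reference vertex and the
paths. Hence exactly one of two consecutive path vertices shares the color of `z`, and this
alternates along the path. -/
theorem color_values {z : M} {p e c : M → M} [Definable₁ c]
    (he : ∀ x, 0 < e x ↔ AdjCode (z + 2) p x) (hc : ∀ v, c v < z + 2)
    (hce : ∀ a b, a < b → e (edgeM a b) ≠ 0 → c a ≠ c b) (i : M) :
    (∀ m, c (z + 1 + pairM i (2 * m)) = c z ↔ c (z + 1 + pairM i 0) = c z) ∧
    (∀ m, c (z + 1 + pairM i (2 * m + 1)) = c z ↔ ¬ c (z + 1 + pairM i 0) = c z) ∧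
    ∀ j, First p i j → c (z + 1 + pairM i j) ≠ c z := by
  classical
  have hone : (0 : M) < 1 := one_pos
  have hadj {a b : M} (hab : a < b) (h : Adj (z + 2) p a b) : c a ≠ c b :=
    hce a b hab ((he _).2 ((adjCode_iff p hab).2 h)).ne'
  have hu (w v : M) (hw : w < z) (hv : w < v) : c w ≠ c v := hadj hv (.inl (by gcongr))
  have hrv (j : M) : z < z + 1 + pairM i j := (lt_add_one z).trans_le le_self_add
  have e2 (j : M) : z + 1 + pairM i j + 1 = z + 2 + pairM i j := by
    rw [← one_add_one_eq_two]; ring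
  have hpath (j : M) : z + 1 + pairM i j < z + 1 + pairM i (j + 1) := by
    gcongr
    exact edgeM_lt ((lt_add_one_iff' _ _).2 le_self_add) (by rw [← add_assoc]; exact lt_add_one _) i
  have hstep (j : M) : c (z + 1 + pairM i j) ≠ c (z + 1 + pairM i (j + 1)) := by
    have h0 : (0 : M) < z + 2 := pos_of_gt (hc 0)
    have hb := bounds_of_vertex h0 (e2 (j + 1))
    exact hadj (hpath j) (.inr (.inr ⟨i, hb.1, j, (lt_add_one j).trans hb.2, e2 j, e2 (j + 1)⟩))
  have key (j : M) : c (z + 1 + pairM i (j + 1)) = c z ↔ ¬ c (z + 1 + pairM i j) = c z := by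
    refine ⟨fun h h' => hstep j (h'.trans h.symm), fun h => ?_⟩
    by_contra h'
    -- The vertices `0, …, z` and the two path vertices would be `z + 3` vertices with distinct
    -- colors below `z + 2`.
    let ν (w : M) : M := if w < z + 1 then w else if w < z + 2 then z + 1 + pairM i j else
      z + 1 + pairM i (j + 1)
    have hν : Definable fun v : ℕ → M => ν (v 0) := by
      change Definable fun v : ℕ → M => if v 0 < z + 1 then v 0 else if v 0 < z + 2 then
        z + 1 + pairM i j else z + 1 + pairM i (j + 1)
      infer_instance
    have := pigeonhole (h := fun w => c (ν w)) (n := z + 3) (fun w _ => hc _)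
      (fun w hw w' hw' => by
        have l1 : ν w = if w < z + 1 then w else if w < z + 2 then z + 1 + pairM i j else
          z + 1 + pairM i (j + 1) := rfl
        have l2 : ν w' = if w' < z + 1 then w' else if w' < z + 2 then z + 1 + pairM i j else
          z + 1 + pairM i (j + 1) := rfl
        have hz (j : M) : ¬ z + 1 + pairM i j = z := (hrv j).ne'
        rw [l1, l2]
        rcases lt_or_ge w' z with h1 | h1
        · rw [if_pos (h1.trans (lt_add_one z))]
          refine hu _ _ h1 ?_
          split_ifs
          · exact hw'
          · exact h1.trans (hrv j)
          · exact h1.trans (hrv _)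
        · rcases h1.eq_or_lt with rfl | h1
          · rw [if_pos (lt_add_one z), if_neg (not_lt.2 ((lt_iff_add_one_le _ _).1 hw'))]
            split_ifs
            · exact Ne.symm h
            · exact Ne.symm h'
          · have h1' := (lt_iff_add_one_le _ _).1 h1
            have h2' := (lt_iff_add_one_le _ _).1 hw'
            have hw2 : z + 2 ≤ w := by
              rw [← one_add_one_eq_two, ← add_assoc]; exact (add_le_add_left h1' 1).trans h2'
            have hw1 : z + 1 ≤ w := (add_le_add_right one_le_two z).trans hw2
            have h4 : w' < z + 2 := by
              rw [← one_add_one_eq_two, ← add_assoc]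
              refine hw'.trans_le ((lt_add_one_iff' _ _).1 (hw.trans_eq ?_))
              rw [add_assoc, add_assoc]; congr 1; norm_num
            rw [if_neg hw1.not_gt, if_neg hw2.not_gt, if_neg (not_lt.2 h1'), if_pos h4]
            exact hstep j)
    have h32 : z + 2 < z + 3 := by gcongr; norm_num
    exact h32.not_ge this
  have heven (m : M) : c (z + 1 + pairM i (2 * m)) = c z ↔ c (z + 1 + pairM i 0) = c z :=
    induction (P := fun m : M =>
        c (z + 1 + pairM i (2 * m)) = c z ↔ c (z + 1 + pairM i 0) = c z) (by rw [mul_zero])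
      (fun m ih => by
        rw [mul_add, mul_one, ← one_add_one_eq_two, ← add_assoc, key, key, one_add_one_eq_two, ih,
          not_not]) m
  refine ⟨heven, fun m => by rw [key, heven], fun j hj => ?_⟩
  have hb := bounds_of_vertex (pos_of_gt (hc 0)) (e2 j)
  exact (hadj (hrv j) (.inr (.inl ⟨i, hb.1, j, hb.2, rfl, e2 j, hj⟩))).symm

end Colorings

end IRCA

/-! ### Formulas expressing the combinatorial notions -/

namespace IRCA

open PRModel Formula Term

/-! ### Truth of formulas -/

section Semantics

variable {M : Type} [PRModel M] (v : ℕ → M) (φ : ℕ → M → M) (s t : Term) (A B : Formula)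

@[simp] theorem sat_eq : Sat (s ≐ t) v φ ↔ ev s v φ = ev t v φ := Iff.rfl
@[simp] theorem sat_and : Sat (A ⩑ B) v φ ↔ Sat A v φ ∧ Sat B v φ := Iff.rfl
@[simp] theorem sat_or : Sat (or A B) v φ ↔ Sat A v φ ∨ Sat B v φ := Iff.rfl
@[simp] theorem sat_imp : Sat (A ⇛ B) v φ ↔ (Sat A v φ → Sat B v φ) := Iff.rfl
@[simp] theorem sat_neg : Sat (neg A) v φ ↔ ¬ Sat A v φ := Iff.rfl
@[simp] theorem sat_iff : Sat (Formula.iff A B) v φ ↔ (Sat A v φ ↔ Sat B v φ) :=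
  iff_iff_implies_and_implies.symm
@[simp] theorem sat_allN : Sat (allN A) v φ ↔ ∀ x, Sat A (ext x v) φ := Iff.rfl
@[simp] theorem sat_exN : Sat (exN A) v φ ↔ ∃ x, Sat A (ext x v) φ := Iff.rfl
@[simp] theorem sat_le : Sat (le s t) v φ ↔ ev s v φ ≤ ev t v φ := Iff.rfl
@[simp] theorem sat_lt : Sat (lt s t) v φ ↔ ev s v φ < ev t v φ := by
  rw [Formula.lt, sat_le, ev_succ, lt_iff_add_one_le]

@[simp] theorem ev_sh_ext (x : M) : ev t.sh (ext x v) φ = ev t v φ := ev_sh t _ φ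

end Semantics

section QF

variable (s t : Term) (A B : Formula)

@[simp] theorem qf_eq : (s ≐ t).QF := trivial
@[simp] theorem qf_and : (A ⩑ B).QF ↔ A.QF ∧ B.QF := Iff.rfl
@[simp] theorem qf_or : (or A B).QF ↔ A.QF ∧ B.QF := Iff.rfl
@[simp] theorem qf_imp : (A ⇛ B).QF ↔ A.QF ∧ B.QF := Iff.rfl
@[simp] theorem qf_neg : (neg A).QF ↔ A.QF := ⟨fun h => h.1, fun h => ⟨h, trivial⟩⟩
@[simp] theorem qf_iff : (Formula.iff A B).QF ↔ A.QF ∧ B.QF := by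
  simp only [Formula.iff, qf_and, qf_imp]; tauto
@[simp] theorem qf_lt : (lt s t).QF := trivial
@[simp] theorem qf_ball : (ball s A).QF := trivial

end QF

/-! ### Quantifier-free formulas for the combinatorial notions -/

namespace Formula

/-- Bounded existential quantification of a quantifier-free formula. -/
def bex (n : Term) (A : Formula) : Formula := neg (ball n (neg A))

/-- Bounded form of `isFirst`. -/
def firstB (p : ℕ) (i j : Term) : Formula :=
  neg (app p (pair i j) ≐ zero) ⩑ ball j (app p (pair i.sh ♯0) ≐ zero)

def notEvenB (j : Term) : Formula := ball (succ j) (neg (j.sh ≐ mul two ♯0))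

def notOddB (j : Term) : Formula := ball (succ j) (neg (j.sh ≐ succ (mul two ♯0)))

/-- Bounded form of `inTree`. -/
def inTreeB (k : Term) (t : ℕ) (x : Term) : Formula :=
  ball (succ x) (lt zero (app t (cut k.sh x.sh ♯0)))

def correctB (k : Term) (p : ℕ) (c : Term) : Formula :=
  ball (len k c) (lt (entry k.sh c.sh ♯0) two ⩑
    ball (len k.sh c.sh) (firstB p ♯1 ♯0 ⇛
      ((entry k.sh.sh c.sh.sh ♯1 ≐ zero) ⇛ notEvenB ♯0) ⩑
      ((entry k.sh.sh c.sh.sh ♯1 ≐ one) ⇛ notOddB ♯0)))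

def validColB (k : Term) (e : ℕ) (c : Term) : Formula :=
  ball (len k c) (ball ♯0 (neg (app e (edgeCode ♯0 ♯1) ≐ zero) ⇛
    neg (entry k.sh.sh c.sh.sh ♯0 ≐ entry k.sh.sh c.sh.sh ♯1)))

/-- A bound on the codes of the sequences of length `m`. -/
def _root_.IRCA.Term.bound (k m : Term) : Term := prec zero (add (mul k.sh.sh ♯0) k.sh.sh) m

def deadB (k : Term) (t : ℕ) (c m : Term) : Formula :=
  ball (succ (bound k (add (len k c) m)))
    (neg ((len k.sh ♯0 ≐ add (len k.sh c.sh) m.sh) ⩑ (cut k.sh ♯0 m.sh ≐ c.sh) ⩑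
      inTreeB k.sh t ♯0))

def raceB (k : Term) (t : ℕ) (c i j : Term) : Formula :=
  bex (succ j) (or
    ((j.sh ≐ mul two ♯0) ⩑ deadB k.sh t (snoc k.sh c.sh i.sh) ♯0)
    ((j.sh ≐ succ (mul two ♯0)) ⩑
      ball k.sh (lt i.sh.sh ♯0 ⇛ deadB k.sh.sh t (snoc k.sh.sh c.sh.sh ♯0) ♯1)))

def raceCodeB (k : Term) (t : ℕ) (y : Term) : Formula :=
  bex (succ y) (bex (succ y.sh) (bex (succ y.sh.sh)
    ((y.sh.sh.sh ≐ pair (pair ♯2 ♯1) ♯0) ⩑ raceB k.sh.sh.sh t ♯2 ♯1 ♯0)))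

def adjB (k : Term) (p : ℕ) (a b : Term) : Formula :=
  or (lt (add a two) k) (or
    (bex (succ b) (bex (succ b.sh) ((add a.sh.sh two ≐ k.sh.sh) ⩑
      (succ b.sh.sh ≐ add k.sh.sh (pair ♯1 ♯0)) ⩑ firstB p ♯1 ♯0)))
    (bex (succ b) (bex (succ b.sh) ((succ a.sh.sh ≐ add k.sh.sh (pair ♯1 ♯0)) ⩑
      (succ b.sh.sh ≐ add k.sh.sh (pair ♯1 (succ ♯0)))))))

def adjCodeB (k : Term) (p : ℕ) (x : Term) : Formula :=
  bex (add x two) (bex ♯0 ((x.sh.sh ≐ edgeCode ♯0 ♯1) ⩑ adjB k.sh.sh p ♯0 ♯1))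

/-- The first nonzero value of the `i`-th function is found at an even argument up to `m`. -/
def evenFoundB (p : ℕ) (m i : Term) : Formula :=
  bex m (firstB p i.sh ♯0 ⩑ notOddB ♯0)

def colSpecB (k : Term) (p : ℕ) (m v y : Term) : Formula :=
  lt y k ⩑ (lt (add v two) k ⇛ (y ≐ v)) ⩑ ((add v two ≐ k) ⇛ (succ y ≐ k)) ⩑
    ball (succ v) (ball (succ v.sh) ((succ v.sh.sh ≐ add k.sh.sh (pair ♯1 ♯0)) ⇛
      (Formula.iff (evenFoundB p (succ m.sh.sh) ♯1) (notOddB ♯0) ⇛ (add y.sh.sh two ≐ k.sh.sh)) ⩑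
      (neg (Formula.iff (evenFoundB p (succ m.sh.sh) ♯1) (notOddB ♯0)) ⇛
        (succ y.sh.sh ≐ k.sh.sh))))

end Formula

section QF

variable (n k c i j y : Term) (A : Formula) (t : ℕ)

@[simp] theorem qf_bex : (bex n A).QF := ⟨trivial, trivial⟩
@[simp] theorem qf_firstB : (firstB t i j).QF := by simp [firstB]
@[simp] theorem qf_notEvenB : (notEvenB j).QF := trivial
@[simp] theorem qf_notOddB : (notOddB j).QF := trivial
@[simp] theorem qf_inTreeB : (inTreeB k t c).QF := trivial
@[simp] theorem qf_correctB : (correctB k t c).QF := trivial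
@[simp] theorem qf_validColB : (validColB k t c).QF := trivial
@[simp] theorem qf_deadB : (deadB k t c n).QF := trivial
@[simp] theorem qf_raceB : (raceB k t c i j).QF := by simp [raceB]
@[simp] theorem qf_raceCodeB : (raceCodeB k t c).QF := by simp [raceCodeB]
@[simp] theorem qf_adjB : (adjB k t i j).QF := by simp [adjB]
@[simp] theorem qf_adjCodeB : (adjCodeB k t c).QF := by simp [adjCodeB]
@[simp] theorem qf_evenFoundB : (evenFoundB t n i).QF := by simp [evenFoundB]
@[simp] theorem qf_colSpecB : (colSpecB k t n i y).QF := by simp [colSpecB]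

end QF

section Semantics

variable {M : Type} [PRModel M] {φ : ℕ → M → M} (hφ : ∀ i, Definable₁ (φ i)) (v : ℕ → M)

include hφ

theorem sat_bex (n : Term) (A : Formula) (hA : A.QF) :
    Sat (bex n A) v φ ↔ ∃ j < ev n v φ, Sat A (ext j v) φ := by
  rw [bex, sat_neg, sat_ball hφ _ _ (by simpa using hA)]
  simp

variable (k c i j m n y : Term) (p : ℕ)

theorem sat_firstB : Sat (firstB p i j) v φ ↔ First (φ p) (ev i v φ) (ev j v φ) := by
  simp [firstB, sat_ball hφ, First]

theorem sat_notEvenB : Sat (notEvenB j) v φ ↔ NotEven (ev j v φ) := by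
  simp [notEvenB, sat_ball hφ, NotEven]

theorem sat_notOddB : Sat (notOddB j) v φ ↔ NotOdd (ev j v φ) := by
  simp [notOddB, sat_ball hφ, NotOdd]

theorem sat_inTreeB : Sat (inTreeB k p c) v φ ↔ InT (ev k v φ) (φ p) (ev c v φ) := by
  simp [inTreeB, sat_ball hφ, InT]

theorem sat_correctB : Sat (correctB k p c) v φ ↔ Correct (ev k v φ) (φ p) (ev c v φ) := by
  simp [correctB, sat_ball hφ, sat_firstB hφ, sat_notEvenB hφ, sat_notOddB hφ, Correct]

theorem sat_validColB : Sat (validColB k p c) v φ ↔ ValidCol (ev k v φ) (φ p) (ev c v φ) := by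
  simp [validColB, sat_ball hφ, ValidCol]

omit hφ in
@[simp] theorem ev_bound : ev (bound k m) v φ = boundM (ev k v φ) (ev m v φ) := by
  simp only [bound, ev, ev_add, ev_mul, ev_sh, ext_succ]; rfl

theorem sat_deadB : Sat (deadB k p c m) v φ ↔ Dead (ev k v φ) (φ p) (ev c v φ) (ev m v φ) := by
  simp [deadB, sat_ball hφ, sat_inTreeB hφ, Dead]

theorem sat_raceB : Sat (raceB k p c i j) v φ ↔
    Race (ev k v φ) (φ p) (ev c v φ) (ev i v φ) (ev j v φ) := by
  simp [raceB, sat_ball hφ, sat_bex hφ, sat_deadB hφ, Race]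

theorem sat_raceCodeB : Sat (raceCodeB k p y) v φ ↔ RaceCode (ev k v φ) (φ p) (ev y v φ) := by
  simp [raceCodeB, sat_bex hφ, sat_raceB hφ, RaceCode]

theorem sat_adjB : Sat (adjB k p i j) v φ ↔ Adj (ev k v φ) (φ p) (ev i v φ) (ev j v φ) := by
  simp [adjB, sat_bex hφ, sat_firstB hφ, Adj]

theorem sat_adjCodeB : Sat (adjCodeB k p y) v φ ↔ AdjCode (ev k v φ) (φ p) (ev y v φ) := by
  simp [adjCodeB, sat_bex hφ, sat_adjB hφ, AdjCode]

theorem sat_evenFoundB : Sat (evenFoundB p m i) v φ ↔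
    ∃ j < ev m v φ, First (φ p) (ev i v φ) j ∧ NotOdd j := by
  simp [evenFoundB, sat_bex hφ, sat_firstB hφ, sat_notOddB hφ]

theorem sat_colSpecB : Sat (colSpecB k p m i y) v φ ↔
    ColSpec (ev k v φ) (φ p) (ev m v φ) (ev i v φ) (ev y v φ) := by
  simp [colSpecB, sat_ball hφ, sat_evenFoundB hφ, sat_notOddB hφ, ColSpec]

end Semantics

/-! ### Derivations from validity -/

section Derivations

variable {Γ : List Formula} {A B : Formula}

theorem Formula.QF.isE (hA : A.QF) : A.IsE := by
  induction A with
  | eq => trivial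
  | bot => trivial
  | and A B ihA ihB => exact ⟨ihA hA.1, ihB hA.2⟩
  | or A B ihA ihB => exact ⟨ihA hA.1, ihB hA.2⟩
  | imp A B => exact hA
  | _ => exact hA.elim

theorem Formula.QF.isH (hA : A.QF) : A.IsH := by
  induction A with
  | eq => trivial
  | bot => trivial
  | and A B ihA ihB => exact ⟨ihA hA.1, ihB hA.2⟩
  | or A B ihA ihB => exact hA
  | imp A B ihA ihB => exact ⟨hA.1.isE, ihB hA.2⟩
  | _ => exact hA.elim

theorem Formula.QF.isH_choose (hA : A.QF) :
    (allN (A.sub (scons (.app 0 ♯0) var) Nat.succ)).IsH :=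
  (hA.sub _ _).isH

theorem Proves.of_valid (h : Valid Γ A) (hA : A.IsP) : Γ ⊩ A := proves_of_valid A hA Γ h

/-- New functions enter derivations only by choice, by explicit definition and by the principles
themselves. The function introduced becomes number `0`, and its defining property remains in the
context for the semantic steps. -/
theorem Proves.choose (A : Formula) (hA : A.QF) (h : Γ ⊩ allN (exN A))
    (h' : allN (A.sub (scons (.app 0 ♯0) var) Nat.succ) :: Γ.map shF ⊩ B.shF) : Γ ⊩ B :=
  .exFE (.impE (.ax (.choice A hA)) h) h'

theorem Proves.define (s : Term) (h : allN (.app 0 ♯0 ≐ s.shF) :: Γ.map shF ⊩ B.shF) : Γ ⊩ B :=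
  .exFE (.comprehension s) h

theorem sat_choose {M : Type} [PRModel M] {v : ℕ → M} {φ : ℕ → M → M}
    (h : Sat (allN (A.sub (scons (.app 0 ♯0) var) Nat.succ)) v φ) (x : M) :
    Sat A (ext (φ 0 x) (ext x v)) (fun n => φ (n + 1)) := by
  have := (sat_sub A _ _ _ _).1 (h x)
  rwa [show (fun n => ev (scons (.app 0 ♯0) var n) (ext x v) φ) = ext (φ 0 x) (ext x v) by
    funext n; cases n <;> rfl] at this

theorem sat_define {M : Type} [PRModel M] {v : ℕ → M} {φ : ℕ → M → M} {s : Term}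
    (h : Sat (allN (.app 0 ♯0 ≐ s.shF)) v φ) (x : M) :
    φ 0 x = ev s (ext x v) (fun n => φ (n + 1)) := by
  rw [← ev_shF]; exact h x

theorem sat_separate {M : Type} [PRModel M] {v : ℕ → M} {φ : ℕ → M → M} (hA : A.QF)
    (h : Sat (allN (.app 0 ♯0 ≐ (IRCA.ind A).shF)) v φ) (x : M) :
    0 < φ 0 x ↔ Sat A (ext x v) (fun n => φ (n + 1)) := by
  rw [sat_define h, ev_ind A hA]

end Derivations

end IRCA

/-! ### Derivations from weak König's lemma -/

namespace IRCA

open PRModel Formula Term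

/-! ### Weak König's lemma gives functions -/

section Semantics

variable {M : Type} [PRModel M] (v : ℕ → M) (φ : ℕ → M → M)

theorem ev_code (k i : ℕ) (t : Term) :
    ev (prec zero (snoc ♯(k + 2) ♯0 (app i ♯1)) t) v φ = codeM (v k) (φ i) (ev t v φ) := by
  simp only [ev, ev_snoc]; rfl

theorem ev_follow (k i : ℕ) (t : Term) :
    ev (prec zero (snoc ♯(k + 2) ♯0 (app i ♯0)) t) v φ = followM (v k) (φ i) (ev t v φ) := by
  simp only [ev, ev_snoc]; rfl

theorem pos_of_two_le {k : M} (h : 2 ≤ k) : 0 < k := two_pos.trans_le h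

@[simp] theorem sat_inTree (k c : Term) (t : ℕ) :
    Sat (inTree k t c) v φ ↔ ∀ j, 0 < φ t (cutM (ev k v φ) (ev c v φ) j) := by
  simp [inTree]

@[simp] theorem sat_isFirst (p : ℕ) (i j : Term) :
    Sat (isFirst p i j) v φ ↔ First (φ p) (ev i v φ) (ev j v φ) := by
  simp [isFirst, First]

@[simp] theorem sat_isLLPO (p : ℕ) (i n : Term) : Sat (isLLPO p i n) v φ ↔
    (ev n v φ = 0 → ∀ j, First (φ p) (ev i v φ) j → ∀ m, j ≠ 2 * m) ∧
      (ev n v φ ≠ 0 → ev n v φ = 1 ∧ ∀ j, First (φ p) (ev i v φ) j → ∀ m, j ≠ 2 * m + 1) := by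
  simp [isLLPO]

theorem isP_isLLPO (p : ℕ) (i n : Term) : (isLLPO p i n).IsP := by
  simp [isLLPO, isFirst, IsP, IsH, IsE, neg, lt, le]

end Semantics

theorem inTreeB_of_inTree {Γ : List Formula} {k c : Term} {t : ℕ} (h : Γ ⊩ inTree k t c) :
    Γ ⊩ inTreeB k t c :=
  .cut h <| .of_valid (fun M _ v φ hφ H => by
    have h1 := H _ (.head _) trivial
    rw [sat_inTree] at h1
    rw [sat_inTreeB hφ]
    exact fun j _ => h1 j) trivial

theorem inTree_of_inTreeB {Γ : List Formula} {k c : Term} {t : ℕ} (hk : Γ ⊩ le two k)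
    (h : Γ ⊩ inTreeB k t c) : Γ ⊩ inTree k t c :=
  .cut hk <| .cut h.wk <| .of_valid (fun M _ v φ hφ H => by
    have h1 := H _ (.head _) trivial
    have h2 := H _ (.tail _ (.head _)) trivial
    rw [sat_le, ev_two] at h2
    rwa [sat_inTreeB hφ, inT_iff (pos_of_two_le h2), ← sat_inTree] at h1) trivial

/-- `isPath` is not a hypothesis of class `IsH`, since unbounded `inTree` formulas stand to the left
of implications. It is therefore unpacked by rules, with the bounded `inTreeB` in place of `inTree`,
until choice can produce a successor function. -/
theorem exists_fun_of_isPath : [isPath ♯0 1 0, le two ♯0] ⊩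
    exF (allN (lt (app 0 ♯0) ♯1 ⩑ lt zero (app 2 (prec zero (snoc ♯3 ♯0 (app 0 ♯1)) ♯0)))) := by
  have h0 : [isPath ♯0 1 0, le two ♯0] ⊩ inTreeB ♯0 0 zero := inTreeB_of_inTree (.andE₁ .here)
  have hp : [inTreeB ♯1 0 ♯0, isPath ♯1 1 0, le two ♯1] ⊩ (inTree ♯1 1 ♯0 ⩑
      exN (lt ♯0 ♯2 ⩑ inTree ♯2 0 (snoc ♯2 ♯1 ♯0) ⩑
      allN (lt ♯0 ♯3 ⇛ inTree ♯3 0 (snoc ♯3 ♯2 ♯0) ⇛ (♯0 ≐ ♯1)))) :=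
    .impE (.allNE ♯0 (.andE₂ (A := inTree ♯1 0 zero) (.hyp (.tail _ (.head _)))))
      (inTree_of_inTreeB (.hyp (.tail _ (.tail _ (.head _)))) .here)
  have h1 : [isPath ♯0 1 0, le two ♯0] ⊩ allN (inTreeB ♯1 0 ♯0 ⇛ inTreeB ♯1 1 ♯0) :=
    .allNI (.impI (inTreeB_of_inTree (.andE₁ hp)))
  have h2 : [isPath ♯0 1 0, le two ♯0] ⊩
      allN (exN (inTreeB ♯2 0 ♯1 ⇛ (lt ♯0 ♯2 ⩑ inTreeB ♯2 0 (snoc ♯2 ♯1 ♯0)))) := by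
    refine .allNI (.orE (A := inTreeB ♯1 0 ♯0) (.em trivial) ?_ ?_)
    · refine .exNE (.andE₂ hp) (.exNI ♯0 (.impI (.wk (.andI (.andE₁ .here) ?_))))
      exact inTreeB_of_inTree (.andE₁ (.andE₂ .here))
    -- Choice needs a total relation; off the path any value will do, here `0`.
    · refine .of_valid (fun M _ v φ hφ H => ⟨0, fun h => ?_⟩) (by simp [IsP, IsE])
      exact (H _ (.head _) (by simp [IsH, neg]; trivial) h).elim
  refine .cut h0 (.cut h1.wk (.choose _ (by simp) h2.wk.wk ?_))
  -- The entry at `n` is the successor function applied to the node reached after `n` steps.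
  refine .define (.app 0 (prec zero (snoc ♯3 ♯0 (app 0 ♯0)) ♯0)) (.exFI 0 ?_)
  change _ ⊩ allN (lt (app 0 ♯0) ♯1 ⩑
    lt zero (app 3 (prec zero (snoc ♯3 ♯0 (app 0 ♯1)) ♯0)))
  refine .of_valid (fun M _ v φ hφ H => ?_) ⟨trivial, trivial⟩
  have hf := sat_define (H _ (.head _) trivial)
  have hs := sat_choose ((sat_shF _ _ _).1 (H _ (.tail _ (.head _)) (by trivial)))
  have ht : Sat (allN (inTreeB ♯1 2 ♯0 ⇛ inTreeB ♯1 3 ♯0)) v φ :=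
    H _ (.tail _ (.tail _ (.head _))) ⟨trivial, trivial⟩
  have h0 : Sat (inTreeB ♯0 2 zero) v φ := H _ (.tail _ (.tail _ (.tail _ (.head _)))) trivial
  have hk : Sat (le two ♯0) v φ :=
    H _ (.tail _ (.tail _ (.tail _ (.tail _ (.tail _ (.head _)))))) trivial
  simp [sat_inTreeB, ev_follow, ev_code] at hf hs ht h0 hk ⊢
  exact path_fun (pos_of_two_le hk) h0 ht hs hf

theorem exists_fun_of_wkl {Γ : List Formula} (hW : WKLn ♯0 ∈ Γ) (hk : le two ♯0 ∈ Γ)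
    (ht : Γ ⊩ infiniteTree ♯0 0) : Γ ⊩ exF (allN (lt (app 0 ♯0) ♯1 ⩑
      lt zero (app 1 (prec zero (snoc ♯3 ♯0 (app 0 ♯1)) ♯0)))) := by
  refine .exFE (A := isPath ♯0 1 0) (.impE (.allFE 0 (.hyp hW)) ht)
    (.exFE (exists_fun_of_isPath.weaken ?_) (.exFI 0 .here))
  rintro B (_ | ⟨_, _ | ⟨_, ⟨⟩⟩⟩)
  · exact .head _
  · exact .tail _ (List.mem_map_of_mem (f := Formula.shF) hk)

theorem llpo_of_wkl : [WKLn ♯0, le two ♯0] ⊩ LLPOhat := by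
  refine .allFI (.define (IRCA.ind (correctB ♯1 0 ♯0)) ?_)
  refine .exFE (exists_fun_of_wkl (.tail _ (.head _)) (.tail _ (.tail _ (.head _))) ?_)
    (.exFI 0 ?_)
  · refine .allNI ?_
    refine .choose (or ((♯0 ≐ one) ⩑ evenFoundB 1 ♯2 ♯1) ((♯0 ≐ zero) ⩑ neg (evenFoundB 1 ♯2 ♯1)))
      (by simp) (.of_valid (fun M _ v φ hφ H i => ?_) (by simp [IsP, IsE]; trivial)) ?_
    · by_cases h : Sat (evenFoundB 1 ♯2 ♯1) (ext 0 (ext i v)) φ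
      · refine ⟨1, .inl ⟨rfl, ?_⟩⟩
        simpa [sat_evenFoundB] using h
      · refine ⟨0, .inr ⟨rfl, ?_⟩⟩
        simpa [sat_evenFoundB] using h
    -- The witness is given as a term because an existential goal with `inTree` inside is not of
    -- class `IsP`.
    · refine .exNI (prec zero (snoc ♯3 ♯0 (app 0 ♯1)) ♯0) ?_
      change _ ⊩ (len ♯1 (prec zero (snoc ♯3 ♯0 (app 0 ♯1)) ♯0) ≐ ♯0) ⩑
        inTree ♯1 1 (prec zero (snoc ♯3 ♯0 (app 0 ♯1)) ♯0)
      refine .of_valid (fun M _ v φ hφ H => ?_) ⟨trivial, trivial⟩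
      have hf := sat_choose (H _ (.head _) (QF.isH_choose (by simp)))
      have ht := sat_separate (by simp)
        ((sat_sh _ _ _).1 ((sat_shF _ _ _).1 (H _ (.tail _ (.head _)) trivial)))
      have hk : Sat (le two ♯1) v φ := H _ (.tail _ (.tail _ (.tail _ (.head _)))) trivial
      simp [sat_evenFoundB, sat_correctB, ev_code, -not_exists, -not_and] at hf ht hk ⊢
      exact correct_code hk ht hf
  · change _ ⊩ allN (isLLPO 2 ♯0 (app 0 ♯0))
    refine .of_valid (fun M _ v φ hφ H => ?_) (isP_isLLPO _ _ _)
    have hf := H _ (.head _) ⟨trivial, trivial⟩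
    have ht := sat_separate (by simp) ((sat_shF _ _ _).1 (H _ (.tail _ (.head _)) trivial))
    simp [sat_correctB, ev_code] at hf ht
    exact fun i => (sat_isLLPO ..).2 (correct_values ht hf i)

theorem gc_of_wkl : [WKLn ♯0, le two ♯0] ⊩ GC ♯0 := by
  refine .allFI (.impI (.define (IRCA.ind (validColB ♯1 0 ♯0)) ?_))
  refine .exFE (exists_fun_of_wkl (.tail _ (.tail _ (.head _)))
    (.tail _ (.tail _ (.tail _ (.head _)))) ?_) (.exFI 0 ?_)
  · refine .allNI (.exNE (A := (len ♯2 ♯0 ≐ succ ♯1) ⩑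
      allN (allN (lt ♯1 ♯0 ⇛ le ♯0 ♯3 ⇛ edge 1 ♯1 ♯0 ⇛
        neg (entry ♯4 ♯2 ♯1 ≐ entry ♯4 ♯2 ♯0))))
      -- A coloring of the subgraph with vertices `0, …, m` is one entry too long for level `m`; its
      -- parent is the witness.
      (.allNE ♯0 (A := finColorable ♯2 1 ♯0) (.hyp (.tail _ (.head _)))) (.exNI (parent ♯2 ♯0) ?_))
    change _ ⊩ (len ♯2 (parent ♯2 ♯0) ≐ ♯1) ⩑ inTree ♯2 0 (parent ♯2 ♯0)
    refine .of_valid (fun M _ v φ hφ H => ?_) ⟨trivial, trivial⟩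
    have hc := H _ (.head _) (by simp [IsH, IsE, QF, neg, edge, lt, le])
    have ht := sat_separate (by simp)
      ((sat_sh _ _ _).1 ((sat_sh _ _ _).1 (H _ (.tail _ (.head _)) trivial)))
    have hk : Sat (le two ♯2) v φ :=
      H _ (.tail _ (.tail _ (.tail _ (.tail _ (.head _))))) trivial
    simp [sat_validColB, edge] at hc ht hk ⊢
    exact validCol_parent (pos_of_two_le hk) ht hc.1 hc.2
  · change _ ⊩ allN (lt (app 0 ♯0) ♯1) ⩑
      allN (allN (lt ♯1 ♯0 ⇛ edge 2 ♯1 ♯0 ⇛ neg (app 0 ♯1 ≐ app 0 ♯0)))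
    refine .of_valid (fun M _ v φ hφ H => ?_) (by simp [IsP, IsH, IsE, neg, edge, lt, le])
    have hf := H _ (.head _) ⟨trivial, trivial⟩
    have ht := sat_separate (by simp) ((sat_shF _ _ _).1 (H _ (.tail _ (.head _)) trivial))
    simp [sat_validColB, ev_code, edge] at hf ht ⊢
    exact ⟨fun n => (hf n).1, fun a b hab h => validCol_fun ht hf hab h⟩

end IRCA

/-! ### Converse derivations and the equivalences -/

namespace IRCA

open PRModel Formula Term

theorem llpo_of_gc : [GC ♯0, le two ♯0] ⊩ LLPOhat := by
  refine .allFI (.define (IRCA.ind (adjCodeB ♯1 0 ♯0)) ?_)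
  refine .cut (A := allN (finColorable ♯1 0 ♯0)) ?_
    (.exFE (A := isColoring ♯0 1 0) (.impE (.allFE 0 (.hyp (.tail _ (.tail _ (.head _))))) .here) ?_)
  · refine .allNI (.choose (colSpecB ♯3 1 ♯2 ♯1 ♯0) (by simp)
      (.of_valid (fun M _ v φ hφ H i => ?_) (QF.isE (by simp))) ?_)
    · have hk : Sat (le two ♯1) v φ := H _ (.tail _ (.tail _ (.head _))) trivial
      simp [sat_colSpecB] at hk ⊢
      exact exists_colSpec hk _ _ _
    · refine .exNI (prec zero (snoc ♯3 ♯0 (app 0 ♯1)) (succ ♯0)) ?_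
      change _ ⊩ (len ♯1 (prec zero (snoc ♯3 ♯0 (app 0 ♯1)) (succ ♯0)) ≐ succ ♯0) ⩑
        allN (allN (lt ♯1 ♯0 ⇛ le ♯0 ♯2 ⇛ edge 1 ♯1 ♯0 ⇛
          neg (entry ♯3 (prec zero (snoc ♯5 ♯0 (app 0 ♯1)) (succ ♯2)) ♯1 ≐
            entry ♯3 (prec zero (snoc ♯5 ♯0 (app 0 ♯1)) (succ ♯2)) ♯0)))
      refine .of_valid (fun M _ v φ hφ H => ?_) (by simp [IsP, IsH, IsE, neg, edge, lt, le])
      have hf := sat_choose (H _ (.head _) (QF.isH_choose (by simp)))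
      have he := sat_separate (by simp)
        ((sat_sh _ _ _).1 ((sat_shF _ _ _).1 (H _ (.tail _ (.head _)) trivial)))
      have hk : Sat (le two ♯1) v φ := H _ (.tail _ (.tail _ (.tail _ (.head _)))) trivial
      simp [sat_colSpecB, sat_adjCodeB, ev_code, edge] at hf he hk ⊢
      have hb := isBranch_codeM (f := φ 0) fun n => (hf n).1
      refine ⟨hb.len _, fun a b hab hbm h => ?_⟩
      rw [hb.entry ((lt_add_one_iff' _ _).2 (hab.le.trans hbm)), hb.entry ((lt_add_one_iff' _ _).2 hbm)]
      exact colSpec_adj (pos_of_two_le hk) hf hab hbm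
        ((adjCode_iff _ hab).1 ((he _).1 (pos_iff_ne_zero.2 h)))
  -- With `k = z + 2` the terms name the start of the `i`-th path, `z + 1 + ⟨i, 0⟩`, and the
  -- reference vertex `z`; equal colors give the value `0`.
  · refine .choose (or ((♯0 ≐ zero) ⩑ (app 0 (add (tsub ♯2 one) (pair ♯1 zero)) ≐
      app 0 (tsub ♯2 two))) ((♯0 ≐ one) ⩑ neg (app 0 (add (tsub ♯2 one) (pair ♯1 zero)) ≐
      app 0 (tsub ♯2 two)))) (by simp) (.of_valid (fun M _ v φ hφ H i => ?_) (QF.isE (by simp))) ?_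
    · by_cases h : Sat (app 0 (add (tsub ♯2 one) (pair ♯1 zero)) ≐ app 0 (tsub ♯2 two))
        (ext 0 (ext i v)) φ
      · refine ⟨0, .inl ⟨rfl, ?_⟩⟩
        simpa using h
      · refine ⟨1, .inr ⟨rfl, ?_⟩⟩
        simpa using h
    · refine .exFI 0 ?_
      change _ ⊩ allN (isLLPO 3 ♯0 (app 0 ♯0))
      refine .of_valid (fun M _ v φ hφ H => ?_) (isP_isLLPO _ _ _)
      have hf := sat_choose (H _ (.head _) (QF.isH_choose (by simp)))
      have hc := (sat_shF _ _ _).1 (H _ (.tail _ (.head _))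
        ⟨trivial, trivial, ⟨trivial, trivial⟩, trivial, trivial⟩)
      have he := sat_separate (by simp) ((sat_shF _ _ _).1 ((sat_shF _ _ _).1
        (H _ (.tail _ (.tail _ (.tail _ (.head _)))) trivial)))
      have hk : Sat (le two ♯0) v φ :=
        H _ (.tail _ (.tail _ (.tail _ (.tail _ (.tail _ (.head _)))))) trivial
      simp [sat_adjCodeB, isColoring, edge] at hf he hc hk
      intro i
      rw [sat_isLLPO]
      obtain ⟨z, hz⟩ := exists_add_of_le hk
      rw [add_comm] at hz
      have e1 : z + 2 - 1 = z + 1 := by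
        rw [← one_add_one_eq_two, ← add_assoc, add_tsub_cancel_right]
      rw [hz] at he hc hf
      simp only [add_tsub_cancel_right, e1] at hf
      obtain ⟨h1, h2, h3⟩ := color_values he hc.1 hc.2 i
      refine ⟨fun h j hj m e => h3 j hj ?_, fun h => ?_⟩
      · rw [e, h1]
        rcases hf i with h' | h'
        · exact h'.2
        · exact (zero_ne_one (h.symm.trans h'.1)).elim
      · rcases hf i with h' | h'
        · exact (h h'.1).elim
        · exact ⟨h'.1, fun j hj m e => h3 j hj (by rw [e, h2]; exact h'.2)⟩

/-- An element of length `m` extends the empty sequence by `m` entries. This moves infinitude into a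
hypothesis of class `IsH`, which the existential original is not. -/
theorem not_dead_of_infiniteTree : [infiniteTree ♯0 0, le two ♯0] ⊩
    allN (neg (deadB ♯1 0 zero ♯0)) := by
  refine .allNI (.impI (.exNE (A := (len ♯2 ♯0 ≐ ♯1) ⩑ inTree ♯2 0 ♯0)
    (.allNE ♯0 (A := exN ((len ♯3 ♯0 ≐ ♯1) ⩑ inTree ♯3 0 ♯0)) (.hyp (.tail _ (.head _)))) ?_))
  refine .of_valid (fun M _ v φ hφ H => ?_) trivial
  have hc := H _ (.head _) ⟨trivial, trivial⟩
  have hd : Sat (deadB ♯2 0 zero ♯1) v φ := H _ (.tail _ (.head _)) trivial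
  have hk : Sat (le two ♯2) v φ := H _ (.tail _ (.tail _ (.tail _ (.head _)))) trivial
  simp [sat_deadB] at hc hd hk
  have hk := pos_of_two_le hk
  refine (dead_iff hk _ _ _).1 hd (v 0) ⟨?_, ?_, hc.2⟩
  · rw [lenM_zero, zero_add, hc.1]
  · rw [← hc.1, cutM_len hk]

/-- The values given by the principle, in terms of bounded quantifiers. -/
theorem values_of_llpo : [allN (isLLPO 1 ♯0 (app 0 ♯0))] ⊩ allN (allN (firstB 1 ♯1 ♯0 ⇛
    ((app 0 ♯1 ≐ zero) ⇛ notEvenB ♯0) ⩑ (neg (app 0 ♯1 ≐ zero) ⇛ notOddB ♯0))) := by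
  refine .allNI (.allNI (.impI ?_))
  have hL : [firstB 1 ♯1 ♯0, allN (isLLPO 1 ♯0 (app 0 ♯0))] ⊩ isLLPO 1 ♯1 (app 0 ♯1) :=
    .allNE ♯1 (A := isLLPO 1 ♯0 (app 0 ♯0)) (.hyp (.tail _ (.head _)))
  -- The premise `isFirst` has an unbounded quantifier, so the LLPO hypothesis cannot be read
  -- semantically; its premise is first proved from the bounded version.
  have hF : [firstB 1 ♯1 ♯0, allN (isLLPO 1 ♯0 (app 0 ♯0))] ⊩ isFirst 1 ♯1 ♯0 := by
    refine .of_valid (fun M _ v φ hφ H => ?_) (by simp [isFirst, IsP, IsH, neg, lt, le])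
    rw [sat_isFirst]
    exact (sat_firstB hφ ..).1 (H _ (.head _) (QF.isH (by simp)))
  refine .andI (.impI ?_) (.impI ?_)
  · refine .cut (.impE (.allNE ♯0 (.impE (.andE₁ hL.wk) .here)) hF.wk) ?_
    refine .of_valid (fun M _ v φ hφ H => ?_) trivial
    have h : Sat (allN (neg (♯1 ≐ mul two ♯0))) v φ := H _ (.head _) ⟨trivial, trivial⟩
    rw [sat_notEvenB hφ, notEven_iff]
    simpa using h
  · refine .cut (.impE (.allNE ♯0 (.andE₂ (.impE (.andE₂ hL.wk) .here))) hF.wk) ?_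
    refine .of_valid (fun M _ v φ hφ H => ?_) trivial
    have h : Sat (allN (neg (♯1 ≐ succ (mul two ♯0)))) v φ := H _ (.head _) ⟨trivial, trivial⟩
    rw [sat_notOddB hφ, notOdd_iff]
    simpa using h

theorem wkl_of_llpo : [LLPOhat, le two ♯0] ⊩ WKLn ♯0 := by
  refine .allFI (.impI (.cut (not_dead_of_infiniteTree.weaken (by simp; tauto)) ?_))
  refine .define (IRCA.ind (raceCodeB ♯1 0 ♯0)) ?_
  refine .exFE (A := allN (isLLPO 1 ♯0 (app 0 ♯0)))
    (.allFE 0 (.hyp (.tail _ (.tail _ (.tail _ (.head _)))))) ?_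
  refine .cut (values_of_llpo.weaken (by simp)) ?_
  -- The least entry with answer `0`, or the last entry `k - 1` if no earlier one has it; a value
  -- exists by the least-number principle.
  refine .choose (lt ♯0 ♯2 ⩑ ball ♯0 (neg (app 0 (pair ♯2 ♯0) ≐ zero)) ⩑
    or (app 0 (pair ♯1 ♯0) ≐ zero) (succ ♯0 ≐ ♯2)) (by simp)
    (.of_valid (fun M _ v φ hφ H c => ?_) (QF.isE (by simp))) ?_
  · have hk : Sat (le two ♯0) v φ :=
      H _ (.tail _ (.tail _ (.tail _ (.tail _ (.tail _ (.tail _ (.head _))))))) trivial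
    simp [sat_ball hφ] at hk ⊢
    obtain ⟨z, hz⟩ := exists_eq_add_one (pos_of_two_le hk).ne'
    obtain ⟨y, hy, h, hmin⟩ := exists_least
      (P := fun y => φ 0 (pairM c y) = 0 ∨ y + 1 = v 0) (.inr hz.symm : _ ∨ z + 1 = v 0)
    exact ⟨y, by rw [hz, lt_add_one_iff']; exact hy, fun i hi e => hmin i hi (.inl e), h⟩
  refine .define (IRCA.ind (♯0 ≐ prec zero (snoc ♯3 ♯0 (app 0 ♯0)) (len ♯1 ♯0))) (.exFI 0 ?_)
  change _ ⊩ isPath ♯0 4 0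
  -- The successor is given explicitly, since the existential quantifier in `isPath` governs
  -- unbounded quantifiers and falls outside `IsP`; it is reintroduced by rule afterwards.
  refine .cut (A := inTree ♯0 0 zero ⩑ allN (inTree ♯1 0 ♯0 ⇛ (inTree ♯1 4 ♯0 ⩑
    (lt (app 1 ♯0) ♯1 ⩑ inTree ♯1 0 (snoc ♯1 ♯0 (app 1 ♯0)) ⩑
      allN (lt ♯0 ♯2 ⇛ inTree ♯2 0 (snoc ♯2 ♯1 ♯0) ⇛ (♯0 ≐ app 1 ♯1)))))) ?_ ?_
  · refine .of_valid (fun M _ v φ hφ H => ?_)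
      (by simp [IsP, IsH, inTree, lt, le])
    have hq := sat_separate (by simp) (H _ (.head _) trivial)
    have hs := sat_choose ((sat_shF _ _ _).1 (H _ (.tail _ (.head _))
      ((isH_sub _ _ _).2 (QF.isH_choose (by simp)))))
    have hf : Sat (allN (allN (firstB 3 ♯1 ♯0 ⇛ ((app 2 ♯1 ≐ zero) ⇛ notEvenB ♯0) ⩑
      (neg (app 2 ♯1 ≐ zero) ⇛ notOddB ♯0)))) v φ :=
        H _ (.tail _ (.tail _ (.head _))) (QF.isH (A := firstB 3 ♯1 ♯0 ⇛
          ((app 2 ♯1 ≐ zero) ⇛ notEvenB ♯0) ⩑ (neg (app 2 ♯1 ≐ zero) ⇛ notOddB ♯0)) (by simp))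
    have hp := sat_separate (by simp) ((sat_shF _ _ _).1 ((sat_shF _ _ _).1 ((sat_shF _ _ _).1
      (H _ (.tail _ (.tail _ (.tail _ (.tail _ (.head _))))) trivial))))
    have hd : Sat (allN (neg (deadB ♯1 4 zero ♯0))) v φ :=
      H _ (.tail _ (.tail _ (.tail _ (.tail _ (.tail _ (.head _)))))) ⟨trivial, trivial⟩
    have hk : Sat (le two ♯0) v φ := H _ (.tail _ (.tail _ (.tail _ (.tail _ (.tail _ (.tail _
      (.tail _ (.tail _ (.head _))))))))) trivial
    simp [sat_ball, sat_firstB, sat_notEvenB, sat_notOddB, sat_raceCodeB, sat_deadB, ev_follow]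
      at hq hs hf hp hd hk ⊢
    have hk := pos_of_two_le hk
    exact follow_isPath hk (fun c => (hs c).1) hq (alive_follow hk hp hf hs hd)
  · refine .andI (.andE₁ .here) (.allNI (.impI (.cut (A := inTree ♯1 4 ♯0 ⩑
      (lt (app 1 ♯0) ♯1 ⩑ inTree ♯1 0 (snoc ♯1 ♯0 (app 1 ♯0)) ⩑
        allN (lt ♯0 ♯2 ⇛ inTree ♯2 0 (snoc ♯2 ♯1 ♯0) ⇛ (♯0 ≐ app 1 ♯1))))
      (.impE (.allNE ♯0 (.andE₂ (A := inTree ♯1 0 zero) (.hyp (.tail _ (.head _))))) .here)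
      (.andI (.andE₁ .here) (.exNI (app 1 ♯0) (.andE₂ .here))))))

/-! ### The equivalences -/

/-- Derivability for all bases gives derivability for base `2`. -/
theorem Proves.base_two {Γ : List Formula} {A : Formula} (h : [le two ♯0] ⊩ A) :
    Γ ⊩ A.inst two := by
  have h2 : Γ ⊩ le two two := .of_valid (fun M _ v φ _ _ => by simp) trivial
  have h1 : [] ⊩ allN (le two ♯0 ⇛ A) := .allNI (.impI h)
  exact .impE (.allNE two (h1.weaken (by simp))) h2

theorem wkl_iff_llpo (Γ : List Formula) : Γ ⊩ Formula.iff WKL LLPOhat :=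
  .andI (.base_two (A := WKLn ♯0 ⇛ LLPOhat) (.impI llpo_of_wkl))
    (.base_two (A := LLPOhat ⇛ WKLn ♯0) (.impI wkl_of_llpo))

/-- LLPO does not mention `k`, so it links the principle for base `k` with the binary one; no tree
has to be recoded from one base to another. -/
theorem Proves.iff_of_llpo {Γ : List Formula} {A : Formula} (h : A :: Γ ⊩ LLPOhat)
    (h' : LLPOhat :: Γ ⊩ A) : Γ ⊩ Formula.iff WKL A :=
  .andI (.impI (.cut (.impE (.andE₁ (wkl_iff_llpo _)) .here)
      (h'.weaken (by simp [List.subset_def]; tauto))))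
    (.impI (.impE (.andE₂ (wkl_iff_llpo _)) h))

theorem gc_of_llpo : [LLPOhat, le two ♯0] ⊩ GC ♯0 :=
  .cut wkl_of_llpo (gc_of_wkl.weaken (by simp))

end IRCA

theorem mainTheorem4 :
    IRCA.Proves IRCA.iRCA0 []
      (IRCA.Formula.allN
        (IRCA.Formula.le IRCA.Term.two (IRCA.Term.var 0) ⇛
          (IRCA.Formula.iff IRCA.Formula.WKL IRCA.Formula.LLPOhat ⩑
           IRCA.Formula.iff IRCA.Formula.WKL (IRCA.Formula.WKLn (IRCA.Term.var 0)) ⩑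
           IRCA.Formula.iff IRCA.Formula.WKL (IRCA.Formula.GC (IRCA.Term.var 0))))) :=
  .allNI (.impI (.andI (IRCA.wkl_iff_llpo _)
    (.andI (.iff_of_llpo IRCA.llpo_of_wkl IRCA.wkl_of_llpo)
      (.iff_of_llpo IRCA.llpo_of_gc IRCA.gc_of_llpo))))
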